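/- For real parameters $\lambda,\mu,\beta$ let $Z_{\lambda,\mu,\beta}=(X,Y)$ be the non-smooth vector field on $\mathbb R^2$ with switching line $\Sigma=\{y=0\}$, $f(x,y)=y$, given by $X=(1,\;x-\lambda)$ for $y\ge 0$ and $$Y=\Big(\tfrac{\mu}{2}x+\tfrac{\mu-2}{2}(y+\beta),\ \tfrac{\mu-2}{2}x+\tfrac{\mu}{2}(y+\beta)\Big)\quad\text{for } y\le 0 .$$ On $\Sigma$, sewing, escaping and sliding mean $(X.f)(Y.f)>0$; $X.f>0>Y.f$; $X.f<0<Y.f$. On the last two regions $Z^\Sigma$ is Filippov's sliding (escaping) field; its zeros are the pseudo-equilibria. A pseudo-equilibrium is a $\Sigma$-saddle if it is an attractor of $Z^\Sigma$ in the escaping region or a repeller in the sliding region, a $\Sigma$-repeller if it is a repeller in the escaping region, and a $\Sigma$-attractor if it is an attractor in the sliding region. Put $c=\mu\beta/(2-\mu)$, $d=(\lambda,0)$, $S=(0,-\beta)$, $h=(-\beta,0)$, $j=(\beta,0)$. Two systems have the same *configuration* if (a) an increasing homeomorphism of $\Sigma$ matches, at every point, the signs of $X.f$ and $Y.f$, the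 visible and invisible folds and the equilibria of $X$ and of $Y$, and the direction and zeros of $Z^\Sigma$; and (b) an increasing homeomorphism of $\Sigma$ matches the visible and invisible folds and equilibria of $X$ and of $Y$ and the points where an arc of $Y$ in $y<0$ joins $\Sigma$ to a hyperbolic saddle of $Y$ along its stable, respectively unstable, separatrix. They have the same *topological behaviour* if there is a bijection between their singular points (equilibria of $X$ in $y\ge0$ and of $Y$ in $y\le0$, pseudo-equilibria, and points of $\Sigma$ with $(X.f)(Y.f)=0$) which preserves the kind: lying on $\Sigma$ or not, equilibrium or hyperbolic saddle of $X$ or $Y$, visible or invisible fold of $X$ or $Y$, $\Sigma$-saddle, $\Sigma$-repeller, $\Sigma$-attractor. A *topological equivalence* is a homeomorphism of the plane which preserves $\Sigma$ and maps oriented orbit arcs of $X$ in $y\ge0$, $Y$ in $y\le0$ and $Z^\Sigma$ to such arcs, possibly exchanging the two sides of $\Sigma$. **Theorem.** For every $r\in(0,1)$ there is $\varepsilon_0>0$ such that for every $0<\mu<\varepsilon_0$ the following holds for the parameters $(\lambda,\beta)\in(-r,r)^2$. 1. There are exactly 13 configurations and exactly 7 topological behaviours. The configurations correspond to the following 13 regions,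 which partition the square and each have $(0,0)$ in their closure: for $\beta<0$: (1) $\lambda<c$, (2) $\lambda=c$, (3) $\lambda>c$; for $\beta=0$: (4) $\lambda<0$, (5) $\lambda=0$, (6) $\lambda>0$; for $\beta>0$: (7) $\lambda<-\beta$, (8) $\lambda=-\beta$, (9) $-\beta<\lambda<c$, (10) $\lambda=c$, (11) $c<\lambda<\beta$, (12) $\lambda=\beta$, (13) $\lambda>\beta$. The behaviours correspond to the groups $\{1,3\},\{2\},\{4,6\},\{5\},\{7,8,9\},\{10\},\{11,12,13\}$, and systems of different groups are not topologically equivalent. 2. On $\Sigma$, $X.f$ vanishes only at $d$, a visible fold of $X$, and $Y.f$ only at $(c,0)$. The only zero of the linear field $Y$ is $S$, a hyperbolic saddle. For $\beta<0$, $(c,0)$ is a visible fold of $Y$; for $\beta=0$, $(c,0)=S$; for $\beta>0$, $(c,0)$ is an invisible fold of $Y$, the unstable separatrix of $S$ meets $\Sigma$ exactly in $h$ and the stable one exactly in $j$, by arcs in $y<0$ (there are no such arcs for $\beta\le0$). The sliding region is $x<\min(\lambda,c)$, the escaping region $x>\max(\lambda,c)$, the sewing region the open interval between $\lambda$ and $c$.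 3. There is a $\Sigma$-saddle $Q=(q,0)$ with $q<\min(\lambda,c)$, and $Z^\Sigma$ points to the left for $x<q$. If $\beta\le0$ or $\lambda=c$, $Q$ is the only pseudo-equilibrium, and $Z^\Sigma$ points to the right for $q<x<\min(\lambda,c)$ and for $x>\max(\lambda,c)$. If $\beta>0$ and $\lambda<c$, there is exactly one other pseudo-equilibrium, a $\Sigma$-repeller $P=(p,0)$ with $p>c$; $Z^\Sigma$ points to the right for $q<x<\lambda$ and for $x>p$, to the left for $c<x<p$. If $\beta>0$ and $\lambda>c$, there is exactly one other pseudo-equilibrium, a $\Sigma$-attractor $P=(p,0)$ with $q<p<c$; $Z^\Sigma$ points to the right for $q<x<p$ and for $x>\lambda$, to the left for $p<x<c$. 4. If $\beta>0$ and $\lambda=c$, the boundary of the triangle $hjS$ is a $\Sigma$-graph of kind III, and every interior point of the triangle lies on a $\Sigma$-graph of kind III which passes through $d$ and is contained in the closed triangle. Here a $\Sigma$-graph is a simple closed path that meets $\Sigma$, contains a singular point, and consists of finitely many oriented non-trivial orbit arcs of $X$ in $y\ge0$, $Y$ in $y\le0$ and $Z^\Sigma$, joined at singular points or at points of $\Sigma$;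 it is of kind III if its points on $\Sigma$ with $(X.f)(Y.f)\ne0$ form a proper subset of the union of the sliding and escaping regions. -/

import Mathlib

open Set Filter Topology

noncomputable section

namespace FoldSaddle

/-- The function whose zero set is the switching line: `f (x, y) = y`. -/
def f (p : ℝ × ℝ) : ℝ := p.2

/-- The switching line `{y = 0}`. -/
def Sig : Set (ℝ × ℝ) := {p | f p = 0}

/-- The closed upper half plane. -/
def SigPlus : Set (ℝ × ℝ) := {p | 0 ≤ f p}

/-- The closed lower half plane. -/
def SigMinus : Set (ℝ × ℝ) := {p | f p ≤ 0}

/-- The derivative `V.g (p) = ⟨∇ g (p), V (p)⟩` of a function along a vector field. -/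
def lie (V : ℝ × ℝ → ℝ × ℝ) (g : ℝ × ℝ → ℝ) (p : ℝ × ℝ) : ℝ := fderiv ℝ g p (V p)

/-- A non-smooth vector field `Z = (X, Y)`: `X` acts on `y ≥ 0` and `Y` acts on `y ≤ 0`. -/
structure Sys where
  X : ℝ × ℝ → ℝ × ℝ
  Y : ℝ × ℝ → ℝ × ℝ

namespace Sys

variable (Z : Sys)

/-- `X.f` -/
def Xf (p : ℝ × ℝ) : ℝ := lie Z.X f p

/-- `Y.f` -/
def Yf (p : ℝ × ℝ) : ℝ := lie Z.Y f p

/-- `X².f = X.(X.f)` -/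
def XXf (p : ℝ × ℝ) : ℝ := lie Z.X Z.Xf p

/-- `Y².f = Y.(Y.f)` -/
def YYf (p : ℝ × ℝ) : ℝ := lie Z.Y Z.Yf p

/-- The sewing region. -/
def sewing : Set (ℝ × ℝ) := {p | p ∈ Sig ∧ 0 < Z.Xf p * Z.Yf p}

/-- The escaping region. -/
def escaping : Set (ℝ × ℝ) := {p | p ∈ Sig ∧ 0 < Z.Xf p ∧ Z.Yf p < 0}

/-- The sliding region. -/
def sliding : Set (ℝ × ℝ) := {p | p ∈ Sig ∧ Z.Xf p < 0 ∧ 0 < Z.Yf p}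

/-- Filippov's vector field on the sliding and escaping regions: the convex combination
of `X` and `Y` that is tangent to the switching line. (Used only on these two regions.) -/
def field (p : ℝ × ℝ) : ℝ × ℝ :=
  (Z.Yf p - Z.Xf p)⁻¹ • (Z.Yf p • Z.X p - Z.Xf p • Z.Y p)

/-- The sliding (or escaping) field as a scalar field in the coordinate `x` of the line. -/
def H (x : ℝ) : ℝ := (Z.field (x, 0)).1

/-- Visible fold of `X` (the orbit of `X` through `p` stays locally in `y ≥ 0`). -/
def VisFoldX (p : ℝ × ℝ) : Prop := p ∈ Sig ∧ Z.Xf p = 0 ∧ 0 < Z.XXf p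

/-- Invisible fold of `X`. -/
def InvFoldX (p : ℝ × ℝ) : Prop := p ∈ Sig ∧ Z.Xf p = 0 ∧ Z.XXf p < 0

/-- Visible fold of `Y` (the orbit of `Y` through `p` stays locally in `y ≤ 0`). -/
def VisFoldY (p : ℝ × ℝ) : Prop := p ∈ Sig ∧ Z.Yf p = 0 ∧ Z.YYf p < 0

/-- Invisible fold of `Y`. -/
def InvFoldY (p : ℝ × ℝ) : Prop := p ∈ Sig ∧ Z.Yf p = 0 ∧ 0 < Z.YYf p

/-- Regular points of the switching line. -/
def Regular (p : ℝ × ℝ) : Prop :=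
  p ∈ Sig ∧ (0 < Z.Xf p * Z.Yf p ∨ (Z.Xf p * Z.Yf p < 0 ∧ Z.field p ≠ 0))

/-- Pseudo-equilibria: zeros of the sliding (or escaping) field. -/
def Pseudo (p : ℝ × ℝ) : Prop := p ∈ Z.sliding ∪ Z.escaping ∧ Z.field p = 0

/-- Attracting zero of a scalar field: nearby points move towards `a` from both sides. -/
def Attracts (v : ℝ → ℝ) (a : ℝ) : Prop :=
  v a = 0 ∧ (∀ᶠ x in 𝓝[<] a, 0 < v x) ∧ (∀ᶠ x in 𝓝[>] a, v x < 0)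

/-- Repelling zero of a scalar field: nearby points move away from `a` on both sides. -/
def Repels (v : ℝ → ℝ) (a : ℝ) : Prop :=
  v a = 0 ∧ (∀ᶠ x in 𝓝[<] a, v x < 0) ∧ (∀ᶠ x in 𝓝[>] a, 0 < v x)

def SigmaSaddle (p : ℝ × ℝ) : Prop :=
  Z.Pseudo p ∧ ((p ∈ Z.escaping ∧ Attracts Z.H p.1) ∨ (p ∈ Z.sliding ∧ Repels Z.H p.1))

def SigmaRepeller (p : ℝ × ℝ) : Prop := Z.Pseudo p ∧ p ∈ Z.escaping ∧ Repels Z.H p.1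

def SigmaAttractor (p : ℝ × ℝ) : Prop := Z.Pseudo p ∧ p ∈ Z.sliding ∧ Attracts Z.H p.1

/-- Hyperbolic saddle of a planar vector field. -/
def HypSaddle (V : ℝ × ℝ → ℝ × ℝ) (p : ℝ × ℝ) : Prop :=
  V p = 0 ∧ ∃ a b : ℝ, a < 0 ∧ 0 < b ∧
    Module.End.HasEigenvalue (fderiv ℝ V p : (ℝ × ℝ) →ₗ[ℝ] (ℝ × ℝ)) a ∧
    Module.End.HasEigenvalue (fderiv ℝ V p : (ℝ × ℝ) →ₗ[ℝ] (ℝ × ℝ)) b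

/-- `p` is a point of the switching line from which an arc of `Y` inside `y < 0` runs to a
hyperbolic saddle of `Y` (the stable separatrix meets the line in `p`). -/
def StableHit (p : ℝ × ℝ) : Prop :=
  p ∈ Sig ∧ ∃ S, HypSaddle Z.Y S ∧ ∃ γ : ℝ → ℝ × ℝ, γ 0 = p ∧ (∀ t, 0 < t → f (γ t) < 0) ∧
    (∀ t, 0 ≤ t → HasDerivWithinAt γ (Z.Y (γ t)) (Ici 0) t) ∧ Tendsto γ atTop (𝓝 S)

/-- `p` is a point of the switching line reached by an arc of `Y` inside `y < 0` that starts at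
a hyperbolic saddle of `Y` (the unstable separatrix meets the line in `p`). -/
def UnstableHit (p : ℝ × ℝ) : Prop :=
  p ∈ Sig ∧ ∃ S, HypSaddle Z.Y S ∧ ∃ γ : ℝ → ℝ × ℝ, γ 0 = p ∧ (∀ t, t < 0 → f (γ t) < 0) ∧
    (∀ t, t ≤ 0 → HasDerivWithinAt γ (Z.Y (γ t)) (Iic 0) t) ∧ Tendsto γ atBot (𝓝 S)

/-! ### Configurations -/

/-- What can be seen of the phase portrait at a point of the switching line. -/
inductive Local
  | XUp | XDown | YUp | YDown | visX | invX | visY | invY | eqX | eqY | moveRight | moveLeft | rest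

def HasLocal (p : ℝ × ℝ) : Local → Prop
  | .XUp => 0 < Z.Xf p
  | .XDown => Z.Xf p < 0
  | .YUp => 0 < Z.Yf p
  | .YDown => Z.Yf p < 0
  | .visX => Z.VisFoldX p
  | .invX => Z.InvFoldX p
  | .visY => Z.VisFoldY p
  | .invY => Z.InvFoldY p
  | .eqX => Z.X p = 0
  | .eqY => Z.Y p = 0
  | .moveRight => p ∈ Z.sliding ∪ Z.escaping ∧ 0 < (Z.field p).1
  | .moveLeft => p ∈ Z.sliding ∪ Z.escaping ∧ (Z.field p).1 < 0
  | .rest => Z.Pseudo p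

/-- The marks that give the position of the contact points and of the separatrices. -/
inductive Mark
  | visX | invX | visY | invY | eqX | eqY | stable | unstable

def HasMark (p : ℝ × ℝ) : Mark → Prop
  | .visX => Z.VisFoldX p
  | .invX => Z.InvFoldX p
  | .visY => Z.VisFoldY p
  | .invY => Z.InvFoldY p
  | .eqX => Z.X p = 0
  | .eqY => Z.Y p = 0
  | .stable => Z.StableHit p
  | .unstable => Z.UnstableHit p

/-- Same configuration: along the switching line, from left to right, the two systems show the
same local portraits in the same order, and their contact points, equilibria and intersections
with the saddle separatrices come in the same order. -/
def SameConfig (Z W : Sys) : Prop :=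
  (∃ φ : ℝ ≃o ℝ, ∀ x k, Z.HasLocal (x, 0) k ↔ W.HasLocal (φ x, 0) k) ∧
  (∃ ψ : ℝ ≃o ℝ, ∀ x k, Z.HasMark (x, 0) k ↔ W.HasMark (ψ x, 0) k)

/-! ### Behaviours -/

/-- Singular points: equilibria of `X` in `y ≥ 0`, equilibria of `Y` in `y ≤ 0`, and the points
of the switching line that are not regular. -/
def Singular (p : ℝ × ℝ) : Prop :=
  (p ∈ SigPlus ∧ Z.X p = 0) ∨ (p ∈ SigMinus ∧ Z.Y p = 0) ∨ (p ∈ Sig ∧ ¬ Z.Regular p)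

/-- The kinds of singular points (a point may be of several kinds at once). -/
inductive Kind
  | onLine | eqX | eqY | saddleX | saddleY | visX | invX | visY | invY
  | sigmaSaddle | sigmaRepeller | sigmaAttractor

def HasKind (p : ℝ × ℝ) : Kind → Prop
  | .onLine => p ∈ Sig
  | .eqX => p ∈ SigPlus ∧ Z.X p = 0
  | .eqY => p ∈ SigMinus ∧ Z.Y p = 0
  | .saddleX => p ∈ SigPlus ∧ HypSaddle Z.X p
  | .saddleY => p ∈ SigMinus ∧ HypSaddle Z.Y p
  | .visX => Z.VisFoldX p
  | .invX => Z.InvFoldX p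
  | .visY => Z.VisFoldY p
  | .invY => Z.InvFoldY p
  | .sigmaSaddle => Z.SigmaSaddle p
  | .sigmaRepeller => Z.SigmaRepeller p
  | .sigmaAttractor => Z.SigmaAttractor p

/-- Same behaviour: the two systems have the same singular points, counted by kind. -/
def SameBehaviour (Z W : Sys) : Prop :=
  ∃ e : {p // Z.Singular p} ≃ {p // W.Singular p},
    ∀ p k, Z.HasKind p.1 k ↔ W.HasKind (e p).1 k

/-! ### Topological equivalence -/

/-- There is an oriented arc (possibly trivial) of an orbit of `V` inside `D` from `p` to `q`. -/
def Arc (V : ℝ × ℝ → ℝ × ℝ) (D : Set (ℝ × ℝ)) (p q : ℝ × ℝ) : Prop :=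
  ∃ T : ℝ, 0 ≤ T ∧ ∃ γ : ℝ → ℝ × ℝ, γ 0 = p ∧ γ T = q ∧
    ∀ t ∈ Icc 0 T, γ t ∈ D ∧ HasDerivWithinAt γ (V (γ t)) (Icc 0 T) t

def ArcX (p q : ℝ × ℝ) : Prop := Arc Z.X SigPlus p q

def ArcY (p q : ℝ × ℝ) : Prop := Arc Z.Y SigMinus p q

def ArcSig (p q : ℝ × ℝ) : Prop := Arc Z.field (Z.sliding ∪ Z.escaping) p q

/-- Topological equivalence: a homeomorphism of the plane that preserves the switching line
(it may exchange its two sides) and maps oriented orbit arcs onto oriented orbit arcs. -/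
def TopEquiv (Z W : Sys) : Prop :=
  ∃ h : (ℝ × ℝ) ≃ₜ (ℝ × ℝ), h '' Sig = Sig ∧
    (∀ p q, Z.ArcSig p q ↔ W.ArcSig (h p) (h q)) ∧
    ((∀ p q, (Z.ArcX p q ↔ W.ArcX (h p) (h q)) ∧ (Z.ArcY p q ↔ W.ArcY (h p) (h q))) ∨
     (∀ p q, (Z.ArcX p q ↔ W.ArcY (h p) (h q)) ∧ (Z.ArcY p q ↔ W.ArcX (h p) (h q))))

/-! ### Graphs -/

/-- On `(a, b)` the path `γ` runs, in positive direction and with any positive speed, along a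
non-trivial orbit of `V` inside `D`. -/
def Follows (V : ℝ × ℝ → ℝ × ℝ) (D : Set (ℝ × ℝ)) (γ : ℝ → ℝ × ℝ) (a b : ℝ) : Prop :=
  ∀ t ∈ Ioo a b, γ t ∈ D ∧ V (γ t) ≠ 0 ∧ ∃ c : ℝ, 0 < c ∧ HasDerivAt γ (c • V (γ t)) t

/-- A graph of `Z`: a simple closed path that meets the switching line, starts at a singular
point and is a finite concatenation of oriented orbit arcs, which are joined
at singular points or at points of the switching line. -/
def SigmaGraph (Δ : Set (ℝ × ℝ)) : Prop :=
  (Δ ∩ Sig).Nonempty ∧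
  ∃ (γ : ℝ → ℝ × ℝ) (n : ℕ) (τ : Fin (n + 1) → ℝ),
    StrictMono τ ∧ τ 0 = 0 ∧ τ (Fin.last n) = 1 ∧
    ContinuousOn γ (Icc 0 1) ∧ γ 0 = γ 1 ∧ InjOn γ (Ico 0 1) ∧ γ '' Icc 0 1 = Δ ∧
    Z.Singular (γ 0) ∧ (∀ k, Z.Singular (γ (τ k)) ∨ γ (τ k) ∈ Sig) ∧
    ∀ k : Fin n,
      Follows Z.X SigPlus γ (τ k.castSucc) (τ k.succ) ∨
      Follows Z.Y SigMinus γ (τ k.castSucc) (τ k.succ) ∨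
      Follows Z.field (Z.sliding ∪ Z.escaping) γ (τ k.castSucc) (τ k.succ)

/-- A graph of kind III: apart from contact points it meets the line
in a proper part of the union of the sliding and the escaping region. -/
def SigmaGraphIII (Δ : Set (ℝ × ℝ)) : Prop :=
  Z.SigmaGraph Δ ∧
    {p ∈ Δ ∩ Sig | ¬ (Z.Xf p = 0 ∨ Z.Yf p = 0)} ⊂ Z.sliding ∪ Z.escaping

theorem SameConfig.equivalence : Equivalence SameConfig where
  refl _ := ⟨⟨OrderIso.refl ℝ, fun _ _ => Iff.rfl⟩, ⟨OrderIso.refl ℝ, fun _ _ => Iff.rfl⟩⟩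
  symm := by
    rintro Z W ⟨⟨φ, h1⟩, ⟨ψ, h2⟩⟩
    refine ⟨⟨φ.symm, fun x k => ?_⟩, ⟨ψ.symm, fun x k => ?_⟩⟩
    · have := h1 (φ.symm x) k
      rw [OrderIso.apply_symm_apply] at this
      exact this.symm
    · have := h2 (ψ.symm x) k
      rw [OrderIso.apply_symm_apply] at this
      exact this.symm
  trans := by
    rintro Z W V ⟨⟨φ, h1⟩, ⟨ψ, h2⟩⟩ ⟨⟨φ', h3⟩, ⟨ψ', h4⟩⟩
    exact ⟨⟨φ.trans φ', fun x k => (h1 x k).trans (h3 (φ x) k)⟩,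
      ⟨ψ.trans ψ', fun x k => (h2 x k).trans (h4 (ψ x) k)⟩⟩

theorem SameBehaviour.equivalence : Equivalence SameBehaviour where
  refl _ := ⟨Equiv.refl _, fun _ _ => Iff.rfl⟩
  symm := by
    rintro Z W ⟨e, h⟩
    refine ⟨e.symm, fun p k => ?_⟩
    have := h (e.symm p) k
    rw [Equiv.apply_symm_apply] at this
    exact this.symm
  trans := by
    rintro Z W V ⟨e, h⟩ ⟨e', h'⟩
    exact ⟨e.trans e', fun p k => (h p k).trans (h' (e p) k)⟩

end Sys

/-! ### The family -/

/-- The unfolding of the visible fold-saddle, with parameters `l` (for `λ`), `μ`, `β`. -/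
def Zv (l μ β : ℝ) : Sys where
  X p := (1, p.1 - l)
  Y p := (μ / 2 * p.1 + (μ - 2) / 2 * (p.2 + β), (μ - 2) / 2 * p.1 + μ / 2 * (p.2 + β))

/-- The square `(-r, r)²` of the `(λ, β)`-plane. -/
abbrev Box (r : ℝ) : Type := {a : ℝ × ℝ // |a.1| < r ∧ |a.2| < r}

/-- Parameters up to equality of the configuration. -/
def configSetoid (μ r : ℝ) : Setoid (Box r) where
  r a b := Sys.SameConfig (Zv a.1.1 μ a.1.2) (Zv b.1.1 μ b.1.2)
  iseqv := ⟨fun _ => Sys.SameConfig.equivalence.refl _,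
    fun h => Sys.SameConfig.equivalence.symm h,
    fun h h' => Sys.SameConfig.equivalence.trans h h'⟩

/-- Parameters up to equality of the behaviour. -/
def behaviourSetoid (μ r : ℝ) : Setoid (Box r) where
  r a b := Sys.SameBehaviour (Zv a.1.1 μ a.1.2) (Zv b.1.1 μ b.1.2)
  iseqv := ⟨fun _ => Sys.SameBehaviour.equivalence.refl _,
    fun h => Sys.SameBehaviour.equivalence.symm h,
    fun h h' => Sys.SameBehaviour.equivalence.trans h h'⟩

/-- Abscissa of the point where `Y.f` vanishes on the switching line: the visible fold of `Y`
if `β < 0`, the saddle if `β = 0`, the invisible fold of `Y` if `β > 0`. -/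
def contact (μ β : ℝ) : ℝ := μ * β / (2 - μ)

/-- The thirteen regions of the bifurcation diagram in the `(λ, β)`-plane. -/
inductive Case
  | c1 | c2 | c3 | c4 | c5 | c6 | c7 | c8 | c9 | c10 | c11 | c12 | c13

def Region (l μ β : ℝ) : Case → Prop
  | .c1 => β < 0 ∧ l < contact μ β
  | .c2 => β < 0 ∧ l = contact μ β
  | .c3 => β < 0 ∧ contact μ β < l
  | .c4 => β = 0 ∧ l < 0
  | .c5 => β = 0 ∧ l = 0
  | .c6 => β = 0 ∧ 0 < l
  | .c7 => 0 < β ∧ l < -β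
  | .c8 => 0 < β ∧ l = -β
  | .c9 => 0 < β ∧ -β < l ∧ l < contact μ β
  | .c10 => 0 < β ∧ l = contact μ β
  | .c11 => 0 < β ∧ contact μ β < l ∧ l < β
  | .c12 => 0 < β ∧ l = β
  | .c13 => 0 < β ∧ β < l

/-- The case that represents the behaviour of a given case. -/
def Case.rep : Case → Case
  | .c1 => .c1
  | .c2 => .c2
  | .c3 => .c1
  | .c4 => .c4
  | .c5 => .c5
  | .c6 => .c4
  | .c7 => .c7
  | .c8 => .c7
  | .c9 => .c7
  | .c10 => .c10
  | .c11 => .c11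
  | .c12 => .c11
  | .c13 => .c11

end FoldSaddle

end

noncomputable section

namespace FoldSaddle

open Sys

/-! ### Lie derivatives, sliding and escaping regions -/

/-! On the switching line everything is explicit. `X.f` is `x - λ` and `Y.f` is a positive multiple
of `c - x`, so folds and the sliding, escaping and sewing regions depend only on the order of `λ`
and `c` and on the sign of `β`.

The sliding field is a quadratic `num` with leading coefficient `-μ`, divided by a factor of
constant sign on each of the two regions. For small `μ` one root `q` lies far to the left of the
square and gives the permanent saddle `Q`. The other root `p` is located by two values of the
quadratic (`num_fold`, `num_contact`): `num λ = (2 - μ)(c - λ)` and `(2 - μ) num c = 4(1 - μ)β(c -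
λ)`. So `p` lies on the same side of `λ` as `c` does, and `p - c` has the sign of `β(c - λ)`. Hence
`p` is a pseudo-equilibrium exactly if `β > 0` and `λ ≠ c` (`root_sliding_iff`,
`root_escaping_iff`).

Configurations are thus governed by finitely many comparisons (`SameOrder`): finite families in the
same order are matched by an order isomorphism (`exists_orderIso_forall_eq`), and the marks give the
comparisons back. Behaviours are governed by the coincidences among at most five labelled singular
points (`SameType`), which are recovered by asking which combinations of kinds occur.

Topological equivalence only sees arcs, so `SameType` is expressed through them. The points where
`X` or `Y` has only the trivial arc are `S` (if `β ≥ 0`) and the invisible fold (`stuckPoint_iff`);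
the sliding points are those in the domain of the sliding field that no arc of `X` or `Y` leaves
(`mem_sliding_iff_arcs`).

The field `Y` is diagonal in the coordinates `u = x + (y + β)` and `v = x - (y + β)`, with rates
`-(1 - μ)` and `1`. The triangle `hjS` is `y ≤ 0`, `u ≥ 0`, `v ≤ 0`, and `y` is a convex function of
time along orbits with `u ≥ 0 ≥ v`. So an orbit through an interior point comes down from the line
to the right of `c` and returns to it on the left. If `λ = c`, the sliding field points to the right
on both sides of `c` (beyond `q`) and closes this arc to a loop through the two-fold. -/

theorem lie_f (V : ℝ × ℝ → ℝ × ℝ) (p : ℝ × ℝ) : lie V f p = (V p).2 := by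
  have h : fderiv ℝ f p = ContinuousLinearMap.snd ℝ ℝ ℝ :=
    (ContinuousLinearMap.snd ℝ ℝ ℝ).hasFDerivAt.fderiv
  rw [lie, h]
  rfl

theorem Xf_eq (l μ β : ℝ) (p : ℝ × ℝ) : (Zv l μ β).Xf p = p.1 - l := lie_f _ _

theorem Yf_eq (l μ β : ℝ) (p : ℝ × ℝ) :
    (Zv l μ β).Yf p = (μ - 2) / 2 * p.1 + μ / 2 * (p.2 + β) := lie_f _ _

theorem XXf_eq (l μ β : ℝ) (p : ℝ × ℝ) : (Zv l μ β).XXf p = 1 := by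
  have h : HasFDerivAt (Zv l μ β).Xf (ContinuousLinearMap.fst ℝ ℝ ℝ) p := by
    rw [funext (Xf_eq l μ β)]
    exact (ContinuousLinearMap.fst ℝ ℝ ℝ).hasFDerivAt.sub_const l
  rw [XXf, lie, h.fderiv]
  rfl

theorem YYf_eq (l μ β : ℝ) (p : ℝ × ℝ) :
    (Zv l μ β).YYf p =
      (μ - 2) / 2 * ((Zv l μ β).Y p).1 + μ / 2 * ((Zv l μ β).Y p).2 := by
  have h : HasFDerivAt (Zv l μ β).Yf
      (((μ - 2) / 2) • ContinuousLinearMap.fst ℝ ℝ ℝ +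
        (μ / 2) • ContinuousLinearMap.snd ℝ ℝ ℝ) p := by
    rw [funext (Yf_eq l μ β)]
    exact ((ContinuousLinearMap.fst ℝ ℝ ℝ).hasFDerivAt.const_mul _).add
      (((ContinuousLinearMap.snd ℝ ℝ ℝ).hasFDerivAt.add_const β).const_mul _)
  rw [YYf, lie, h.fderiv]
  simp

theorem mem_Sig {p : ℝ × ℝ} : p ∈ Sig ↔ p.2 = 0 := Iff.rfl

theorem mk_mem_Sig (x : ℝ) : (x, (0 : ℝ)) ∈ Sig := rfl

/-- The division-free form of the definition, through which arithmetic tactics handle `contact`. -/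
theorem contact_mul {μ : ℝ} (hμ : μ < 1) (β : ℝ) : (2 - μ) * contact μ β = μ * β := by
  have : 2 - μ ≠ 0 := by linarith
  rw [contact]
  field_simp

theorem Yf_line {μ : ℝ} (hμ : μ < 1) (l β x : ℝ) :
    (Zv l μ β).Yf (x, 0) = (2 - μ) / 2 * (contact μ β - x) := by
  have := contact_mul hμ β
  rw [Yf_eq]
  dsimp only
  linarith

theorem Yf_line_eq_zero {μ : ℝ} (hμ : μ < 1) {l β x : ℝ} :
    (Zv l μ β).Yf (x, 0) = 0 ↔ x = contact μ β := by
  rw [Yf_line hμ, mul_eq_zero, sub_eq_zero, eq_comm (a := x)]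
  exact or_iff_right (by linarith)

theorem Yf_line_pos {μ : ℝ} (hμ : μ < 1) {l β x : ℝ} :
    0 < (Zv l μ β).Yf (x, 0) ↔ x < contact μ β := by
  rw [Yf_line hμ, mul_pos_iff_of_pos_left (by linarith), sub_pos]

theorem Yf_line_neg {μ : ℝ} (hμ : μ < 1) {l β x : ℝ} :
    (Zv l μ β).Yf (x, 0) < 0 ↔ contact μ β < x := by
  rw [Yf_line hμ, ← not_le, ← not_le, mul_nonneg_iff_of_pos_left (by linarith), sub_nonneg]

theorem Xf_line_eq_zero {l μ β x : ℝ} : (Zv l μ β).Xf (x, 0) = 0 ↔ x = l := by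
  rw [Xf_eq, sub_eq_zero]

theorem Xf_line_pos {l μ β x : ℝ} : 0 < (Zv l μ β).Xf (x, 0) ↔ l < x := by
  rw [Xf_eq, sub_pos]

theorem Xf_line_neg {l μ β x : ℝ} : (Zv l μ β).Xf (x, 0) < 0 ↔ x < l := by
  rw [Xf_eq, sub_neg]

theorem mem_sliding {μ : ℝ} (hμ : μ < 1) {l β x : ℝ} :
    (x, 0) ∈ (Zv l μ β).sliding ↔ x < l ∧ x < contact μ β := by
  simp only [sliding, mem_ofPred_eq, mk_mem_Sig, true_and, Xf_line_neg, Yf_line_pos hμ]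

theorem mem_escaping {μ : ℝ} (hμ : μ < 1) {l β x : ℝ} :
    (x, 0) ∈ (Zv l μ β).escaping ↔ l < x ∧ contact μ β < x := by
  simp only [escaping, mem_ofPred_eq, mk_mem_Sig, true_and, Xf_line_pos, Yf_line_neg hμ]

theorem mem_sewing {μ : ℝ} (hμ : μ < 1) {l β x : ℝ} :
    (x, 0) ∈ (Zv l μ β).sewing ↔ min l (contact μ β) < x ∧ x < max l (contact μ β) := by
  simp only [sewing, mem_ofPred_eq, mk_mem_Sig, true_and, mul_pos_iff, Xf_line_pos, Yf_line_neg hμ,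
    Xf_line_neg, Yf_line_pos hμ, min_lt_iff, lt_max_iff]
  constructor
  · rintro (h | h) <;> tauto
  · rintro ⟨h | h, h' | h'⟩
    · exact absurd h h'.not_gt
    · exact .inl ⟨h, h'⟩
    · exact .inr ⟨h', h⟩
    · exact absurd h h'.not_gt

theorem eq_line {p : ℝ × ℝ} (h : p ∈ Sig) : p = (p.1, 0) := Prod.ext rfl h

/-! ### Folds and equilibria -/

theorem X_ne_zero (l μ β : ℝ) (p : ℝ × ℝ) : (Zv l μ β).X p ≠ 0 := fun h =>
  one_ne_zero (congrArg Prod.fst h : (1 : ℝ) = 0)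

theorem Y_eq_zero {μ : ℝ} (hμ : μ < 1) {l β : ℝ} {p : ℝ × ℝ} :
    (Zv l μ β).Y p = 0 ↔ p = (0, -β) := by
  constructor
  · intro h
    have h1 : μ / 2 * p.1 + (μ - 2) / 2 * (p.2 + β) = 0 := congrArg Prod.fst h
    have h2 : (μ - 2) / 2 * p.1 + μ / 2 * (p.2 + β) = 0 := congrArg Prod.snd h
    -- The sum of the two equations isolates the eigencoordinate `u`, of eigenvalue `μ - 1`.
    have h3 : (μ - 1) * (p.1 + (p.2 + β)) = 0 := by linarith
    have h4 : p.1 + (p.2 + β) = 0 := (mul_eq_zero.1 h3).resolve_left (by linarith)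
    refine Prod.ext ?_ ?_ <;> dsimp only <;> linarith
  · rintro rfl
    simp [Zv]

/-- As `1 - μ > 0`, the sign of `β` alone decides between visible and invisible. -/
theorem YYf_contact {μ : ℝ} (hμ : μ < 1) (l β : ℝ) :
    (Zv l μ β).YYf (contact μ β, 0) = β * (1 - μ) := by
  have h := contact_mul hμ β
  rw [YYf_eq]
  simp only [Zv]
  linear_combination -μ / 2 * h

theorem visFoldX_iff {l μ β : ℝ} {p : ℝ × ℝ} : (Zv l μ β).VisFoldX p ↔ p = (l, 0) := by
  constructor
  · rintro ⟨h1, h2, -⟩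
    rw [Xf_eq, sub_eq_zero] at h2
    exact Prod.ext h2 h1
  · rintro rfl
    exact ⟨mk_mem_Sig _, Xf_line_eq_zero.2 rfl, by rw [XXf_eq]; exact one_pos⟩

theorem not_invFoldX {l μ β : ℝ} {p : ℝ × ℝ} : ¬ (Zv l μ β).InvFoldX p := by
  rintro ⟨-, -, h⟩
  rw [XXf_eq] at h
  exact absurd h (not_lt.2 zero_le_one)

theorem contact_of_Yf {μ : ℝ} (hμ : μ < 1) {l β : ℝ} {p : ℝ × ℝ} (h1 : p ∈ Sig)
    (h2 : (Zv l μ β).Yf p = 0) : p = (contact μ β, 0) := by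
  rw [eq_line h1] at h2 ⊢
  rw [(Yf_line_eq_zero hμ).1 h2]

theorem visFoldY_iff {μ : ℝ} (hμ : μ < 1) {l β : ℝ} {p : ℝ × ℝ} :
    (Zv l μ β).VisFoldY p ↔ β < 0 ∧ p = (contact μ β, 0) := by
  constructor
  · rintro ⟨h1, h2, h3⟩
    obtain rfl := contact_of_Yf hμ h1 h2
    rw [YYf_contact hμ] at h3
    exact ⟨by nlinarith, rfl⟩
  · rintro ⟨hβ, rfl⟩
    refine ⟨mk_mem_Sig _, (Yf_line_eq_zero hμ).2 rfl, ?_⟩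
    rw [YYf_contact hμ]
    nlinarith

theorem invFoldY_iff {μ : ℝ} (hμ : μ < 1) {l β : ℝ} {p : ℝ × ℝ} :
    (Zv l μ β).InvFoldY p ↔ 0 < β ∧ p = (contact μ β, 0) := by
  constructor
  · rintro ⟨h1, h2, h3⟩
    obtain rfl := contact_of_Yf hμ h1 h2
    rw [YYf_contact hμ] at h3
    exact ⟨by nlinarith, rfl⟩
  · rintro ⟨hβ, rfl⟩
    refine ⟨mk_mem_Sig _, (Yf_line_eq_zero hμ).2 rfl, ?_⟩
    rw [YYf_contact hμ]
    nlinarith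

theorem contact_neg {μ β : ℝ} (h0 : 0 < μ) (h1 : μ < 1) (hβ : β < 0) : contact μ β < 0 := by
  have := contact_mul h1 β
  nlinarith

theorem contact_zero (μ : ℝ) : contact μ 0 = 0 := by simp [contact]

theorem contact_pos {μ β : ℝ} (h0 : 0 < μ) (h1 : μ < 1) (hβ : 0 < β) : 0 < contact μ β := by
  have := contact_mul h1 β
  nlinarith

theorem contact_lt {μ β : ℝ} (h1 : μ < 1) (hβ : 0 < β) : contact μ β < β := by
  have := contact_mul h1 β
  nlinarith

theorem lt_contact {μ β : ℝ} (h1 : μ < 1) (hβ : β < 0) : β < contact μ β := by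
  have := contact_mul h1 β
  nlinarith

theorem Y_line_eq_zero {μ : ℝ} (hμ : μ < 1) {l β x : ℝ} :
    (Zv l μ β).Y (x, 0) = 0 ↔ β = 0 ∧ x = contact μ β := by
  rw [Y_eq_zero hμ, Prod.mk.injEq]
  constructor
  · rintro ⟨rfl, h⟩
    obtain rfl : β = 0 := by linarith
    simp [contact_zero]
  · rintro ⟨rfl, rfl⟩
    simp [contact_zero]

/-- The linear part of the field `Y`. -/
def linY (μ : ℝ) : (ℝ × ℝ) →L[ℝ] (ℝ × ℝ) :=
  ((μ / 2) • ContinuousLinearMap.fst ℝ ℝ ℝ +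
    ((μ - 2) / 2) • ContinuousLinearMap.snd ℝ ℝ ℝ).prod
  (((μ - 2) / 2) • ContinuousLinearMap.fst ℝ ℝ ℝ + (μ / 2) • ContinuousLinearMap.snd ℝ ℝ ℝ)

theorem fderiv_Y (l μ β : ℝ) (p : ℝ × ℝ) : fderiv ℝ (Zv l μ β).Y p = linY μ := by
  have h : (Zv l μ β).Y = fun p => linY μ p + ((μ - 2) / 2 * β, μ / 2 * β) := by
    funext p
    refine Prod.ext ?_ ?_ <;> simp [Zv, linY] <;> ring
  rw [h]
  exact ((linY μ).hasFDerivAt.add_const _).fderiv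

/-- The eigenvectors are `(1, 1)` for `μ - 1` and `(1, -1)` for `1`; for `β > 0` they are the
directions of the sides `jS` and `hS` of the triangle. -/
theorem hypSaddle_Y {μ : ℝ} (hμ : μ < 1) {l β : ℝ} {p : ℝ × ℝ} :
    HypSaddle (Zv l μ β).Y p ↔ p = (0, -β) := by
  refine ⟨fun h => (Y_eq_zero hμ).1 h.1, fun h => ⟨(Y_eq_zero hμ).2 h, μ - 1, 1, by linarith,
    one_pos, ?_, ?_⟩⟩ <;> rw [fderiv_Y]
  · refine Module.End.hasEigenvalue_of_hasEigenvector (x := ((1, 1) : ℝ × ℝ))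
      ⟨Module.End.mem_eigenspace_iff.2 ?_, by simp⟩
    refine Prod.ext ?_ ?_ <;> simp [linY] <;> ring
  · refine Module.End.hasEigenvalue_of_hasEigenvector (x := ((1, -1) : ℝ × ℝ))
      ⟨Module.End.mem_eigenspace_iff.2 ?_, by simp⟩
    refine Prod.ext ?_ ?_ <;> simp [linY] <;> ring

/-! ### The sliding field -/

theorem field_snd (l μ β : ℝ) (p : ℝ × ℝ) : ((Zv l μ β).field p).2 = 0 := by
  simp only [field, Xf, Yf, lie_f, Prod.smul_snd, Prod.snd_sub, smul_eq_mul]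
  ring

/-- Twice the numerator of the sliding field on the switching line. -/
def num (l μ β x : ℝ) : ℝ := (2 - μ) * (contact μ β - x) - (x - l) * (μ * x - (2 - μ) * β)

theorem H_eq {μ : ℝ} (hμ : μ < 1) (l β x : ℝ) :
    (Zv l μ β).H x = num l μ β x / ((2 - μ) * (contact μ β - x) + 2 * (l - x)) := by
  have h1 : (2 - μ) * (contact μ β - x) + 2 * (l - x) =
      2 * ((2 - μ) / 2 * (contact μ β - x) - (x - l)) := by ring
  have h2 : num l μ β x =
      2 * ((2 - μ) / 2 * (contact μ β - x) * 1 -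
        (x - l) * (μ / 2 * x + (μ - 2) / 2 * (0 + β))) := by
    rw [num]; ring
  rw [h1, h2, mul_div_mul_left _ _ two_ne_zero, Sys.H, field, Yf_line hμ, Xf_eq]
  exact (div_eq_inv_mul _ _).symm

/-- The factorization of the numerator of the sliding field: `q` and `p` are its roots. -/
structure Roots (l μ β q p : ℝ) : Prop where
  pos : 0 < μ
  lt_one : μ < 1
  lt_fold : q < l
  lt_contact : q < contact μ β
  -- Keeps the corner `h = (-β, 0)` to the right of `q`, so that the graphs below never meet the
  -- saddle `Q`.
  lt_neg : q < -β
  lt_root : q < p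
  num_eq : ∀ x, num l μ β x = -μ * ((x - q) * (x - p))

/-- A concave quadratic which is positive at `x₀` has a root on either side. With `D` the
discriminant, `D - (2 a x₀ - b)²` is `4 a` times the value at `x₀`, whence `|2 a x₀ - b| < √D`. -/
theorem exists_factorization {a b e x₀ : ℝ} (ha : 0 < a) (h : 0 < -a * x₀ ^ 2 + b * x₀ + e) :
    ∃ q p : ℝ, q < x₀ ∧ x₀ < p ∧
      ∀ x, -a * x ^ 2 + b * x + e = -a * ((x - q) * (x - p)) := by
  have hD : 0 < b ^ 2 + 4 * a * e := by nlinarith [sq_nonneg (2 * a * x₀ - b)]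
  set s := √(b ^ 2 + 4 * a * e) with hs
  have hss : s ^ 2 = b ^ 2 + 4 * a * e := Real.sq_sqrt hD.le
  have hlt : |2 * a * x₀ - b| < s := by
    apply abs_lt_of_sq_lt_sq _ (Real.sqrt_nonneg _)
    rw [hss]
    nlinarith
  obtain ⟨h1, h2⟩ := abs_lt.1 hlt
  refine ⟨(b - s) / (2 * a), (b + s) / (2 * a), ?_, ?_, fun x => ?_⟩
  · rw [div_lt_iff₀ (by linarith)]; linarith
  · rw [lt_div_iff₀ (by linarith)]; linarith
  · field_simp
    linear_combination -hss

/-- It suffices that `num` is positive at a point `-K` to the left of `l`, `-β` and the contact.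
There the term `(2 - μ)(1 - β)K` is at least `31/4`, while the others are bounded below by `-1`,
`-1/4`, `-1/16` and `-2`. -/
theorem exists_roots {r l μ β : ℝ} (hr : r < 1) (hμ0 : 0 < μ) (hμ : μ < (1 - r) ^ 2 / 16)
    (hl : |l| < r) (hβ : |β| < r) : ∃ q p, Roots l μ β q p := by
  obtain ⟨hl1, hl2⟩ := abs_lt.1 hl
  obtain ⟨hβ1, hβ2⟩ := abs_lt.1 hβ
  have hμ1 : μ < 1 / 16 := by nlinarith
  have hc := contact_mul (μ := μ) (by linarith) β
  -- Chosen so that `K (1 - β) ≥ 4` on the whole square; the bound on `μ` is precisely `μ K² < 1`.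
  -- Also `K ≥ 4`, which puts `-K` left of everything relevant.
  set K := 4 / (1 - r) with hK
  have hKr : K * (1 - r) = 4 := div_mul_cancel₀ _ (by linarith)
  have hK4 : 4 ≤ K := by nlinarith
  have hμK : μ * K ^ 2 < 1 := by
    calc μ * K ^ 2 < (1 - r) ^ 2 / 16 * K ^ 2 := by gcongr
      _ = (K * (1 - r)) ^ 2 / 16 := by ring
      _ = 1 := by rw [hKr]; norm_num
  have hμK1 : μ * K ≤ 1 / 4 := by nlinarith
  have hform : ∀ x, num l μ β x =
      -μ * x ^ 2 + (-(2 - μ) * (1 - β) + μ * l) * x + (μ * β - (2 - μ) * l * β) := fun x => by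
    rw [num]
    linear_combination hc
  have h0 : 0 < -μ * (-K) ^ 2 + (-(2 - μ) * (1 - β) + μ * l) * (-K) +
      (μ * β - (2 - μ) * l * β) := by
    have e1 : 4 ≤ K * (1 - β) := by nlinarith
    have e2 : 4 * (31 / 16) ≤ (2 - μ) * (K * (1 - β)) := by nlinarith
    have e3 : -(1 / 4) ≤ -(μ * K * l) := by nlinarith [mul_pos hμ0 (by linarith : 0 < K)]
    have e4 : -(1 / 16) ≤ μ * β := by nlinarith
    have e5 : l * β ≤ 1 := by nlinarith
    have e6 : (2 - μ) * (l * β) ≤ 2 := by nlinarith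
    nlinarith
  obtain ⟨q, p, h1, h2, h3⟩ := exists_factorization hμ0 h0
  refine ⟨q, p, hμ0, by linarith, by linarith, ?_, by linarith, by linarith, fun x => ?_⟩
  · have : -1 < contact μ β := by nlinarith
    linarith
  · rw [hform, h3]

namespace Roots

variable {l μ β q p : ℝ} (R : Roots l μ β q p)
include R

/-- The second summand of `num` vanishes at `l`. Since `l - q > 0`, this ties the sign of `p - l` to
that of `c - l`. -/
theorem num_fold : (2 - μ) * (contact μ β - l) = -μ * ((l - q) * (l - p)) := by
  rw [← R.num_eq, num]; ring

/-- The first summand of `num` vanishes at the contact; in the second, `(2 - μ)(μ c - (2 - μ)β) =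
-4(1 - μ)β`. Since `c - q > 0`, this fixes the side of the contact on which `p` lies. -/
theorem num_contact : 4 * (1 - μ) * β * (contact μ β - l) =
    -μ * (2 - μ) * ((contact μ β - q) * (contact μ β - p)) := by
  have h := R.num_eq (contact μ β)
  have hc := contact_mul R.lt_one β
  rw [num] at h
  linear_combination (2 - μ) * h + (contact μ β - l) * μ * hc

theorem fold_lt_root_iff : l < p ↔ l < contact μ β := by
  have h := R.num_fold
  have h1 : 0 < μ * (l - q) := mul_pos R.pos (sub_pos.2 R.lt_fold)
  have h2 := R.lt_one
  constructor <;> intro h3 <;> by_contra! h4 <;> nlinarith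

theorem root_lt_fold_iff : p < l ↔ contact μ β < l := by
  have h := R.num_fold
  have h1 : 0 < μ * (l - q) := mul_pos R.pos (sub_pos.2 R.lt_fold)
  have h2 := R.lt_one
  constructor <;> intro h3 <;> by_contra! h4 <;> nlinarith

theorem contact_lt_root_iff : contact μ β < p ↔ 0 < β * (contact μ β - l) := by
  have h := R.num_contact
  have h2 := R.lt_one
  have h1 : 0 < μ * (2 - μ) * (contact μ β - q) :=
    mul_pos (mul_pos R.pos (by linarith)) (sub_pos.2 R.lt_contact)
  constructor <;> intro h3 <;> by_contra! h4 <;> nlinarith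

theorem root_lt_contact_iff : p < contact μ β ↔ β * (contact μ β - l) < 0 := by
  have h := R.num_contact
  have h2 := R.lt_one
  have h1 : 0 < μ * (2 - μ) * (contact μ β - q) :=
    mul_pos (mul_pos R.pos (by linarith)) (sub_pos.2 R.lt_contact)
  constructor <;> intro h3 <;> by_contra! h4 <;> nlinarith

/-- In these degenerate cases `num` vanishes at the contact: the second root has run into the
boundary of the sliding or escaping region and is no pseudo-equilibrium. -/
theorem contact_eq_root (h : β = 0 ∨ l = contact μ β) : p = contact μ β := by
  have h1 : β * (contact μ β - l) = 0 := by
    rcases h with h | h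
    · rw [h, zero_mul]
    · rw [h, sub_self, mul_zero]
  refine le_antisymm (not_lt.1 fun h2 => ?_) (not_lt.1 fun h2 => ?_)
  · exact (R.contact_lt_root_iff.1 h2).ne' h1
  · exact (R.root_lt_contact_iff.1 h2).ne h1

/-- The denominator is positive here, so the field has the sign of `-(x - q)(x - p)`. -/
theorem H_sliding {x : ℝ} (h1 : x < l) (h2 : x < contact μ β) :
    ∃ d, 0 < d ∧ (Zv l μ β).H x = -d * ((x - q) * (x - p)) := by
  have h3 := R.lt_one
  have h4 : 0 < (2 - μ) * (contact μ β - x) + 2 * (l - x) := by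
    have := mul_pos (by linarith : 0 < 2 - μ) (sub_pos.2 h2)
    linarith
  refine ⟨μ / ((2 - μ) * (contact μ β - x) + 2 * (l - x)), div_pos R.pos h4, ?_⟩
  rw [H_eq R.lt_one, R.num_eq]
  ring

/-- The denominator is negative here, and `x - q > 0` can be absorbed into `d`, so that only the
root `p` matters. -/
theorem H_escaping {x : ℝ} (h1 : l < x) (h2 : contact μ β < x) :
    ∃ d, 0 < d ∧ (Zv l μ β).H x = d * (x - p) := by
  have h3 := R.lt_one
  have h4 : (2 - μ) * (contact μ β - x) + 2 * (l - x) < 0 := by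
    have := mul_pos (by linarith : 0 < 2 - μ) (sub_pos.2 h2)
    linarith
  refine ⟨μ * (x - q) / -((2 - μ) * (contact μ β - x) + 2 * (l - x)),
    div_pos (mul_pos R.pos (by linarith [R.lt_fold])) (by linarith), ?_⟩
  rw [H_eq R.lt_one, R.num_eq, div_neg]
  ring

theorem H_sliding_pos {x : ℝ} (h1 : x < l) (h2 : x < contact μ β) :
    0 < (Zv l μ β).H x ↔ q < x ∧ x < p := by
  obtain ⟨d, hd, h⟩ := R.H_sliding h1 h2
  have := R.lt_root
  rw [h]
  constructor
  · intro h3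
    have h4 : (x - q) * (x - p) < 0 := by nlinarith
    rcases mul_neg_iff.1 h4 with h5 | h5
    · exact ⟨by linarith, by linarith⟩
    · linarith
  · rintro ⟨h3, h4⟩
    have := mul_pos (sub_pos.2 h3) (sub_pos.2 h4)
    nlinarith

theorem H_sliding_neg {x : ℝ} (h1 : x < l) (h2 : x < contact μ β) :
    (Zv l μ β).H x < 0 ↔ x < q ∨ p < x := by
  obtain ⟨d, hd, h⟩ := R.H_sliding h1 h2
  have := R.lt_root
  rw [h]
  constructor
  · intro h3
    have h4 : 0 < (x - q) * (x - p) := by nlinarith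
    rcases mul_pos_iff.1 h4 with h5 | h5
    · exact .inr (by linarith)
    · exact .inl (by linarith)
  · rintro (h3 | h3)
    · have := mul_pos (sub_pos.2 h3) (by linarith : 0 < p - x)
      nlinarith
    · have := mul_pos (sub_pos.2 h3) (by linarith : 0 < x - q)
      nlinarith

theorem H_sliding_eq_zero {x : ℝ} (h1 : x < l) (h2 : x < contact μ β) :
    (Zv l μ β).H x = 0 ↔ x = q ∨ x = p := by
  obtain ⟨d, hd, h⟩ := R.H_sliding h1 h2
  rw [h, mul_eq_zero, mul_eq_zero, sub_eq_zero, sub_eq_zero]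
  exact or_iff_right (by linarith)

theorem H_escaping_pos {x : ℝ} (h1 : l < x) (h2 : contact μ β < x) :
    0 < (Zv l μ β).H x ↔ p < x := by
  obtain ⟨d, hd, h⟩ := R.H_escaping h1 h2
  rw [h, mul_pos_iff_of_pos_left hd, sub_pos]

theorem H_escaping_neg {x : ℝ} (h1 : l < x) (h2 : contact μ β < x) :
    (Zv l μ β).H x < 0 ↔ x < p := by
  obtain ⟨d, hd, h⟩ := R.H_escaping h1 h2
  rw [h, ← not_le, ← not_le, mul_nonneg_iff_of_pos_left hd, sub_nonneg]

theorem H_escaping_eq_zero {x : ℝ} (h1 : l < x) (h2 : contact μ β < x) :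
    (Zv l μ β).H x = 0 ↔ x = p := by
  obtain ⟨d, hd, h⟩ := R.H_escaping h1 h2
  rw [h, mul_eq_zero, sub_eq_zero]
  exact or_iff_right hd.ne'

end Roots

theorem field_line (l μ β x : ℝ) : (Zv l μ β).field (x, 0) = ((Zv l μ β).H x, 0) :=
  Prod.ext rfl (field_snd l μ β _)

theorem pseudo_line {μ : ℝ} (hμ : μ < 1) {l β x : ℝ} :
    (Zv l μ β).Pseudo (x, 0) ↔
      (x < l ∧ x < contact μ β ∨ l < x ∧ contact μ β < x) ∧ (Zv l μ β).H x = 0 := by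
  rw [Pseudo, mem_union, mem_sliding hμ, mem_escaping hμ, field_line, Prod.mk_eq_zero]
  tauto

theorem Sys.Pseudo.mem_Sig {Z : Sys} {p : ℝ × ℝ} (h : Z.Pseudo p) : p ∈ Sig :=
  h.1.elim And.left And.left

/-! ### The flow of `Y` -/

/-- The flow of the linear field `Y` at time `t`. -/
def flowY (μ β : ℝ) (p : ℝ × ℝ) (t : ℝ) : ℝ × ℝ :=
  (((p.1 + (p.2 + β)) * Real.exp (-(1 - μ) * t) + (p.1 - (p.2 + β)) * Real.exp t) / 2,
   ((p.1 + (p.2 + β)) * Real.exp (-(1 - μ) * t) - (p.1 - (p.2 + β)) * Real.exp t) / 2 - β)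

theorem flowY_zero (μ β : ℝ) (p : ℝ × ℝ) : flowY μ β p 0 = p := by
  refine Prod.ext ?_ ?_ <;> simp [flowY]

/-- The contracting eigencoordinate `u`; the expanding one, `v`, follows. Nearly every later fact
about orbits of `Y` is read off from these two exponentials. -/
theorem flowY_add_coord (μ β : ℝ) (p : ℝ × ℝ) (t : ℝ) :
    (flowY μ β p t).1 + ((flowY μ β p t).2 + β) =
      (p.1 + (p.2 + β)) * Real.exp (-(1 - μ) * t) := by
  simp only [flowY]; ring

theorem flowY_sub_coord (μ β : ℝ) (p : ℝ × ℝ) (t : ℝ) :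
    (flowY μ β p t).1 - ((flowY μ β p t).2 + β) = (p.1 - (p.2 + β)) * Real.exp t := by
  simp only [flowY]; ring

theorem flowY_flowY (μ β : ℝ) (p : ℝ × ℝ) (s t : ℝ) :
    flowY μ β (flowY μ β p s) t = flowY μ β p (s + t) := by
  rw [flowY, flowY_add_coord, flowY_sub_coord, flowY, mul_add, Real.exp_add, Real.exp_add]
  refine Prod.ext ?_ ?_ <;> dsimp only <;> ring

theorem hasDerivAt_flowY (l μ β : ℝ) (p : ℝ × ℝ) (t : ℝ) :
    HasDerivAt (flowY μ β p) ((Zv l μ β).Y (flowY μ β p t)) t := by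
  have h1 : HasDerivAt (fun t => Real.exp (-(1 - μ) * t))
      (Real.exp (-(1 - μ) * t) * (-(1 - μ) * 1)) t :=
    ((hasDerivAt_id t).const_mul _).exp
  have h2 := Real.hasDerivAt_exp t
  have h3 : HasDerivAt (flowY μ β p) (_, _) t := (((h1.const_mul (p.1 + (p.2 + β))).add (h2.const_mul (p.1 - (p.2 + β)))).div_const
    2).prodMk ((((h1.const_mul (p.1 + (p.2 + β))).sub
      (h2.const_mul (p.1 - (p.2 + β)))).div_const 2).sub_const β)
  refine h3.congr_deriv ?_
  refine Prod.ext ?_ ?_ <;> simp only [flowY, Zv] <;> ring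

theorem continuous_flowY (μ β : ℝ) (p : ℝ × ℝ) : Continuous (flowY μ β p) :=
  continuous_iff_continuousAt.2 fun t => (hasDerivAt_flowY 0 μ β p t).continuousAt

theorem hasDerivWithinAt_fst {γ : ℝ → ℝ × ℝ} {γ' : ℝ × ℝ} {s : Set ℝ} {t : ℝ}
    (h : HasDerivWithinAt γ γ' s t) : HasDerivWithinAt (fun t => (γ t).1) γ'.1 s t :=
  (ContinuousLinearMap.fst ℝ ℝ ℝ).hasFDerivAt.comp_hasDerivWithinAt t h

theorem hasDerivWithinAt_snd {γ : ℝ → ℝ × ℝ} {γ' : ℝ × ℝ} {s : Set ℝ} {t : ℝ}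
    (h : HasDerivWithinAt γ γ' s t) : HasDerivWithinAt (fun t => (γ t).2) γ'.2 s t :=
  (ContinuousLinearMap.snd ℝ ℝ ℝ).hasFDerivAt.comp_hasDerivWithinAt t h

/-- The product `g t * exp (-k t)` has derivative zero within `s`, hence is constant on the convex
set `s`. Derivatives within `s` are used because arcs live on closed intervals and half-lines. -/
theorem eq_of_hasDerivWithinAt_mul {g : ℝ → ℝ} {k : ℝ} {s : Set ℝ} (hs : Convex ℝ s)
    (h0 : (0 : ℝ) ∈ s) (h : ∀ t ∈ s, HasDerivWithinAt g (k * g t) s t) {t : ℝ} (ht : t ∈ s) :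
    g t = g 0 * Real.exp (k * t) := by
  have h1 : ∀ t ∈ s, HasDerivWithinAt (fun t => g t * Real.exp (-k * t)) 0 s t := fun t ht => by
    have h2 : HasDerivAt (fun t => Real.exp (-k * t)) (Real.exp (-k * t) * (-k * 1)) t :=
      ((hasDerivAt_id t).const_mul _).exp
    exact ((h t ht).mul h2.hasDerivWithinAt).congr_deriv (by ring)
  have h3 := hs.norm_image_sub_le_of_norm_hasDerivWithin_le (C := 0) h1 (by simp) h0 ht
  rw [zero_mul, norm_le_zero_iff, sub_eq_zero, mul_zero, Real.exp_zero, mul_one] at h3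
  rw [← h3, mul_assoc, ← Real.exp_add]
  simp

/-- Uniqueness of the orbits of `Y`. -/
theorem eq_flowY {l μ β : ℝ} {γ : ℝ → ℝ × ℝ} {s : Set ℝ} (hs : Convex ℝ s) (h0 : (0 : ℝ) ∈ s)
    (h : ∀ t ∈ s, HasDerivWithinAt γ ((Zv l μ β).Y (γ t)) s t) {t : ℝ} (ht : t ∈ s) :
    γ t = flowY μ β (γ 0) t := by
  have h1 : ∀ t ∈ s, HasDerivWithinAt (fun t => (γ t).1 + ((γ t).2 + β))
      (-(1 - μ) * ((γ t).1 + ((γ t).2 + β))) s t := fun t ht => by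
    exact ((hasDerivWithinAt_fst (h t ht)).add
      ((hasDerivWithinAt_snd (h t ht)).add_const β)).congr_deriv (by simp only [Zv]; ring)
  have h2 : ∀ t ∈ s, HasDerivWithinAt (fun t => (γ t).1 - ((γ t).2 + β))
      (1 * ((γ t).1 - ((γ t).2 + β))) s t := fun t ht => by
    exact ((hasDerivWithinAt_fst (h t ht)).sub
      ((hasDerivWithinAt_snd (h t ht)).add_const β)).congr_deriv (by simp only [Zv]; ring)
  have e1 := eq_of_hasDerivWithinAt_mul hs h0 h1 ht
  have e2 := eq_of_hasDerivWithinAt_mul hs h0 h2 ht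
  rw [one_mul] at e2
  refine Prod.ext ?_ ?_
  · simp only [flowY]; linarith
  · simp only [flowY]; linarith

/-! ### Separatrices -/

theorem tendsto_exp_neg_mul {k : ℝ} (hk : 0 < k) :
    Tendsto (fun t : ℝ => Real.exp (-k * t)) atTop (𝓝 0) :=
  Real.tendsto_exp_atBot.comp ((tendsto_const_mul_atBot_of_neg (by linarith)).2 tendsto_id)

theorem tendsto_of_coords {β : ℝ} {g : ℝ → ℝ × ℝ} {F : Filter ℝ}
    (h1 : Tendsto (fun t => (g t).1 + ((g t).2 + β)) F (𝓝 0))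
    (h2 : Tendsto (fun t => (g t).1 - ((g t).2 + β)) F (𝓝 0)) : Tendsto g F (𝓝 (0, -β)) := by
  have e1 := (h1.add h2).div_const 2
  have e2 := ((h1.sub h2).div_const 2).sub_const β
  have e3 : Tendsto (fun t => (g t).1) F (𝓝 0) := by
    convert e1 using 2 <;> ring
  have e4 : Tendsto (fun t => (g t).2) F (𝓝 (-β)) := by
    convert e2 using 2 <;> ring
  exact e3.prodMk_nhds e4

/-- Convergence to the saddle forces `v = 0`, because `v` grows like `exp t`; on the line this
leaves only `x = β`. -/
theorem stableHit_iff {l μ β : ℝ} (hμ : μ < 1) {p : ℝ × ℝ} :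
    (Zv l μ β).StableHit p ↔ 0 < β ∧ p = (β, 0) := by
  constructor
  · rintro ⟨hp, S, hS, γ, h0, hneg, hder, hlim⟩
    obtain rfl := (hypSaddle_Y hμ).1 hS
    have hγ : ∀ t, 0 ≤ t → γ t = flowY μ β p t := fun t ht =>
      h0 ▸ eq_flowY (convex_Ici 0) self_mem_Ici hder ht
    have hp2 : p.2 = 0 := hp
    have hv : p.1 - (p.2 + β) = 0 := by
      have e1 : Tendsto (fun t => (p.1 - (p.2 + β)) * Real.exp t) atTop (𝓝 (0 - (-β + β))) := by
        refine Tendsto.congr' ?_ (hlim.fst_nhds.sub (hlim.snd_nhds.add_const β))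
        filter_upwards [eventually_ge_atTop 0] with t ht
        rw [hγ t ht, flowY_sub_coord]
      have e2 := e1.mul (Real.tendsto_exp_neg_atTop_nhds_zero)
      simp only [mul_assoc, ← Real.exp_add, add_neg_cancel, Real.exp_zero, mul_one, mul_zero] at e2
      exact tendsto_nhds_unique tendsto_const_nhds e2
    have hp1 : p.1 = β := by linarith
    -- At time `1` the ordinate is `β (exp (-(1 - μ)) - 1)`; it is negative only if `β > 0`.
    have h1 := hneg 1 one_pos
    rw [hγ 1 zero_le_one, f, flowY] at h1
    simp only [hv, zero_mul, sub_zero, mul_one] at h1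
    have h2 : Real.exp (-(1 - μ)) < 1 := Real.exp_lt_one_iff.2 (by linarith)
    refine ⟨?_, Prod.ext hp1 hp2⟩
    rw [hp1, hp2] at h1
    nlinarith
  · rintro ⟨hβ, rfl⟩
    refine ⟨mk_mem_Sig _, (0, -β), (hypSaddle_Y hμ).2 rfl, flowY μ β (β, 0), flowY_zero _ _ _,
      fun t ht => ?_, fun t _ => (hasDerivAt_flowY l μ β _ t).hasDerivWithinAt, ?_⟩
    · have h1 : Real.exp (-(1 - μ) * t) < 1 := Real.exp_lt_one_iff.2 (by nlinarith)
      simp only [f, flowY]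
      nlinarith
    · refine tendsto_of_coords ?_ ?_ <;> simp only [flowY_add_coord, flowY_sub_coord]
      · simpa using (tendsto_exp_neg_mul (sub_pos.2 hμ)).const_mul (β + (0 + β))
      · simp

/-- The mirror image: backward in time it is `u` that would blow up, so `u = 0` and `x = -β`. -/
theorem unstableHit_iff {l μ β : ℝ} (hμ : μ < 1) {p : ℝ × ℝ} :
    (Zv l μ β).UnstableHit p ↔ 0 < β ∧ p = (-β, 0) := by
  constructor
  · rintro ⟨hp, S, hS, γ, h0, hneg, hder, hlim⟩
    obtain rfl := (hypSaddle_Y hμ).1 hS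
    have hγ : ∀ t, t ≤ 0 → γ t = flowY μ β p t := fun t ht =>
      h0 ▸ eq_flowY (convex_Iic 0) self_mem_Iic hder ht
    have hp2 : p.2 = 0 := hp
    have hu : p.1 + (p.2 + β) = 0 := by
      have e1 : Tendsto (fun t => (p.1 + (p.2 + β)) * Real.exp (-(1 - μ) * t)) atBot
          (𝓝 (0 + (-β + β))) := by
        refine Tendsto.congr' ?_ (hlim.fst_nhds.add (hlim.snd_nhds.add_const β))
        filter_upwards [eventually_le_atBot 0] with t ht
        rw [hγ t ht, flowY_add_coord]
      have e3 : Tendsto (fun t : ℝ => Real.exp ((1 - μ) * t)) atBot (𝓝 0) :=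
        Real.tendsto_exp_atBot.comp
          ((tendsto_const_mul_atBot_of_pos (sub_pos.2 hμ)).2 tendsto_id)
      have e2 := e1.mul e3
      simp only [mul_assoc, ← Real.exp_add, ← add_mul, neg_add_cancel, zero_mul, Real.exp_zero,
        mul_one, mul_zero] at e2
      exact tendsto_nhds_unique tendsto_const_nhds e2
    have hp1 : p.1 = -β := by linarith
    have h1 := hneg (-1) (by norm_num)
    rw [hγ (-1) (by norm_num), f, flowY] at h1
    simp only [hu, zero_mul, zero_sub] at h1
    have h2 : Real.exp (-1) < 1 := Real.exp_lt_one_iff.2 (by norm_num)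
    refine ⟨?_, Prod.ext hp1 hp2⟩
    rw [hp1, hp2] at h1
    nlinarith
  · rintro ⟨hβ, rfl⟩
    refine ⟨mk_mem_Sig _, (0, -β), (hypSaddle_Y hμ).2 rfl, flowY μ β (-β, 0), flowY_zero _ _ _,
      fun t ht => ?_, fun t _ => (hasDerivAt_flowY l μ β _ t).hasDerivWithinAt, ?_⟩
    · have h1 : Real.exp t < 1 := Real.exp_lt_one_iff.2 ht
      simp only [f, flowY]
      nlinarith
    · refine tendsto_of_coords ?_ ?_ <;> simp only [flowY_add_coord, flowY_sub_coord]
      · simp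
      · simpa using Real.tendsto_exp_atBot.const_mul (-β - (0 + β))

/-! ### Order isomorphisms of the line with prescribed values -/

/-- There is an order isomorphism which fixes everything up to `m` and maps `x` to `y`. -/
theorem exists_orderIso_kink {m x y : ℝ} (hx : m < x) (hy : m < y) :
    ∃ φ : ℝ ≃o ℝ, (∀ t ≤ m, φ t = t) ∧ φ x = y := by
  set k := (y - m) / (x - m) with hk
  have hk0 : 0 < k := div_pos (sub_pos.2 hy) (sub_pos.2 hx)
  have hkx : k * (x - m) = y - m := div_mul_cancel₀ _ (sub_pos.2 hx).ne'
  -- Piecewise linear, of slope `1` up to `m` and of slope `k` beyond.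
  let g : ℝ → ℝ := fun t => min t m + k * max (t - m) 0
  have g1 : ∀ t, t ≤ m → g t = t := fun t ht => by
    simp only [g, min_eq_left ht, max_eq_right (sub_nonpos.2 ht), mul_zero, add_zero]
  have g2 : ∀ t, m ≤ t → g t = m + k * (t - m) := fun t ht => by
    simp only [g, min_eq_right ht, max_eq_left (sub_nonneg.2 ht)]
  have hmono : StrictMono g := by
    intro a b hab
    rcases le_total b m with hb | hb
    · rwa [g1 b hb, g1 a (hab.le.trans hb)]
    · rw [g2 b hb]
      rcases le_total a m with ha | ha
      · rw [g1 a ha]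
        rcases ha.eq_or_lt with rfl | ha
        · have := mul_pos hk0 (sub_pos.2 hab); linarith
        · have := mul_nonneg hk0.le (sub_nonneg.2 hb); linarith
      · rw [g2 a ha]
        have := mul_pos hk0 (sub_pos.2 hab); linarith
  have hsurj : Function.Surjective g := by
    intro b
    rcases le_total b m with hb | hb
    · exact ⟨b, g1 b hb⟩
    · refine ⟨m + (b - m) / k, ?_⟩
      rw [g2 _ (by have := div_nonneg (sub_nonneg.2 hb) hk0.le; linarith)]
      field_simp
      ring
  refine ⟨hmono.orderIsoOfSurjective g hsurj, g1, ?_⟩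
  change g x = y
  rw [g2 x hx.le, hkx]
  ring

/-- Two finite families of reals in the same relative order are related by an order isomorphism. -/
theorem exists_orderIso_forall_eq {ι : Type*} [Fintype ι] {a b : ι → ℝ}
    (h : ∀ i j, a i < a j ↔ b i < b j) : ∃ φ : ℝ ≃o ℝ, ∀ i, φ (a i) = b i := by
  classical
  suffices H : ∀ s : Finset ι, ∃ φ : ℝ ≃o ℝ, ∀ i ∈ s, φ (a i) = b i by
    obtain ⟨φ, hφ⟩ := H Finset.univ
    exact ⟨φ, fun i => hφ i (Finset.mem_univ i)⟩
  intro s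
  -- Points are added in increasing order of `a`, so each new value is corrected by a kink to the
  -- right of all values already prescribed. A tie with the previous maximum needs no correction.
  induction s using Finset.induction_on_max_value a with
  | empty => exact ⟨OrderIso.refl ℝ, by simp⟩
  | insert i s hi hmax ih =>
    obtain ⟨φ, hφ⟩ := ih
    rcases s.eq_empty_or_nonempty with rfl | hs
    · exact ⟨OrderIso.addRight (b i - a i), by simp⟩
    · obtain ⟨m, hm, hm'⟩ := s.exists_max_image a hs
      rcases (hmax m hm).eq_or_lt with he | hlt
      · refine ⟨φ, fun j hj => ?_⟩
        rcases Finset.mem_insert.1 hj with rfl | hj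
        · rw [← he, hφ m hm]
          exact le_antisymm (not_lt.1 fun h' => he.le.not_gt ((h _ _).2 h'))
            (not_lt.1 fun h' => he.ge.not_gt ((h _ _).2 h'))
        · exact hφ j hj
      · obtain ⟨ψ, h1, h2⟩ := exists_orderIso_kink (m := b m) (x := φ (a i)) (y := b i)
          (by rw [← hφ m hm]; exact φ.lt_iff_lt.2 hlt) ((h _ _).1 hlt)
        refine ⟨φ.trans ψ, fun j hj => ?_⟩
        rw [OrderIso.trans_apply]
        rcases Finset.mem_insert.1 hj with rfl | hj
        · exact h2
        · rw [hφ j hj]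
          exact h1 _ (not_lt.1 fun h' => (hm' j hj).not_gt ((h _ _).2 h'))

/-! ### Configurations -/

/-- All local data become comparisons of `x` with the four numbers `l`, `contact μ β`, `q`, `p`,
together with the sign of `β`; an order isomorphism matching these four therefore matches the data.
-/
theorem hasLocal_iff {l μ β q p : ℝ} (R : Roots l μ β q p) (x : ℝ) (k : Local) :
    (Zv l μ β).HasLocal (x, 0) k ↔ match k with
      | .XUp => l < x
      | .XDown => x < l
      | .YUp => x < contact μ β
      | .YDown => contact μ β < x
      | .visX => x = l
      | .invX => False
      | .visY => β < 0 ∧ x = contact μ β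
      | .invY => 0 < β ∧ x = contact μ β
      | .eqX => False
      | .eqY => β = 0 ∧ x = contact μ β
      | .moveRight => (x < l ∧ x < contact μ β) ∧ q < x ∧ x < p ∨
          (l < x ∧ contact μ β < x) ∧ p < x
      | .moveLeft => (x < l ∧ x < contact μ β) ∧ (x < q ∨ p < x) ∨
          (l < x ∧ contact μ β < x) ∧ x < p
      | .rest => (x < l ∧ x < contact μ β) ∧ (x = q ∨ x = p) ∨
          (l < x ∧ contact μ β < x) ∧ x = p := by
  have hμ := R.lt_one
  cases k with
  | XUp => exact Xf_line_pos
  | XDown => exact Xf_line_neg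
  | YUp => exact Yf_line_pos hμ
  | YDown => exact Yf_line_neg hμ
  | visX => exact visFoldX_iff.trans (by simp)
  | invX => exact iff_false_intro not_invFoldX
  | visY => exact (visFoldY_iff hμ).trans (by simp)
  | invY => exact (invFoldY_iff hμ).trans (by simp)
  | eqX => exact iff_false_intro (X_ne_zero _ _ _ _)
  | eqY => exact Y_line_eq_zero hμ
  | moveRight =>
    change ((x, 0) ∈ _ ∪ _ ∧ 0 < (Zv l μ β).H x) ↔ _
    rw [mem_union, mem_sliding hμ, mem_escaping hμ, or_and_right]
    exact or_congr (and_congr_right fun h => R.H_sliding_pos h.1 h.2)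
      (and_congr_right fun h => R.H_escaping_pos h.1 h.2)
  | moveLeft =>
    change ((x, 0) ∈ _ ∪ _ ∧ (Zv l μ β).H x < 0) ↔ _
    rw [mem_union, mem_sliding hμ, mem_escaping hμ, or_and_right]
    exact or_congr (and_congr_right fun h => R.H_sliding_neg h.1 h.2)
      (and_congr_right fun h => R.H_escaping_neg h.1 h.2)
  | rest =>
    refine (pseudo_line hμ).trans ?_
    rw [or_and_right]
    exact or_congr (and_congr_right fun h => R.H_sliding_eq_zero h.1 h.2)
      (and_congr_right fun h => R.H_escaping_eq_zero h.1 h.2)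

theorem hasMark_iff {l μ β : ℝ} (hμ : μ < 1) (x : ℝ) (k : Mark) :
    (Zv l μ β).HasMark (x, 0) k ↔ match k with
      | .visX => x = l
      | .invX => False
      | .visY => β < 0 ∧ x = contact μ β
      | .invY => 0 < β ∧ x = contact μ β
      | .eqX => False
      | .eqY => β = 0 ∧ x = contact μ β
      | .stable => 0 < β ∧ x = β
      | .unstable => 0 < β ∧ x = -β := by
  cases k with
  | visX => exact visFoldX_iff.trans (by simp)
  | invX => exact iff_false_intro not_invFoldX
  | visY => exact (visFoldY_iff hμ).trans (by simp)
  | invY => exact (invFoldY_iff hμ).trans (by simp)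
  | eqX => exact iff_false_intro (X_ne_zero _ _ _ _)
  | eqY => exact Y_line_eq_zero hμ
  | stable => exact (stableHit_iff hμ).trans (by simp)
  | unstable => exact (unstableHit_iff hμ).trans (by simp)

/-- Equality of the data on which the configuration depends. -/
structure SameOrder (l β l' β' μ : ℝ) : Prop where
  neg_iff : β < 0 ↔ β' < 0
  pos_iff : 0 < β ↔ 0 < β'
  lt_iff : l < contact μ β ↔ l' < contact μ β'
  gt_iff : contact μ β < l ↔ contact μ β' < l'
  lt_neg_iff : 0 < β → (l < -β ↔ l' < -β')
  neg_lt_iff : 0 < β → (-β < l ↔ -β' < l')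
  lt_stable_iff : 0 < β → (l < β ↔ l' < β')
  stable_lt_iff : 0 < β → (β < l ↔ β' < l')

theorem eq_iff_of_lt_iff {a b a' b' : ℝ} (h1 : a < b ↔ a' < b') (h2 : b < a ↔ b' < a') :
    a = b ↔ a' = b' := by
  constructor <;> intro h <;> refine le_antisymm (not_lt.1 fun h' => ?_) (not_lt.1 fun h' => ?_)
  · exact h.le.not_gt (h2.2 h')
  · exact h.ge.not_gt (h1.2 h')
  · exact h.le.not_gt (h2.1 h')
  · exact h.ge.not_gt (h1.1 h')

theorem mul_contact_sub_pos_iff {β β' a a' : ℝ} (h1 : β < 0 ↔ β' < 0) (h2 : 0 < β ↔ 0 < β')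
    (h3 : 0 < a ↔ 0 < a') (h4 : a < 0 ↔ a' < 0) : 0 < β * a ↔ 0 < β' * a' := by
  rw [mul_pos_iff, mul_pos_iff, h1, h2, h3, h4]

theorem mul_contact_sub_neg_iff {β β' a a' : ℝ} (h1 : β < 0 ↔ β' < 0) (h2 : 0 < β ↔ 0 < β')
    (h3 : 0 < a ↔ 0 < a') (h4 : a < 0 ↔ a' < 0) : β * a < 0 ↔ β' * a' < 0 := by
  rw [mul_neg_iff, mul_neg_iff, h1, h2, h3, h4]

/-- The order of the four points is determined by `SameOrder`: `q` is leftmost, and the position of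
`p` depends only on the signs of `β` and `c - l`. -/
theorem exists_orderIso_local {l β l' β' μ q p q' p' : ℝ} (R : Roots l μ β q p)
    (R' : Roots l' μ β' q' p') (h : SameOrder l β l' β' μ) :
    ∃ φ : ℝ ≃o ℝ, φ l = l' ∧ φ (contact μ β) = contact μ β' ∧ φ q = q' ∧ φ p = p' := by
  have h3 : 0 < contact μ β - l ↔ 0 < contact μ β' - l' := by
    rw [sub_pos, sub_pos, h.lt_iff]
  have h4 : contact μ β - l < 0 ↔ contact μ β' - l' < 0 := by
    rw [sub_neg, sub_neg, h.gt_iff]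
  have a1 := R.fold_lt_root_iff.trans (h.lt_iff.trans R'.fold_lt_root_iff.symm)
  have a2 := R.root_lt_fold_iff.trans (h.gt_iff.trans R'.root_lt_fold_iff.symm)
  have a3 := R.contact_lt_root_iff.trans
    ((mul_contact_sub_pos_iff h.neg_iff h.pos_iff h3 h4).trans R'.contact_lt_root_iff.symm)
  have a4 := R.root_lt_contact_iff.trans
    ((mul_contact_sub_neg_iff h.neg_iff h.pos_iff h3 h4).trans R'.root_lt_contact_iff.symm)
  obtain ⟨φ, hφ⟩ := exists_orderIso_forall_eq (a := ![l, contact μ β, q, p])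
    (b := ![l', contact μ β', q', p']) (by
      intro i j
      fin_cases i <;> fin_cases j <;>
        simp [h.lt_iff, h.gt_iff, a1, a2, a3, a4, R.lt_fold, R.lt_contact, R.lt_root, R'.lt_fold,
          R'.lt_contact, R'.lt_root, R.lt_fold.not_gt, R.lt_contact.not_gt, R.lt_root.not_gt, R'.lt_fold.not_gt,
          R'.lt_contact.not_gt, R'.lt_root.not_gt])
  exact ⟨φ, hφ 0, hφ 1, hφ 2, hφ 3⟩

/-- For `β > 0` always `-β < 0 < c < β`, so only the position of `l` varies. Pseudo-equilibria are
not marks, hence `p` need not be compared with `±β`. -/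
theorem exists_orderIso_mark {l β l' β' μ : ℝ} (hμ0 : 0 < μ) (hμ : μ < 1)
    (h : SameOrder l β l' β' μ) :
    ∃ φ : ℝ ≃o ℝ, φ l = l' ∧ φ (contact μ β) = contact μ β' ∧
      (0 < β → φ β = β' ∧ φ (-β) = -β') := by
  by_cases hβ : 0 < β
  · have hβ' := h.pos_iff.1 hβ
    have a1 := contact_pos hμ0 hμ hβ
    have a2 := contact_pos hμ0 hμ hβ'
    have a3 := contact_lt hμ hβ
    have a4 := contact_lt hμ hβ'
    have b1 : -β < β := by linarith
    have b2 : -β' < β' := by linarith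
    have b3 : -β < contact μ β := by linarith
    have b4 : -β' < contact μ β' := by linarith
    obtain ⟨φ, hφ⟩ := exists_orderIso_forall_eq (a := ![l, contact μ β, β, -β])
      (b := ![l', contact μ β', β', -β']) (by
        intro i j
        fin_cases i <;> fin_cases j <;> dsimp <;>
          simp only [h.lt_iff, h.gt_iff, h.lt_neg_iff hβ, h.neg_lt_iff hβ, h.lt_stable_iff hβ,
            h.stable_lt_iff hβ, lt_irrefl, a3, a4, b1, b2, b3, b4, a3.not_gt, a4.not_gt,
            b1.not_gt, b2.not_gt, b3.not_gt, b4.not_gt])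
    exact ⟨φ, hφ 0, hφ 1, fun _ => ⟨hφ 2, hφ 3⟩⟩
  · obtain ⟨φ, hφ⟩ := exists_orderIso_forall_eq (a := ![l, contact μ β])
      (b := ![l', contact μ β']) (by
        intro i j
        fin_cases i <;> fin_cases j <;> simp [h.lt_iff, h.gt_iff])
    exact ⟨φ, hφ 0, hφ 1, fun h' => absurd h' hβ⟩

theorem zero_iff_of_sign_iff {β β' : ℝ} (h1 : β < 0 ↔ β' < 0) (h2 : 0 < β ↔ 0 < β') :
    β = 0 ↔ β' = 0 := eq_iff_of_lt_iff h1 h2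

theorem sameConfig_of_sameOrder {l β l' β' μ q p q' p' : ℝ} (R : Roots l μ β q p)
    (R' : Roots l' μ β' q' p') (h : SameOrder l β l' β' μ) :
    SameConfig (Zv l μ β) (Zv l' μ β') := by
  have h0 := zero_iff_of_sign_iff h.neg_iff h.pos_iff
  obtain ⟨φ, f1, f2, f3, f4⟩ := exists_orderIso_local R R' h
  obtain ⟨ψ, g1, g2, g3⟩ := exists_orderIso_mark R.pos R.lt_one h
  refine ⟨⟨φ, fun x k => ?_⟩, ⟨ψ, fun x k => ?_⟩⟩
  · rw [hasLocal_iff R, hasLocal_iff R', ← f1, ← f2, ← f3, ← f4]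
    simp only [φ.lt_iff_lt, φ.injective.eq_iff, h.neg_iff, h.pos_iff, h0]
  · rw [hasMark_iff R.lt_one, hasMark_iff R.lt_one, ← g1, ← g2]
    simp only [ψ.injective.eq_iff, h.neg_iff, h0, ← h.pos_iff]
    cases k <;> try rfl
    · exact and_congr_right fun hβ => by rw [← (g3 hβ).1, ψ.injective.eq_iff]
    · exact and_congr_right fun hβ => by rw [← (g3 hβ).2, ψ.injective.eq_iff]

/-- The marks alone suffice: the type of the contact of `Y` gives the sign of `β`, and `ψ` must
carry each marked point to its counterpart while preserving order. -/
theorem sameOrder_of_sameConfig {l β l' β' μ : ℝ} (hμ : μ < 1)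
    (h : SameConfig (Zv l μ β) (Zv l' μ β')) : SameOrder l β l' β' μ := by
  obtain ⟨-, ψ, hψ⟩ := h
  simp only [hasMark_iff hμ] at hψ
  have h1 : ψ l = l' := (hψ l .visX).1 rfl
  have hneg : β < 0 ↔ β' < 0 := by
    constructor <;> intro hβ
    · exact ((hψ (contact μ β) .visY).1 ⟨hβ, rfl⟩).1
    · exact ((hψ (ψ.symm (contact μ β')) .visY).2 ⟨hβ, ψ.apply_symm_apply _⟩).1
  have hpos : 0 < β ↔ 0 < β' := by
    constructor <;> intro hβ
    · exact ((hψ (contact μ β) .invY).1 ⟨hβ, rfl⟩).1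
    · exact ((hψ (ψ.symm (contact μ β')) .invY).2 ⟨hβ, ψ.apply_symm_apply _⟩).1
  have h2 : ψ (contact μ β) = contact μ β' := by
    rcases lt_trichotomy β 0 with hβ | hβ | hβ
    · exact ((hψ (contact μ β) .visY).1 ⟨hβ, rfl⟩).2
    · exact ((hψ (contact μ β) .eqY).1 ⟨hβ, rfl⟩).2
    · exact ((hψ (contact μ β) .invY).1 ⟨hβ, rfl⟩).2
  have h3 : 0 < β → ψ β = β' := fun hβ => ((hψ β .stable).1 ⟨hβ, rfl⟩).2
  have h4 : 0 < β → ψ (-β) = -β' := fun hβ => ((hψ (-β) .unstable).1 ⟨hβ, rfl⟩).2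
  refine ⟨hneg, hpos, ?_, ?_, fun hβ => ?_, fun hβ => ?_, fun hβ => ?_, fun hβ => ?_⟩
  · rw [← h1, ← h2, ψ.lt_iff_lt]
  · rw [← h1, ← h2, ψ.lt_iff_lt]
  · rw [← h1, ← h4 hβ, ψ.lt_iff_lt]
  · rw [← h1, ← h4 hβ, ψ.lt_iff_lt]
  · rw [← h1, ← h3 hβ, ψ.lt_iff_lt]
  · rw [← h1, ← h3 hβ, ψ.lt_iff_lt]

/-! ### Pseudo-equilibria -/

namespace Roots

variable {l μ β q p : ℝ} (R : Roots l μ β q p)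
include R

/-- The two conditions amount to `c < l` and `β (c - l) < 0`; the first reduces the second to `β >
0`. -/
theorem root_sliding_iff : (p < l ∧ p < contact μ β) ↔ 0 < β ∧ contact μ β < l := by
  rw [R.root_lt_fold_iff, R.root_lt_contact_iff]
  constructor
  · rintro ⟨h1, h2⟩
    exact ⟨by nlinarith, h1⟩
  · rintro ⟨h1, h2⟩
    exact ⟨h2, by nlinarith⟩

theorem root_escaping_iff : (l < p ∧ contact μ β < p) ↔ 0 < β ∧ l < contact μ β := by
  rw [R.fold_lt_root_iff, R.contact_lt_root_iff]
  constructor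
  · rintro ⟨h1, h2⟩
    exact ⟨by nlinarith, h1⟩
  · rintro ⟨h1, h2⟩
    exact ⟨h2, by nlinarith⟩

theorem pseudo_iff {w : ℝ × ℝ} : (Zv l μ β).Pseudo w ↔
    w = (q, 0) ∨ (0 < β ∧ contact μ β < l) ∧ w = (p, 0) ∨
      (0 < β ∧ l < contact μ β) ∧ w = (p, 0) := by
  rw [← R.root_sliding_iff, ← R.root_escaping_iff]
  have hl := R.lt_fold
  have hc := R.lt_contact
  constructor
  · intro h
    obtain ⟨x, y⟩ := w
    obtain rfl : y = 0 := Pseudo.mem_Sig h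
    rcases (hasLocal_iff R x .rest).1 h with ⟨⟨h1, h2⟩, rfl | rfl⟩ | ⟨⟨h1, h2⟩, rfl⟩
    · exact .inl rfl
    · exact .inr (.inl ⟨⟨h1, h2⟩, rfl⟩)
    · exact .inr (.inr ⟨⟨h1, h2⟩, rfl⟩)
  · rintro (rfl | ⟨h, rfl⟩ | ⟨h, rfl⟩)
    · exact (hasLocal_iff R q .rest).2 (.inl ⟨⟨hl, hc⟩, .inl rfl⟩)
    · exact (hasLocal_iff R p .rest).2 (.inl ⟨h, .inr rfl⟩)
    · exact (hasLocal_iff R p .rest).2 (.inr ⟨h, rfl⟩)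

theorem H_neg_of_lt {x : ℝ} (hx : x < q) : (Zv l μ β).H x < 0 :=
  (R.H_sliding_neg (hx.trans R.lt_fold) (hx.trans R.lt_contact)).2 (.inl hx)

theorem repels_left : Repels (Zv l μ β).H q := by
  refine ⟨(R.H_sliding_eq_zero R.lt_fold R.lt_contact).2 (.inl rfl), ?_, ?_⟩
  · filter_upwards [self_mem_nhdsWithin] with x hx
    exact R.H_neg_of_lt hx
  · filter_upwards [Ioo_mem_nhdsGT (lt_min (lt_min R.lt_fold R.lt_contact) R.lt_root)] with x hx
    obtain ⟨h1, h2⟩ := hx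
    simp only [lt_min_iff] at h2
    exact (R.H_sliding_pos h2.1.1 h2.1.2).2 ⟨h1, h2.2⟩

theorem attracts_right (h : p < l ∧ p < contact μ β) : Attracts (Zv l μ β).H p := by
  refine ⟨(R.H_sliding_eq_zero h.1 h.2).2 (.inr rfl), ?_, ?_⟩
  · filter_upwards [Ioo_mem_nhdsLT R.lt_root] with x hx
    exact (R.H_sliding_pos (hx.2.trans h.1) (hx.2.trans h.2)).2 hx
  · filter_upwards [Ioo_mem_nhdsGT (lt_min h.1 h.2)] with x hx
    obtain ⟨h1, h2⟩ := hx
    rw [lt_min_iff] at h2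
    exact (R.H_sliding_neg h2.1 h2.2).2 (.inr h1)

theorem repels_right (h : l < p ∧ contact μ β < p) : Repels (Zv l μ β).H p := by
  refine ⟨(R.H_escaping_eq_zero h.1 h.2).2 rfl, ?_, ?_⟩
  · filter_upwards [Ioo_mem_nhdsLT (max_lt h.1 h.2)] with x hx
    obtain ⟨h1, h2⟩ := hx
    rw [max_lt_iff] at h1
    exact (R.H_escaping_neg h1.1 h1.2).2 h2
  · filter_upwards [self_mem_nhdsWithin] with x hx
    exact (R.H_escaping_pos (h.1.trans hx) (h.2.trans hx)).2 hx

end Roots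

theorem Sys.Attracts.not_repels {v : ℝ → ℝ} {a : ℝ} (h : Attracts v a) : ¬ Repels v a := by
  intro h'
  obtain ⟨x, h1, h2⟩ := (h.2.1.and h'.2.1).exists
  exact h1.not_gt h2

theorem not_mem_escaping_of_mem_sliding {Z : Sys} {w : ℝ × ℝ} (h : w ∈ Z.sliding) :
    w ∉ Z.escaping := fun h' => h.2.1.not_gt h'.2.1

namespace Roots

variable {l μ β q p : ℝ} (R : Roots l μ β q p)
include R

/-- The root `q` repels inside the sliding region. The root `p` never qualifies, since it attracts
when it is sliding and repels when it is escaping. -/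
theorem sigmaSaddle_iff {w : ℝ × ℝ} : (Zv l μ β).SigmaSaddle w ↔ w = (q, 0) := by
  have hq : (q, 0) ∈ (Zv l μ β).sliding := (mem_sliding R.lt_one).2 ⟨R.lt_fold, R.lt_contact⟩
  constructor
  · rintro ⟨h1, h2⟩
    rcases R.pseudo_iff.1 h1 with rfl | ⟨h, rfl⟩ | ⟨h, rfl⟩
    · rfl
    · rw [← R.root_sliding_iff] at h
      rcases h2 with h2 | h2
      · exact absurd h2.1 (not_mem_escaping_of_mem_sliding ((mem_sliding R.lt_one).2 h))
      · exact absurd h2.2 (Attracts.not_repels (R.attracts_right h))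
    · rw [← R.root_escaping_iff] at h
      rcases h2 with h2 | h2
      · exact absurd (R.repels_right h) (Attracts.not_repels h2.2)
      · exact absurd ((mem_escaping R.lt_one).2 h) (not_mem_escaping_of_mem_sliding h2.1)
  · rintro rfl
    exact ⟨R.pseudo_iff.2 (.inl rfl), .inr ⟨hq, R.repels_left⟩⟩

theorem sigmaRepeller_iff {w : ℝ × ℝ} :
    (Zv l μ β).SigmaRepeller w ↔ (0 < β ∧ l < contact μ β) ∧ w = (p, 0) := by
  have hq : (q, 0) ∈ (Zv l μ β).sliding := (mem_sliding R.lt_one).2 ⟨R.lt_fold, R.lt_contact⟩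
  constructor
  · rintro ⟨h1, h2, h3⟩
    rcases R.pseudo_iff.1 h1 with rfl | ⟨h, rfl⟩ | ⟨h, rfl⟩
    · exact absurd h2 (not_mem_escaping_of_mem_sliding hq)
    · rw [← R.root_sliding_iff] at h
      exact absurd h2 (not_mem_escaping_of_mem_sliding ((mem_sliding R.lt_one).2 h))
    · exact ⟨h, rfl⟩
  · rintro ⟨h, rfl⟩
    have h' := R.root_escaping_iff.2 h
    exact ⟨R.pseudo_iff.2 (.inr (.inr ⟨h, rfl⟩)), (mem_escaping R.lt_one).2 h',
      R.repels_right h'⟩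

theorem sigmaAttractor_iff {w : ℝ × ℝ} :
    (Zv l μ β).SigmaAttractor w ↔ (0 < β ∧ contact μ β < l) ∧ w = (p, 0) := by
  constructor
  · rintro ⟨h1, h2, h3⟩
    rcases R.pseudo_iff.1 h1 with rfl | ⟨h, rfl⟩ | ⟨h, rfl⟩
    · exact absurd R.repels_left (Attracts.not_repels h3)
    · exact ⟨h, rfl⟩
    · rw [← R.root_escaping_iff] at h
      exact absurd ((mem_escaping R.lt_one).2 h) (not_mem_escaping_of_mem_sliding h2)
  · rintro ⟨h, rfl⟩
    have h' := R.root_sliding_iff.2 h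
    exact ⟨R.pseudo_iff.2 (.inr (.inl ⟨h, rfl⟩)), (mem_sliding R.lt_one).2 h',
      R.attracts_right h'⟩

end Roots

/-! ### Behaviours -/

/-- On the line, sliding or escaping means `X.f * Y.f < 0`, so the claim is the trichotomy for this
product. -/
theorem not_regular_iff {Z : Sys} {w : ℝ × ℝ} (hw : w ∈ Sig) :
    ¬ Z.Regular w ↔ Z.Xf w = 0 ∨ Z.Yf w = 0 ∨ Z.Pseudo w := by
  rw [← or_assoc, ← mul_eq_zero]
  have key : w ∈ Z.sliding ∪ Z.escaping ↔ Z.Xf w * Z.Yf w < 0 := by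
    simp only [sliding, escaping, mem_union, mem_ofPred_eq, hw, true_and, mul_neg_iff]
    exact or_comm
  rw [Regular, Pseudo, key]
  simp only [hw, true_and]
  rcases lt_trichotomy (Z.Xf w * Z.Yf w) 0 with h | h | h
  · simp [h, h.not_gt, h.ne]
  · simp [h]
  · simp [h, h.not_gt, h.ne']

/-- The saddle of `Y` counts only for `β ≥ 0`, when it lies in `y ≤ 0`. The listed points may
coincide: the two contacts if `l = c`, the saddle and the contact of `Y` if `β = 0`. -/
theorem Roots.singular_iff {l μ β q p : ℝ} (R : Roots l μ β q p) {w : ℝ × ℝ} :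
    (Zv l μ β).Singular w ↔ w = (l, 0) ∨ w = (contact μ β, 0) ∨ (0 ≤ β ∧ w = (0, -β)) ∨
      w = (q, 0) ∨ (0 < β ∧ l ≠ contact μ β) ∧ w = (p, 0) := by
  have h5 : (0 < β ∧ l ≠ contact μ β) ∧ w = (p, 0) ↔
      (0 < β ∧ contact μ β < l) ∧ w = (p, 0) ∨ (0 < β ∧ l < contact μ β) ∧ w = (p, 0) := by
    rw [ne_iff_lt_or_gt]
    tauto
  rw [h5, ← R.pseudo_iff]
  constructor
  · rintro (⟨-, h⟩ | ⟨h1, h⟩ | ⟨h1, h⟩)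
    · exact absurd h (X_ne_zero _ _ _ _)
    · obtain rfl := (Y_eq_zero R.lt_one).1 h
      have h1 : -β ≤ 0 := h1
      exact .inr (.inr (.inl ⟨by linarith, rfl⟩))
    · rcases (not_regular_iff h1).1 h with h | h | h
      · rw [Xf_eq, sub_eq_zero] at h
        exact .inl (Prod.ext h h1)
      · exact .inr (.inl (contact_of_Yf R.lt_one h1 h))
      · exact .inr (.inr (.inr h))
  · rintro (rfl | rfl | ⟨h, rfl⟩ | h)
    · exact .inr (.inr ⟨mk_mem_Sig _, (not_regular_iff (mk_mem_Sig _)).2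
        (.inl (Xf_line_eq_zero.2 rfl))⟩)
    · exact .inr (.inr ⟨mk_mem_Sig _, (not_regular_iff (mk_mem_Sig _)).2
        (.inr (.inl ((Yf_line_eq_zero R.lt_one).2 rfl)))⟩)
    · exact .inr (.inl ⟨neg_nonpos.2 h, (Y_eq_zero R.lt_one).2 rfl⟩)
    · exact .inr (.inr ⟨Pseudo.mem_Sig h, (not_regular_iff (Pseudo.mem_Sig h)).2 (.inr (.inr h))⟩)

theorem Roots.hasKind_iff {l μ β q p : ℝ} (R : Roots l μ β q p) (w : ℝ × ℝ) (k : Kind) :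
    (Zv l μ β).HasKind w k ↔ match k with
      | .onLine => w.2 = 0
      | .eqX => False
      | .eqY => 0 ≤ β ∧ w = (0, -β)
      | .saddleX => False
      | .saddleY => 0 ≤ β ∧ w = (0, -β)
      | .visX => w = (l, 0)
      | .invX => False
      | .visY => β < 0 ∧ w = (contact μ β, 0)
      | .invY => 0 < β ∧ w = (contact μ β, 0)
      | .sigmaSaddle => w = (q, 0)
      | .sigmaRepeller => (0 < β ∧ l < contact μ β) ∧ w = (p, 0)
      | .sigmaAttractor => (0 < β ∧ contact μ β < l) ∧ w = (p, 0) := by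
  have hμ := R.lt_one
  have hS : w ∈ SigMinus ∧ w = (0, -β) ↔ 0 ≤ β ∧ w = (0, -β) :=
    and_congr_left fun h => by rw [h]; exact neg_nonpos (a := β)
  cases k with
  | onLine => exact Iff.rfl
  | eqX => exact iff_false_intro fun h => X_ne_zero _ _ _ _ h.2
  | eqY => exact (and_congr_right fun _ => Y_eq_zero hμ).trans hS
  | saddleX => exact iff_false_intro fun h => X_ne_zero _ _ _ _ h.2.1
  | saddleY => exact (and_congr_right fun _ => hypSaddle_Y hμ).trans hS
  | visX => exact visFoldX_iff
  | invX => exact iff_false_intro not_invFoldX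
  | visY => exact visFoldY_iff hμ
  | invY => exact invFoldY_iff hμ
  | sigmaSaddle => exact R.sigmaSaddle_iff
  | sigmaRepeller => exact R.sigmaRepeller_iff
  | sigmaAttractor => exact R.sigmaAttractor_iff

/-- Two subtypes that are labelled by the same index set, with the same coincidences between
labels, are in a bijection which respects the labels. -/
theorem exists_equiv_of_labels {ι α α' : Type*} {P : α → Prop} {P' : α' → Prop} {A : ι → Prop}
    {s : ι → α} {s' : ι → α'} (hP : ∀ w, P w ↔ ∃ i, A i ∧ w = s i)
    (hP' : ∀ w, P' w ↔ ∃ i, A i ∧ w = s' i)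
    (h : ∀ i j, A i → A j → (s i = s j ↔ s' i = s' j)) :
    ∃ e : {w // P w} ≃ {w // P' w}, ∀ w : {w // P w}, ∃ i, A i ∧ w.1 = s i ∧ (e w).1 = s' i := by
  -- An arbitrary choice of one label per point is harmless: by `h` all labels of a point have the
  -- same image.
  choose g hgA hgs using fun w : {w // P w} => (hP w.1).1 w.2
  choose g' hgA' hgs' using fun w : {w // P' w} => (hP' w.1).1 w.2
  refine ⟨⟨fun w => ⟨s' (g w), (hP' _).2 ⟨_, hgA w, rfl⟩⟩,
    fun w => ⟨s (g' w), (hP _).2 ⟨_, hgA' w, rfl⟩⟩, fun w => ?_, fun w => ?_⟩,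
    fun w => ⟨g w, hgA w, hgs w, rfl⟩⟩
  · apply Subtype.ext
    dsimp only
    rw [hgs w, h _ _ (hgA' _) (hgA _), ← hgs']
  · apply Subtype.ext
    dsimp only
    rw [hgs' w, ← h _ _ (hgA _) (hgA' _), ← hgs]

/-- Equality of the data on which the behaviour depends. -/
structure SameType (l β l' β' μ : ℝ) : Prop where
  neg_iff : β < 0 ↔ β' < 0
  pos_iff : 0 < β ↔ 0 < β'
  eq_iff : l = contact μ β ↔ l' = contact μ β'
  lt_iff : 0 < β → (l < contact μ β ↔ l' < contact μ β')

/-- The labels of the singular points. -/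
inductive Label
  | fold | contact | saddle | left | right

/-- The labels that occur for given parameters. -/
def Label.Occurs (l μ β : ℝ) : Label → Prop
  | .fold => True
  | .contact => True
  | .saddle => 0 ≤ β
  | .left => True
  | .right => 0 < β ∧ l ≠ FoldSaddle.contact μ β

/-- The singular point with a given label. -/
def Label.point (l μ β q p : ℝ) : Label → ℝ × ℝ
  | .fold => (l, 0)
  | .contact => (FoldSaddle.contact μ β, 0)
  | .saddle => (0, -β)
  | .left => (q, 0)
  | .right => (p, 0)

theorem Roots.singular_iff_label {l μ β q p : ℝ} (R : Roots l μ β q p) (w : ℝ × ℝ) :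
    (Zv l μ β).Singular w ↔ ∃ i : Label, i.Occurs l μ β ∧ w = i.point l μ β q p := by
  rw [R.singular_iff]
  constructor
  · rintro (h | h | h | h | h)
    · exact ⟨.fold, trivial, h⟩
    · exact ⟨.contact, trivial, h⟩
    · exact ⟨.saddle, h⟩
    · exact ⟨.left, trivial, h⟩
    · exact ⟨.right, h⟩
  · rintro ⟨_ | _ | _ | _ | _, h⟩
    · exact .inl h.2
    · exact .inr (.inl h.2)
    · exact .inr (.inr (.inl h))
    · exact .inr (.inr (.inr (.inl h.2)))
    · exact .inr (.inr (.inr (.inr h)))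

/-- The coincidences between labelled points. -/
theorem Roots.point_eq_iff {l μ β q p : ℝ} (R : Roots l μ β q p) (i j : Label)
    (hi : i.Occurs l μ β) (hj : j.Occurs l μ β) :
    i.point l μ β q p = j.point l μ β q p ↔ match i, j with
      | .fold, .contact => l = FoldSaddle.contact μ β
      | .contact, .fold => l = FoldSaddle.contact μ β
      | .fold, .saddle => β = 0 ∧ l = FoldSaddle.contact μ β
      | .saddle, .fold => β = 0 ∧ l = FoldSaddle.contact μ β
      | .contact, .saddle => β = 0
      | .saddle, .contact => β = 0
      | .fold, .fold => True
      | .contact, .contact => True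
      | .saddle, .saddle => True
      | .left, .left => True
      | .right, .right => True
      | _, _ => False := by
  have h1 := R.lt_fold.ne
  have h2 := R.lt_contact.ne
  have h3 := R.lt_root.ne
  have h4 : ∀ x : ℝ, ((x, 0) : ℝ × ℝ) = (0, -β) ↔ β = 0 ∧ x = FoldSaddle.contact μ β := by
    intro x
    rw [Prod.mk.injEq, zero_eq_neg, and_comm]
    refine and_congr_right fun h => ?_
    rw [h, contact_zero]
  -- When `p` occurs it lies in the open sliding or escaping region, away from both contacts.
  have h5 : ∀ hβ : Label.right.Occurs l μ β, p ≠ l ∧ p ≠ FoldSaddle.contact μ β := by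
    rintro ⟨hβ, hne⟩
    rcases lt_or_gt_of_ne hne with h | h
    · obtain ⟨h6, h7⟩ := R.root_escaping_iff.2 ⟨hβ, h⟩
      exact ⟨h6.ne', h7.ne'⟩
    · obtain ⟨h6, h7⟩ := R.root_sliding_iff.2 ⟨hβ, h⟩
      exact ⟨h6.ne, h7.ne⟩
  have h8 := eq_comm (a := FoldSaddle.contact μ β) (b := l)
  by_cases hr : Label.right.Occurs l μ β
  · obtain ⟨h6, h7⟩ := h5 hr
    cases i <;> cases j <;>
      simp [Label.point, h4, eq_comm (a := ((0, -β) : ℝ × ℝ)), h8, h1, h2, h3, h1.symm, h2.symm,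
        h3.symm, h6, h7, h6.symm, h7.symm]
  · cases i <;> cases j <;> first
      | exact absurd hi hr
      | exact absurd hj hr
      | simp [Label.point, h4, eq_comm (a := ((0, -β) : ℝ × ℝ)), h8, h1, h2, h1.symm, h2.symm]

theorem SameType.occurs_iff {l β l' β' μ : ℝ} (h : SameType l β l' β' μ) (i : Label) :
    i.Occurs l μ β ↔ i.Occurs l' μ β' := by
  cases i with
  | saddle => simpa only [Label.Occurs, not_lt] using not_congr h.neg_iff
  | right => exact and_congr h.pos_iff (not_congr h.eq_iff)
  | _ => exact Iff.rfl

theorem SameType.gt_iff {l β l' β' μ : ℝ} (h : SameType l β l' β' μ) (hβ : 0 < β) :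
    contact μ β < l ↔ contact μ β' < l' := by
  have h1 := h.lt_iff hβ
  have h2 := h.eq_iff
  rw [← not_le, ← not_le, le_iff_lt_or_eq, le_iff_lt_or_eq, h1, h2]

theorem SameType.zero_iff {l β l' β' μ : ℝ} (h : SameType l β l' β' μ) : β = 0 ↔ β' = 0 :=
  zero_iff_of_sign_iff h.neg_iff h.pos_iff

/-- The bijection sends each labelled point to the point with the same label. A kind other than
`onLine` either never occurs or says that a label occurs and names this point, so agreement of the
coincidences transports it. -/
theorem sameBehaviour_of_sameType {l β l' β' μ q p q' p' : ℝ} (R : Roots l μ β q p)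
    (R' : Roots l' μ β' q' p') (h : SameType l β l' β' μ) :
    SameBehaviour (Zv l μ β) (Zv l' μ β') := by
  have key : ∀ i j : Label, i.Occurs l μ β → j.Occurs l μ β →
      (i.point l μ β q p = j.point l μ β q p ↔
        i.point l' μ β' q' p' = j.point l' μ β' q' p') := fun i j hi hj => by
    rw [R.point_eq_iff i j hi hj, R'.point_eq_iff i j ((h.occurs_iff i).1 hi)
      ((h.occurs_iff j).1 hj), h.eq_iff, h.zero_iff]
    cases i <;> cases j <;> rfl
  obtain ⟨e, he⟩ := exists_equiv_of_labels R.singular_iff_label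
    (fun w => (R'.singular_iff_label w).trans
      (exists_congr fun i => and_congr_left fun _ => (h.occurs_iff i).symm)) key
  refine ⟨e, fun w k => ?_⟩
  obtain ⟨i, hi, h1, h2⟩ := he w
  have k1 : i.point l μ β q p = (l, 0) ↔ i.point l' μ β' q' p' = (l', 0) := key i .fold hi trivial
  have k2 : i.point l μ β q p = (contact μ β, 0) ↔ i.point l' μ β' q' p' = (contact μ β', 0) :=
    key i .contact hi trivial
  have k3 : 0 ≤ β → (i.point l μ β q p = (0, -β) ↔ i.point l' μ β' q' p' = (0, -β')) :=
    fun h' => key i .saddle hi h'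
  have k4 : i.point l μ β q p = (q, 0) ↔ i.point l' μ β' q' p' = (q', 0) :=
    key i .left hi trivial
  have k5 : 0 < β ∧ l ≠ contact μ β →
      (i.point l μ β q p = (p, 0) ↔ i.point l' μ β' q' p' = (p', 0)) :=
    fun h' => key i .right hi h'
  have k6 : 0 ≤ β ↔ 0 ≤ β' := h.occurs_iff .saddle
  rw [R.hasKind_iff, R'.hasKind_iff, h1, h2]
  cases k with
  | onLine =>
    cases i with
    | saddle =>
      change -β = 0 ↔ -β' = 0
      rw [neg_eq_zero, neg_eq_zero, h.zero_iff]
    | _ => exact Iff.rfl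
  | eqX => exact Iff.rfl
  | eqY => exact (and_congr_right k3).trans (and_congr_left fun _ => k6)
  | saddleX => exact Iff.rfl
  | saddleY => exact (and_congr_right k3).trans (and_congr_left fun _ => k6)
  | visX => exact k1
  | invX => exact Iff.rfl
  | visY => exact and_congr h.neg_iff k2
  | invY => exact and_congr h.pos_iff k2
  | sigmaSaddle => exact k4
  | sigmaRepeller =>
    dsimp only
    rw [← h.pos_iff, ← and_congr_right h.lt_iff]
    exact and_congr_right fun h' => k5 ⟨h'.1, h'.2.ne⟩
  | sigmaAttractor =>
    dsimp only
    rw [← h.pos_iff, ← and_congr_right h.gt_iff]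
    exact and_congr_right fun h' => k5 ⟨h'.1, h'.2.ne'⟩

/-! ### Recovering the type from the kinds of the singular points -/

theorem Sys.SameBehaviour.exists_iff {Z W : Sys} (h : SameBehaviour Z W) (k m : Kind) :
    (∃ w, Z.Singular w ∧ Z.HasKind w k ∧ Z.HasKind w m) ↔
      ∃ w, W.Singular w ∧ W.HasKind w k ∧ W.HasKind w m := by
  obtain ⟨e, he⟩ := h
  constructor
  · rintro ⟨w, h1, h2, h3⟩
    exact ⟨e ⟨w, h1⟩, (e ⟨w, h1⟩).2, (he ⟨w, h1⟩ k).1 h2, (he ⟨w, h1⟩ m).1 h3⟩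
  · rintro ⟨w, h1, h2, h3⟩
    refine ⟨e.symm ⟨w, h1⟩, (e.symm ⟨w, h1⟩).2, (he _ k).2 ?_, (he _ m).2 ?_⟩ <;>
      rwa [Equiv.apply_symm_apply]

namespace Roots

variable {l μ β q p : ℝ} (R : Roots l μ β q p)
include R

theorem exists_visY_iff :
    (∃ w, (Zv l μ β).Singular w ∧ (Zv l μ β).HasKind w .visY ∧ (Zv l μ β).HasKind w .visY) ↔
      β < 0 := by
  simp only [R.hasKind_iff, and_self]
  exact ⟨fun ⟨_, _, h, _⟩ => h, fun h => ⟨_, R.singular_iff.2 (.inr (.inl rfl)), h, rfl⟩⟩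

theorem exists_invY_iff :
    (∃ w, (Zv l μ β).Singular w ∧ (Zv l μ β).HasKind w .invY ∧ (Zv l μ β).HasKind w .invY) ↔
      0 < β := by
  simp only [R.hasKind_iff, and_self]
  exact ⟨fun ⟨_, _, h, _⟩ => h, fun h => ⟨_, R.singular_iff.2 (.inr (.inl rfl)), h, rfl⟩⟩

theorem exists_repeller_iff :
    (∃ w, (Zv l μ β).Singular w ∧ (Zv l μ β).HasKind w .sigmaRepeller ∧
      (Zv l μ β).HasKind w .sigmaRepeller) ↔ 0 < β ∧ l < contact μ β := by
  simp only [R.hasKind_iff, and_self]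
  exact ⟨fun ⟨_, _, h, _⟩ => h, fun h => ⟨_, R.singular_iff.2
    (.inr (.inr (.inr (.inr ⟨⟨h.1, h.2.ne⟩, rfl⟩)))), h, rfl⟩⟩

/-- The equality `l = c` is seen as one point carrying the fold of `X` and the contact of `Y`; the
three alternatives are the forms of the latter for `β < 0`, `β = 0`, `β > 0`. -/
theorem exists_doubleContact_iff :
    ((∃ w, (Zv l μ β).Singular w ∧ (Zv l μ β).HasKind w .visX ∧ (Zv l μ β).HasKind w .visY) ∨
      (∃ w, (Zv l μ β).Singular w ∧ (Zv l μ β).HasKind w .visX ∧ (Zv l μ β).HasKind w .eqY) ∨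
      ∃ w, (Zv l μ β).Singular w ∧ (Zv l μ β).HasKind w .visX ∧ (Zv l μ β).HasKind w .invY) ↔
      l = contact μ β := by
  simp only [R.hasKind_iff]
  constructor
  · rintro (⟨w, -, rfl, -, h⟩ | ⟨w, -, rfl, -, h⟩ | ⟨w, -, rfl, -, h⟩)
    · exact congrArg Prod.fst h
    · obtain ⟨rfl, h⟩ := Prod.mk.inj h
      obtain rfl : β = 0 := by linarith
      rw [contact_zero]
    · exact congrArg Prod.fst h
  · intro h
    have hs := R.singular_iff.2 (.inl (rfl : ((l, 0) : ℝ × ℝ) = (l, 0)))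
    rcases lt_trichotomy β 0 with hβ | hβ | hβ
    · exact .inl ⟨(l, 0), hs, rfl, hβ, by rw [h]⟩
    · refine .inr (.inl ⟨(l, 0), hs, rfl, hβ.ge, ?_⟩)
      rw [h, hβ, contact_zero, neg_zero]
    · exact .inr (.inr ⟨(l, 0), hs, rfl, hβ, by rw [h]⟩)

end Roots

theorem sameType_of_sameBehaviour {l β l' β' μ q p q' p' : ℝ} (R : Roots l μ β q p)
    (R' : Roots l' μ β' q' p') (h : SameBehaviour (Zv l μ β) (Zv l' μ β')) :
    SameType l β l' β' μ := by
  have hpos : 0 < β ↔ 0 < β' := by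
    rw [← R.exists_invY_iff, ← R'.exists_invY_iff]
    exact h.exists_iff _ _
  refine ⟨?_, hpos, ?_, fun hβ => ?_⟩
  · rw [← R.exists_visY_iff, ← R'.exists_visY_iff]
    exact h.exists_iff _ _
  · rw [← R.exists_doubleContact_iff, ← R'.exists_doubleContact_iff]
    exact or_congr (h.exists_iff _ _) (or_congr (h.exists_iff _ _)
      (h.exists_iff _ _))
  · have h1 := h.exists_iff .sigmaRepeller .sigmaRepeller
    rw [R.exists_repeller_iff, R'.exists_repeller_iff, ← hpos] at h1
    simpa only [hβ, true_and] using h1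

/-! ### Orbit arcs of `X` and `Y` -/

theorem Sys.Arc.left_mem {V : ℝ × ℝ → ℝ × ℝ} {D : Set (ℝ × ℝ)} {p q : ℝ × ℝ} (h : Arc V D p q) :
    p ∈ D := by
  obtain ⟨T, hT, γ, h0, -, h⟩ := h
  exact h0 ▸ (h 0 ⟨le_rfl, hT⟩).1

theorem arc_of_hasDerivAt {V : ℝ × ℝ → ℝ × ℝ} {D : Set (ℝ × ℝ)} {g : ℝ → ℝ × ℝ} {a b : ℝ}
    (hab : a ≤ b) (h : ∀ t, HasDerivAt g (V (g t)) t) (hD : ∀ t ∈ Icc a b, g t ∈ D) :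
    Arc V D (g a) (g b) := by
  refine ⟨b - a, sub_nonneg.2 hab, fun t => g (a + t), by simp, by simp, fun t ht => ⟨hD _ ?_, ?_⟩⟩
  · exact ⟨by linarith [ht.1], by linarith [ht.2]⟩
  · exact ((h (a + t)).comp_const_add a t).hasDerivWithinAt

/-- The arc of duration `0` makes the domain `D` visible in the arc relation, hence accessible to
topological equivalences. -/
theorem arc_self_iff {V : ℝ × ℝ → ℝ × ℝ} {D : Set (ℝ × ℝ)} {p : ℝ × ℝ} :
    Arc V D p p ↔ p ∈ D := by
  refine ⟨Arc.left_mem, fun h => ⟨0, le_rfl, fun _ => p, rfl, rfl, fun t ht => ⟨h, ?_⟩⟩⟩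
  rw [Icc_self, mem_singleton_iff] at ht
  subst ht
  rw [Icc_self]
  exact HasFDerivWithinAt.of_finite (finite_singleton (0 : ℝ))

theorem eventually_pos_of_hasDerivWithinAt {g : ℝ → ℝ} {d : ℝ} (h0 : g 0 = 0) (hd : 0 < d)
    (h : HasDerivWithinAt g d (Ici 0) 0) : ∀ᶠ t in 𝓝[>] (0 : ℝ), 0 < g t := by
  have h1 := (hasDerivWithinAt_iff_tendsto_slope' self_notMem_Ioi).1 h.Ioi_of_Ici
  filter_upwards [h1.eventually (lt_mem_nhds hd), self_mem_nhdsWithin] with t ht ht0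
  rw [slope_def_field, h0, sub_zero, sub_zero] at ht
  exact (div_pos_iff_of_pos_right ht0).1 ht

/-- An orbit arc inside `{g ≤ 0}` does not leave a point of `{g = 0}` where `g` increases. -/
theorem Sys.Arc.eq_of_pos {V : ℝ × ℝ → ℝ × ℝ} {D : Set (ℝ × ℝ)} {p q : ℝ × ℝ}
    (L : (ℝ × ℝ) →L[ℝ] ℝ) (hp : L p = 0) (hV : 0 < L (V p)) (hD : ∀ w ∈ D, L w ≤ 0)
    (h : Arc V D p q) : q = p := by
  obtain ⟨T, hT, γ, h0, h1, h⟩ := h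
  rcases hT.eq_or_lt with rfl | hT
  · rw [← h0, ← h1]
  · exfalso
    have h2 : HasDerivWithinAt (fun t => L (γ t)) (L (V p)) (Ici 0) 0 := by
      have h3 := L.hasFDerivAt.comp_hasDerivWithinAt 0 (h 0 ⟨le_rfl, hT.le⟩).2
      rw [h0] at h3
      exact h3.mono_of_mem_nhdsWithin (Icc_mem_nhdsGE hT)
    have h3 := eventually_pos_of_hasDerivWithinAt (by rw [h0, hp]) hV h2
    obtain ⟨t, ht, ht'⟩ := (h3.and (Ioo_mem_nhdsGT hT)).exists
    exact ht.not_ge (hD _ (h t ⟨ht'.1.le, ht'.2.le⟩).1)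

/-- The flow of `X` at time `t`. -/
def flowX (l : ℝ) (p : ℝ × ℝ) (t : ℝ) : ℝ × ℝ := (p.1 + t, p.2 + ((p.1 - l) * t + t ^ 2 / 2))

theorem hasDerivAt_flowX (l μ β : ℝ) (p : ℝ × ℝ) (t : ℝ) :
    HasDerivAt (flowX l p) ((Zv l μ β).X (flowX l p t)) t := by
  have h1 : HasDerivAt (flowX l p) (_, _) t := ((hasDerivAt_id t).const_add p.1).prodMk
    ((((hasDerivAt_id t).const_mul (p.1 - l)).add (((hasDerivAt_id t).pow 2).div_const 2)).const_add
      p.2)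
  refine h1.congr_deriv (Prod.ext rfl ?_)
  simp [Zv, flowX]
  ring

theorem flowX_zero (l : ℝ) (p : ℝ × ℝ) : flowX l p 0 = p := by
  refine Prod.ext ?_ ?_ <;> simp [flowX]

theorem flowX_ne {l : ℝ} {p : ℝ × ℝ} {t : ℝ} (ht : t ≠ 0) : flowX l p t ≠ p := fun h =>
  ht (by simpa [flowX] using congrArg Prod.fst h)

theorem arcX_flowX_one {l μ β : ℝ} {p : ℝ × ℝ} (hp : p ∈ SigPlus) (h : l ≤ p.1) :
    (Zv l μ β).ArcX p (flowX l p 1) := by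
  have := arc_of_hasDerivAt (D := SigPlus) zero_le_one (hasDerivAt_flowX l μ β p) fun t ht => by
    have h1 : 0 ≤ p.2 := hp
    have h2 := mul_nonneg (sub_nonneg.2 h) ht.1
    change 0 ≤ p.2 + ((p.1 - l) * t + t ^ 2 / 2)
    positivity
  rwa [flowX_zero] at this

theorem arcX_flowX_neg_one {l μ β : ℝ} {p : ℝ × ℝ} (hp : p ∈ SigPlus) (h : p.1 ≤ l) :
    (Zv l μ β).ArcX (flowX l p (-1)) p := by
  have := arc_of_hasDerivAt (D := SigPlus) (neg_nonpos.2 zero_le_one)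
    (hasDerivAt_flowX l μ β p) fun t ht => by
    have h1 : 0 ≤ p.2 := hp
    have h2 := mul_nonneg_of_nonpos_of_nonpos (sub_nonpos.2 h) ht.2
    change 0 ≤ p.2 + ((p.1 - l) * t + t ^ 2 / 2)
    positivity
  rwa [flowX_zero] at this

theorem arcY_iff {l μ β : ℝ} {p q : ℝ × ℝ} : (Zv l μ β).ArcY p q ↔
    ∃ T, 0 ≤ T ∧ q = flowY μ β p T ∧ ∀ t ∈ Icc 0 T, flowY μ β p t ∈ SigMinus := by
  constructor
  · rintro ⟨T, hT, γ, rfl, rfl, h⟩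
    have h1 : ∀ t ∈ Icc 0 T, γ t = flowY μ β (γ 0) t := fun t ht =>
      eq_flowY (convex_Icc 0 T) ⟨le_rfl, hT⟩ (fun t ht => (h t ht).2) ht
    exact ⟨T, hT, h1 T ⟨hT, le_rfl⟩, fun t ht => h1 t ht ▸ (h t ht).1⟩
  · rintro ⟨T, hT, rfl, h⟩
    have := arc_of_hasDerivAt (D := SigMinus) hT (hasDerivAt_flowY l μ β p) h
    rwa [flowY_zero] at this

theorem arcY_of_backward {l μ β : ℝ} {p : ℝ × ℝ} {T : ℝ} (hT : 0 ≤ T)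
    (h : ∀ t ∈ Icc (-T) 0, flowY μ β p t ∈ SigMinus) : (Zv l μ β).ArcY (flowY μ β p (-T)) p := by
  have := arc_of_hasDerivAt (D := SigMinus) (neg_nonpos.2 hT) (hasDerivAt_flowY l μ β p) h
  rwa [flowY_zero] at this

/-- Off the saddle one of `u`, `v` is nonzero, and it is multiplied by an exponential different from
`1`. -/
theorem flowY_ne {μ β : ℝ} (hμ : μ < 1) {p : ℝ × ℝ} (hp : p ≠ (0, -β)) {t : ℝ} (ht : t ≠ 0) :
    flowY μ β p t ≠ p := by
  intro h
  have h1 := flowY_add_coord μ β p t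
  have h2 := flowY_sub_coord μ β p t
  rw [h] at h1 h2
  have h3 : p.1 + (p.2 + β) = 0 := by
    by_contra h3
    have h4 := (mul_eq_left₀ h3).1 h1.symm
    rw [Real.exp_eq_one_iff, mul_eq_zero] at h4
    exact h4.elim (by intro; linarith) ht
  have h5 : p.1 - (p.2 + β) = 0 := by
    by_contra h3
    exact ht ((Real.exp_eq_one_iff _).1 ((mul_eq_left₀ h3).1 h2.symm))
  exact hp (Prod.ext (by dsimp only; linarith) (by dsimp only; linarith))

theorem flowY_equilibrium (μ β t : ℝ) : flowY μ β (0, -β) t = (0, -β) := by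
  simp [flowY]

theorem flowY_contact_snd {μ : ℝ} (hμ : μ < 1) (β t : ℝ) : (flowY μ β (contact μ β, 0) t).2 =
    β / (2 - μ) * (Real.exp (-(1 - μ) * t) + (1 - μ) * Real.exp t - (2 - μ)) := by
  have h : 2 - μ ≠ 0 := by linarith
  simp only [flowY, contact]
  field_simp
  ring

/-- The tangent estimates `exp s ≥ 1 + s` add up with cancelling linear terms. Thus the orbit
through the contact lies, for `t ≠ 0`, strictly on the side given by the sign of `β`. -/
theorem flowY_contact_factor_pos {μ : ℝ} (hμ : μ < 1) {t : ℝ} (ht : t ≠ 0) :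
    0 < Real.exp (-(1 - μ) * t) + (1 - μ) * Real.exp t - (2 - μ) := by
  have h1 := Real.add_one_lt_exp ht
  have h2 := Real.add_one_le_exp (-(1 - μ) * t)
  nlinarith

theorem hasDerivAt_flowY_snd (l μ β : ℝ) (p : ℝ × ℝ) :
    HasDerivAt (fun t => (flowY μ β p t).2) ((Zv l μ β).Yf p) 0 := by
  have h := (ContinuousLinearMap.snd ℝ ℝ ℝ).hasFDerivAt.comp_hasDerivAt 0
    (hasDerivAt_flowY l μ β p 0)
  rw [flowY_zero] at h
  rw [Yf, lie_f]
  exact h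

/-! ### Stuck points -/

/-- `p` is in the domain of the relation, but related only to itself. -/
def Stuck (A : ℝ × ℝ → ℝ × ℝ → Prop) (p : ℝ × ℝ) : Prop := A p p ∧ ∀ q, A p q ∨ A q p → q = p

/-- `p` is related to some other point. -/
def Leaves (A : ℝ × ℝ → ℝ × ℝ → Prop) (p : ℝ × ℝ) : Prop := ∃ q, q ≠ p ∧ A p q

theorem stuck_iff_of_equiv {A B : ℝ × ℝ → ℝ × ℝ → Prop} {h : (ℝ × ℝ) ≃ₜ (ℝ × ℝ)}
    (hAB : ∀ p q, A p q ↔ B (h p) (h q)) (p : ℝ × ℝ) : Stuck A p ↔ Stuck B (h p) := by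
  refine and_congr (hAB p p) (h.toEquiv.forall_congr fun q => ?_)
  change _ ↔ (B (h p) (h q) ∨ B (h q) (h p) → h q = h p)
  rw [hAB, hAB, h.injective.eq_iff]

theorem leaves_iff_of_equiv {A B : ℝ × ℝ → ℝ × ℝ → Prop} {h : (ℝ × ℝ) ≃ₜ (ℝ × ℝ)}
    (hAB : ∀ p q, A p q ↔ B (h p) (h q)) (p : ℝ × ℝ) : Leaves A p ↔ Leaves B (h p) := by
  refine h.toEquiv.exists_congr fun q => ?_
  change _ ↔ h q ≠ h p ∧ B (h p) (h q)
  rw [hAB, h.injective.ne_iff]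

/-- To the right of the fold orbits of `X` rise forward in time, to the left they rise backward in
time, so a nontrivial arc in `y ≥ 0` is always available. -/
theorem not_stuck_arcX (l μ β : ℝ) (p : ℝ × ℝ) : ¬ Stuck (Zv l μ β).ArcX p := by
  rintro ⟨h1, h2⟩
  have hp : p ∈ SigPlus := arc_self_iff.1 h1
  rcases le_total l p.1 with h | h
  · exact flowX_ne one_ne_zero (h2 _ (.inl (arcX_flowX_one hp h)))
  · exact flowX_ne (neg_ne_zero.2 one_ne_zero) (h2 _ (.inr (arcX_flowX_neg_one hp h)))

theorem not_stuck_of_forward {l μ β : ℝ} (hμ : μ < 1) {p : ℝ × ℝ} (hp : p ≠ (0, -β))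
    (h : ∀ᶠ t in 𝓝[>] (0 : ℝ), flowY μ β p t ∈ SigMinus) (hp' : p ∈ SigMinus) :
    ¬ Stuck (Zv l μ β).ArcY p := by
  rintro ⟨-, h2⟩
  obtain ⟨T, hT, hT'⟩ := mem_nhdsGT_iff_exists_Ioc_subset.1 h
  have hT : 0 < T := hT
  refine flowY_ne hμ hp hT.ne' (h2 _ (.inl (arcY_iff.2 ⟨T, hT.le, rfl, fun t ht => ?_⟩)))
  rcases ht.1.eq_or_lt with rfl | h0
  · rwa [flowY_zero]
  · exact hT' ⟨h0, ht.2⟩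

theorem not_stuck_of_backward {l μ β : ℝ} (hμ : μ < 1) {p : ℝ × ℝ} (hp : p ≠ (0, -β))
    (h : ∀ᶠ t in 𝓝[>] (0 : ℝ), flowY μ β p (-t) ∈ SigMinus) (hp' : p ∈ SigMinus) :
    ¬ Stuck (Zv l μ β).ArcY p := by
  rintro ⟨-, h2⟩
  obtain ⟨T, hT, hT'⟩ := mem_nhdsGT_iff_exists_Ioc_subset.1 h
  have hT : 0 < T := hT
  refine flowY_ne hμ hp (neg_ne_zero.2 hT.ne') (h2 _ (.inr (arcY_of_backward hT.le fun t ht => ?_)))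
  rcases ht.2.eq_or_lt with rfl | h0
  · rwa [flowY_zero]
  · have := hT' ⟨neg_pos.2 h0, neg_le.1 ht.1⟩
    simpa only [mem_ofPred_eq, neg_neg] using this

/-- Below the line, or where `Y.f ≠ 0`, the orbit stays in `y ≤ 0` for a short time forward or
backward. At the contact it stays there if `β ≤ 0`, and leaves at once in both directions if `β >
0`. The equilibrium has no other arcs anyway. -/
theorem stuck_arcY_iff {l μ β : ℝ} (hμ : μ < 1) {p : ℝ × ℝ} : Stuck (Zv l μ β).ArcY p ↔
    (0 ≤ β ∧ p = (0, -β)) ∨ (0 < β ∧ p = (contact μ β, 0)) := by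
  constructor
  · intro hs
    have hp : p ∈ SigMinus := arc_self_iff.1 hs.1
    by_cases hS : p = (0, -β)
    · refine .inl ⟨?_, hS⟩
      rw [hS] at hp
      exact neg_nonpos.1 hp
    refine .inr ?_
    rcases (show p.2 ≤ 0 from hp).lt_or_eq with hneg | hzero
    · refine absurd hs (not_stuck_of_forward hμ hS ?_ hp)
      have hc : ContinuousAt (fun t => (flowY μ β p t).2) 0 :=
        (continuous_flowY μ β p).snd.continuousAt
      have h1 := hc.eventually (gt_mem_nhds (show (flowY μ β p 0).2 < 0 by rwa [flowY_zero]))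
      exact (h1.filter_mono nhdsWithin_le_nhds).mono fun t ht => ht.le
    rcases lt_trichotomy ((Zv l μ β).Yf p) 0 with h | h | h
    · refine absurd hs (not_stuck_of_forward hμ hS ?_ hp)
      have h1 := eventually_pos_of_hasDerivWithinAt (g := fun t => -(flowY μ β p t).2)
        (by rw [flowY_zero, hzero, neg_zero]) (neg_pos.2 h)
        (hasDerivAt_flowY_snd l μ β p).neg.hasDerivWithinAt
      exact h1.mono fun t ht => (neg_pos.1 ht).le
    · obtain rfl := contact_of_Yf hμ hzero h
      refine ⟨not_le.1 fun hβ => ?_, rfl⟩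
      refine not_stuck_of_forward hμ hS (Eventually.filter_mono nhdsWithin_le_nhds
        (Eventually.of_forall fun t => ?_)) hp hs
      change (flowY μ β _ t).2 ≤ 0
      rw [flowY_contact_snd hμ]
      rcases eq_or_ne t 0 with rfl | ht
      · refine le_of_eq ?_
        rw [mul_zero, Real.exp_zero]; ring
      · exact mul_nonpos_of_nonpos_of_nonneg (div_nonpos_of_nonpos_of_nonneg hβ (by linarith))
          (flowY_contact_factor_pos hμ ht).le
    · refine absurd hs (not_stuck_of_backward hμ hS ?_ hp)
      have h0 : HasDerivAt (fun t => -(flowY μ β p (-t)).2) ((Zv l μ β).Yf p) 0 := by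
        have h2 := hasDerivAt_flowY_snd l μ β p
        rw [← neg_zero] at h2
        exact (h2.scomp 0 (hasDerivAt_neg 0)).neg.congr_deriv (by simp)
      have h1 := eventually_pos_of_hasDerivWithinAt
        (by rw [neg_zero, flowY_zero, hzero, neg_zero]) h h0.hasDerivWithinAt
      exact h1.mono fun t ht => (neg_pos.1 ht).le
  · rintro (⟨hβ, rfl⟩ | ⟨hβ, rfl⟩)
    · refine ⟨arc_self_iff.2 (neg_nonpos.2 hβ), fun q => ?_⟩
      rintro (h | h)
      · obtain ⟨T, -, rfl, -⟩ := arcY_iff.1 h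
        exact flowY_equilibrium _ _ _
      · obtain ⟨T, -, h, -⟩ := arcY_iff.1 h
        have h1 := congrArg (fun w => flowY μ β w (-T)) h
        rwa [flowY_flowY, add_neg_cancel, flowY_zero, flowY_equilibrium, eq_comm] at h1
    · have key : ∀ t, flowY μ β (contact μ β, 0) t ∈ SigMinus → t = 0 := fun t ht => by
        by_contra h0
        refine (show (flowY μ β (contact μ β, 0) t).2 ≤ 0 from ht).not_gt ?_
        rw [flowY_contact_snd hμ]
        exact mul_pos (div_pos hβ (by linarith)) (flowY_contact_factor_pos hμ h0)
      refine ⟨arc_self_iff.2 (show (0 : ℝ) ≤ 0 from le_rfl), fun q => ?_⟩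
      rintro (h | h)
      · obtain ⟨T, hT, rfl, h'⟩ := arcY_iff.1 h
        rw [key T (h' T ⟨hT, le_rfl⟩), flowY_zero]
      · have hq := Arc.left_mem h
        obtain ⟨T, hT, h, -⟩ := arcY_iff.1 h
        have h1 := congrArg (fun w => flowY μ β w (-T)) h
        rw [flowY_flowY, add_neg_cancel, flowY_zero] at h1
        rw [← h1] at hq ⊢
        rw [key _ hq, flowY_zero]

/-- The points at which one of the two fields has no nontrivial arc. -/
def StuckPoint (Z : Sys) (p : ℝ × ℝ) : Prop := Stuck Z.ArcX p ∨ Stuck Z.ArcY p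

theorem stuckPoint_iff {l μ β : ℝ} (hμ : μ < 1) {p : ℝ × ℝ} : StuckPoint (Zv l μ β) p ↔
    (0 ≤ β ∧ p = (0, -β)) ∨ (0 < β ∧ p = (contact μ β, 0)) := by
  rw [StuckPoint, or_iff_right (not_stuck_arcX l μ β p), stuck_arcY_iff hμ]

/-- At a sliding point both fields push against the line, so neither can start an arc in its half
plane; from an escaping point `X` starts upwards. The criterion is symmetric in `X` and `Y`, hence
survives an exchange of the sides. -/
theorem mem_sliding_iff_arcs {l μ β : ℝ} (p : ℝ × ℝ) : p ∈ (Zv l μ β).sliding ↔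
    (Zv l μ β).ArcSig p p ∧ ¬ (Leaves (Zv l μ β).ArcX p ∨ Leaves (Zv l μ β).ArcY p) := by
  rw [ArcSig, arc_self_iff, mem_union]
  constructor
  · intro h
    refine ⟨.inl h, ?_⟩
    rintro (⟨q, hq, h'⟩ | ⟨q, hq, h'⟩)
    · refine hq (Arc.eq_of_pos (-ContinuousLinearMap.snd ℝ ℝ ℝ) ?_ ?_ ?_ h')
      · simpa using mem_Sig.1 h.1
      · have h1 := h.2.1
        rw [Xf, lie_f] at h1
        simpa using h1
      · intro w hw
        have hw : 0 ≤ w.2 := hw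
        simpa using hw
    · refine hq (Arc.eq_of_pos (ContinuousLinearMap.snd ℝ ℝ ℝ) ?_ ?_ ?_ h')
      · exact mem_Sig.1 h.1
      · have h1 := h.2.2
        rwa [Yf, lie_f] at h1
      · exact fun w hw => hw
  · rintro ⟨h | h, h'⟩
    · exact h
    · refine absurd (.inl ⟨flowX l p 1, flowX_ne one_ne_zero, arcX_flowX_one ?_ ?_⟩) h'
      · exact (mem_Sig.1 h.1).ge
      · have h1 := h.2.1
        rw [Xf_eq] at h1
        linarith

/-! ### Topological invariants -/

theorem exists_stuckPoint_iff {l μ β : ℝ} (hμ : μ < 1) :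
    (∃ p, StuckPoint (Zv l μ β) p) ↔ 0 ≤ β := by
  simp only [stuckPoint_iff hμ]
  constructor
  · rintro ⟨p, h | h⟩
    · exact h.1
    · exact h.1.le
  · exact fun h => ⟨_, .inl ⟨h, rfl⟩⟩

theorem exists_stuckPoint_notMem_iff {l μ β : ℝ} (hμ : μ < 1) :
    (∃ p, p ∉ Sig ∧ StuckPoint (Zv l μ β) p) ↔ 0 < β := by
  simp only [stuckPoint_iff hμ]
  constructor
  · rintro ⟨p, h1, ⟨h2, rfl⟩ | h⟩
    · exact h2.lt_of_ne' fun h => h1 (by rw [h, neg_zero]; exact mk_mem_Sig 0)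
    · exact h.1
  · refine fun h => ⟨(0, -β), fun h' => ?_, .inl ⟨h.le, rfl⟩⟩
    have h' : -β = 0 := h'
    linarith

/-- The points of the line outside the domain of the sliding field form the closed interval between
`l` and the contact, which is a single point only if the two agree. -/
theorem forall_notMem_eq_iff {l μ β : ℝ} (hμ : μ < 1) :
    (∀ p q, p ∈ Sig → q ∈ Sig → ¬ (Zv l μ β).ArcSig p p → ¬ (Zv l μ β).ArcSig q q → p = q) ↔
      l = contact μ β := by
  simp only [ArcSig, arc_self_iff]
  constructor
  · intro h
    refine congrArg Prod.fst (h (l, 0) (contact μ β, 0) (mk_mem_Sig _) (mk_mem_Sig _) ?_ ?_) <;>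
      simp [mem_sliding hμ, mem_escaping hμ]
  · rintro h p q hp hq
    rw [eq_line hp, eq_line hq, mem_union, mem_union, mem_sliding hμ, mem_escaping hμ,
      mem_sliding hμ, mem_escaping hμ, h]
    intro h1 h2
    simp only [and_self, not_or, not_lt] at h1 h2
    rw [le_antisymm h1.2 h1.1, le_antisymm h2.2 h2.1]

theorem contact_mem_closure_sliding_iff {l μ β : ℝ} (hμ : μ < 1) :
    (contact μ β, 0) ∈ closure (Zv l μ β).sliding ↔ contact μ β ≤ l := by
  constructor
  · intro h
    have h1 : (Zv l μ β).sliding ⊆ {p | p.1 ≤ l} := fun p hp => by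
      have := hp.2.1
      rw [Xf_eq] at this
      exact (sub_neg.1 this).le
    exact closure_minimal h1 (isClosed_le continuous_fst continuous_const) h
  · intro h
    have h1 : (fun x : ℝ => ((x, 0) : ℝ × ℝ)) '' Iio (contact μ β) ⊆ (Zv l μ β).sliding := by
      rintro _ ⟨x, hx, rfl⟩
      exact (mem_sliding hμ).2 ⟨lt_of_lt_of_le hx h, hx⟩
    refine closure_mono h1 (image_closure_subset_closure_image (by fun_prop) ⟨_, ?_, rfl⟩)
    rw [closure_Iio]
    exact self_mem_Iic

/-- For `β > 0` the saddle is off the line, so the only stuck point on it is the invisible fold; the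
sliding half-line reaches it exactly when it does not end earlier, at `l`. -/
theorem forall_stuckPoint_mem_closure_iff {l μ β : ℝ} (hμ : μ < 1) (hβ : 0 < β) :
    (∀ p, p ∈ Sig → StuckPoint (Zv l μ β) p → p ∈ closure (Zv l μ β).sliding) ↔
      contact μ β ≤ l := by
  rw [← contact_mem_closure_sliding_iff hμ]
  constructor
  · exact fun h => h _ (mk_mem_Sig _) ((stuckPoint_iff hμ).2 (.inr ⟨hβ, rfl⟩))
  · intro h p hp hs
    rcases (stuckPoint_iff hμ).1 hs with ⟨-, rfl⟩ | ⟨-, rfl⟩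
    · have hp : -β = 0 := hp
      linarith
    · exact h

/-- Each invariant is a statement about arcs, the line and closures which is symmetric in `X` and
`Y`; an exchange of the sides only swaps the two halves of a disjunction. -/
theorem sameType_of_topEquiv {l β l' β' μ : ℝ} (hμ : μ < 1)
    (h : TopEquiv (Zv l μ β) (Zv l' μ β')) : SameType l β l' β' μ := by
  obtain ⟨h, hSig, hArc, hXY⟩ := h
  have hSig' : ∀ p, p ∈ Sig ↔ h p ∈ Sig := fun p => by
    rw [← hSig, h.injective.mem_set_image, hSig]
  have hStuck : ∀ p, StuckPoint (Zv l μ β) p ↔ StuckPoint (Zv l' μ β') (h p) := by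
    intro p
    rcases hXY with hXY | hXY
    · exact or_congr (stuck_iff_of_equiv (fun p q => (hXY p q).1) p)
        (stuck_iff_of_equiv (fun p q => (hXY p q).2) p)
    · exact (or_congr (stuck_iff_of_equiv (fun p q => (hXY p q).1) p)
        (stuck_iff_of_equiv (fun p q => (hXY p q).2) p)).trans or_comm
  have hLeaves : ∀ p, Leaves (Zv l μ β).ArcX p ∨ Leaves (Zv l μ β).ArcY p ↔
      Leaves (Zv l' μ β').ArcX (h p) ∨ Leaves (Zv l' μ β').ArcY (h p) := by
    intro p
    rcases hXY with hXY | hXY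
    · exact or_congr (leaves_iff_of_equiv (fun p q => (hXY p q).1) p)
        (leaves_iff_of_equiv (fun p q => (hXY p q).2) p)
    · exact (or_congr (leaves_iff_of_equiv (fun p q => (hXY p q).1) p)
        (leaves_iff_of_equiv (fun p q => (hXY p q).2) p)).trans or_comm
  have hslide : ∀ p, p ∈ (Zv l μ β).sliding ↔ h p ∈ (Zv l' μ β').sliding := fun p => by
    rw [mem_sliding_iff_arcs, mem_sliding_iff_arcs, hArc, hLeaves]
  have hclosure : ∀ p, p ∈ closure (Zv l μ β).sliding ↔ h p ∈ closure (Zv l' μ β').sliding := by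
    intro p
    have h1 : (Zv l μ β).sliding = h ⁻¹' (Zv l' μ β').sliding := Set.ext hslide
    rw [h1, ← h.preimage_closure, mem_preimage]
  have hpos : 0 < β ↔ 0 < β' := by
    rw [← exists_stuckPoint_notMem_iff (l := l) hμ, ← exists_stuckPoint_notMem_iff (l := l') hμ]
    exact h.toEquiv.exists_congr fun p => and_congr (not_congr (hSig' p)) (hStuck p)
  refine ⟨?_, hpos, ?_, fun hβ => ?_⟩
  · rw [← not_le, ← not_le, not_iff_not, ← exists_stuckPoint_iff (l := l) hμ,
      ← exists_stuckPoint_iff (l := l') hμ]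
    exact h.toEquiv.exists_congr hStuck
  · rw [← forall_notMem_eq_iff hμ, ← forall_notMem_eq_iff hμ]
    refine h.toEquiv.forall_congr fun p => h.toEquiv.forall_congr fun q => ?_
    change _ ↔ (h p ∈ Sig → h q ∈ Sig → ¬ (Zv l' μ β').ArcSig (h p) (h p) →
      ¬ (Zv l' μ β').ArcSig (h q) (h q) → h p = h q)
    rw [hSig' p, hSig' q, hArc p p, hArc q q, h.injective.eq_iff]
  · rw [← not_le, ← not_le, not_iff_not, ← forall_stuckPoint_mem_closure_iff hμ hβ,
      ← forall_stuckPoint_mem_closure_iff hμ (hpos.1 hβ)]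
    refine h.toEquiv.forall_congr fun p => ?_
    rw [hSig', hStuck, hclosure]
    rfl

/-! ### Closed paths through a two-fold point -/

theorem Sys.Follows.congr {V : ℝ × ℝ → ℝ × ℝ} {D : Set (ℝ × ℝ)} {γ γ' : ℝ → ℝ × ℝ} {a b : ℝ}
    (h : Follows V D γ a b) (he : EqOn γ' γ (Ioo a b)) : Follows V D γ' a b := by
  intro t ht
  obtain ⟨h1, h2, c, hc, h3⟩ := h t ht
  rw [he ht]
  exact ⟨h1, h2, c, hc, h3.congr_of_eventuallyEq (he.eventuallyEq_of_mem (Ioo_mem_nhds ht.1 ht.2))⟩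

/-- A closed path that runs from `(c, 0)` to `(a, 0)` along the line, from `(a, 0)` to `(b, 0)`
along `σ`, and from `(b, 0)` back to `(c, 0)` along the line. -/
def loop (c a b : ℝ) (σ : ℝ → ℝ × ℝ) (t : ℝ) : ℝ × ℝ :=
  if t ≤ 1 / 3 then (c + 3 * (a - c) * t, 0)
  else if t < 2 / 3 then σ t
  else (c - 3 * (c - b) + 3 * (c - b) * t, 0)

section

variable {c a b : ℝ} {σ : ℝ → ℝ × ℝ}

theorem loop_first {t : ℝ} (h : t ≤ 1 / 3) : loop c a b σ t = (c + 3 * (a - c) * t, 0) :=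
  if_pos h

theorem loop_last {t : ℝ} (h : 2 / 3 ≤ t) :
    loop c a b σ t = (c - 3 * (c - b) + 3 * (c - b) * t, 0) := by
  rw [loop, if_neg (by linarith), if_neg h.not_gt]

theorem loop_zero : loop c a b σ 0 = (c, 0) := by
  rw [loop_first (by norm_num), mul_zero, add_zero]

theorem loop_one : loop c a b σ 1 = (c, 0) := by
  rw [loop_last (by norm_num), mul_one, sub_add_cancel]

end

/-- The hypotheses on the middle part of the path. -/
structure IsBridge (c a b : ℝ) (σ : ℝ → ℝ × ℝ) : Prop where
  lt_start : c < a
  end_lt : b < c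
  cont : Continuous σ
  start_eq : σ (1 / 3) = (a, 0)
  end_eq : σ (2 / 3) = (b, 0)
  neg : ∀ t ∈ Ioo (1 / 3 : ℝ) (2 / 3), (σ t).2 < 0
  inj : Function.Injective σ

namespace IsBridge

variable {c a b : ℝ} {σ : ℝ → ℝ × ℝ} (B : IsBridge c a b σ)

include B

theorem loop_middle {t : ℝ} (h : t ∈ Icc (1 / 3 : ℝ) (2 / 3)) : loop c a b σ t = σ t := by
  rcases h.1.eq_or_lt with rfl | h1
  · rw [loop_first le_rfl, B.start_eq]
    exact Prod.ext (by dsimp only; ring) rfl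
  · rw [loop, if_neg h1.not_ge]
    rcases h.2.eq_or_lt with rfl | h2
    · rw [if_neg (lt_irrefl _), B.end_eq]
      exact Prod.ext (by dsimp only; ring) rfl
    · rw [if_pos h2]

theorem continuousOn_loop : ContinuousOn (loop c a b σ) (Icc 0 1) := by
  have h1 : ContinuousOn (loop c a b σ) (Iic (1 / 3)) :=
    ContinuousOn.congr (f := fun t => (c + 3 * (a - c) * t, 0)) (by fun_prop)
      fun t ht => loop_first ht
  have h2 : ContinuousOn (loop c a b σ) (Icc (1 / 3) (2 / 3)) :=
    B.cont.continuousOn.congr fun t ht => B.loop_middle ht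
  have h3 : ContinuousOn (loop c a b σ) (Ici (2 / 3)) :=
    ContinuousOn.congr (f := fun t => (c - 3 * (c - b) + 3 * (c - b) * t, 0)) (by fun_prop)
      fun t ht => loop_last ht
  refine ((h1.union_of_isClosed h2 isClosed_Iic isClosed_Icc).union_of_isClosed h3
    (isClosed_Iic.union isClosed_Icc) isClosed_Ici).mono fun t _ => ?_
  rcases le_total t (1 / 3) with h | h
  · exact .inl (.inl h)
  · rcases le_total t (2 / 3) with h' | h'
    · exact .inl (.inr ⟨h, h'⟩)
    · exact .inr h'

/-- The pieces are kept apart by position: the first has abscissa at least `c`, the last has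
abscissa below `c` before time `1`, and the middle one lies strictly below the line. -/
theorem injOn_loop : InjOn (loop c a b σ) (Ico 0 1) := by
  have ha := sub_pos.2 B.lt_start
  have hb := sub_pos.2 B.end_lt
  have key : ∀ s ∈ Ico (0 : ℝ) 1, ∀ t ∈ Ico (0 : ℝ) 1, s < t →
      loop c a b σ s ≠ loop c a b σ t := by
    intro s hs t ht hst h
    rcases le_or_gt t (1 / 3) with h1 | h1
    · rw [loop_first h1, loop_first (hst.le.trans h1)] at h
      have := congrArg Prod.fst h
      dsimp only at this
      nlinarith
    rcases lt_or_ge t (2 / 3) with h2 | h2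
    · rw [B.loop_middle ⟨h1.le, h2.le⟩] at h
      rcases le_or_gt s (1 / 3) with h3 | h3
      · rw [loop_first h3] at h
        exact (B.neg t ⟨h1, h2⟩).ne (congrArg Prod.snd h).symm
      · rw [B.loop_middle ⟨h3.le, (hst.trans h2).le⟩] at h
        exact hst.ne (B.inj h)
    · rw [loop_last h2] at h
      rcases le_or_gt s (1 / 3) with h3 | h3
      · rw [loop_first h3] at h
        have := congrArg Prod.fst h
        dsimp only at this
        have h4 := mul_pos hb (sub_pos.2 ht.2)
        have h5 := mul_nonneg ha.le hs.1
        nlinarith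
      rcases lt_or_ge s (2 / 3) with h4 | h4
      · rw [B.loop_middle ⟨h3.le, h4.le⟩] at h
        exact (B.neg s ⟨h3, h4⟩).ne (congrArg Prod.snd h)
      · rw [loop_last h4] at h
        have := congrArg Prod.fst h
        dsimp only at this
        nlinarith
  intro s hs t ht h
  rcases lt_trichotomy s t with hst | hst | hst
  · exact absurd h (key s hs t ht hst)
  · exact hst
  · exact absurd h.symm (key t ht s hs hst)

theorem image_loop : loop c a b σ '' Icc 0 1 =
    (fun x : ℝ => ((x, 0) : ℝ × ℝ)) '' Icc b a ∪ σ '' Icc (1 / 3) (2 / 3) := by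
  have ha := sub_pos.2 B.lt_start
  have hb := sub_pos.2 B.end_lt
  apply Subset.antisymm
  · rintro _ ⟨t, ht, rfl⟩
    rcases le_total t (1 / 3) with h1 | h1
    · rw [loop_first h1]
      refine .inl ⟨_, ⟨?_, ?_⟩, rfl⟩
      · have := mul_nonneg ha.le ht.1
        linarith
      · nlinarith
    rcases le_total t (2 / 3) with h2 | h2
    · rw [B.loop_middle ⟨h1, h2⟩]
      exact .inr ⟨t, ⟨h1, h2⟩, rfl⟩
    · rw [loop_last h2]
      refine .inl ⟨_, ⟨?_, ?_⟩, rfl⟩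
      · nlinarith
      · have := mul_nonneg hb.le (sub_nonneg.2 ht.2)
        linarith
  · rintro _ (⟨x, hx, rfl⟩ | ⟨t, ht, rfl⟩)
    · rcases le_total c x with h | h
      · have h1 : (x - c) / (3 * (a - c)) ≤ 1 / 3 := by
          rw [div_le_iff₀ (by linarith)]
          linarith [hx.2]
        have h0 : 0 ≤ (x - c) / (3 * (a - c)) := div_nonneg (by linarith) (by linarith)
        refine ⟨_, ⟨h0, by linarith⟩, ?_⟩
        rw [loop_first h1, mul_div_cancel₀ _ (by linarith)]
        exact Prod.ext (by dsimp only; ring) rfl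
      · have h1 : (c - x) / (3 * (c - b)) ≤ 1 / 3 := by
          rw [div_le_iff₀ (by linarith)]
          linarith [hx.1]
        have h0 : 0 ≤ (c - x) / (3 * (c - b)) := div_nonneg (by linarith) (by linarith)
        refine ⟨1 - (c - x) / (3 * (c - b)), ⟨by linarith, by linarith⟩, ?_⟩
        have h2 : 3 * (c - b) * ((c - x) / (3 * (c - b))) = c - x :=
          mul_div_cancel₀ _ (by linarith)
        rw [loop_last (by linarith)]
        exact Prod.ext (by dsimp only; linarith) rfl
    · exact ⟨t, ⟨by linarith [ht.1], by linarith [ht.2]⟩, B.loop_middle ht⟩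

end IsBridge

/-- As `Follows` allows any positive speed, uniform motion to the right is good enough wherever the
field points right; the factor is `m / H`. -/
theorem follows_line {Z : Sys} (hZ : ∀ p, (Z.field p).2 = 0) {γ : ℝ → ℝ × ℝ} {s t u m : ℝ}
    (hm : 0 < m) (hγ : ∀ x ∈ Ioo s t, γ x = (u + m * x, 0))
    (hD : ∀ x ∈ Ioo s t, (u + m * x, 0) ∈ Z.sliding ∪ Z.escaping)
    (hH : ∀ x ∈ Ioo s t, 0 < Z.H (u + m * x)) :
    Follows Z.field (Z.sliding ∪ Z.escaping) γ s t := by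
  refine Follows.congr (γ := fun x => (u + m * x, 0)) (fun x hx => ⟨hD x hx, ?_,
    m / Z.H (u + m * x), div_pos hm (hH x hx), ?_⟩) hγ
  · exact fun h => (hH x hx).ne' (congrArg Prod.fst h)
  · have h1 : HasDerivAt (fun x : ℝ => ((u + m * x, 0) : ℝ × ℝ)) (m * 1, 0) x :=
      (((hasDerivAt_id x).const_mul m).const_add u).prodMk (hasDerivAt_const x 0)
    refine h1.congr_deriv (Prod.ext ?_ ?_)
    · exact (mul_one m).trans (div_mul_cancel₀ m (hH x hx).ne').symm
    · rw [Prod.smul_snd, hZ, smul_zero]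

theorem Roots.singular_contact {l μ β q p : ℝ} (R : Roots l μ β q p) :
    (Zv l μ β).Singular (contact μ β, 0) :=
  R.singular_iff.2 (.inr (.inl rfl))

section TwoFold

variable {l μ β q p : ℝ} (R : Roots l μ β q p) (h : l = contact μ β)
include R h

/-- For `l = c` also `p = c`, so the field points to the right on the whole escaping half-line. -/
theorem Roots.follows_first {a b : ℝ} {σ : ℝ → ℝ × ℝ} (B : IsBridge (contact μ β) a b σ) :
    Follows (Zv l μ β).field ((Zv l μ β).sliding ∪ (Zv l μ β).escaping)
      (loop (contact μ β) a b σ) 0 (1 / 3) := by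
  have ha := sub_pos.2 B.lt_start
  have hp := R.contact_eq_root (.inr h)
  have key : ∀ x ∈ Ioo (0 : ℝ) (1 / 3), contact μ β < contact μ β + 3 * (a - contact μ β) * x :=
    fun x hx => by
      have := mul_pos ha hx.1
      linarith
  refine follows_line (field_snd l μ β) (by linarith : 0 < 3 * (a - contact μ β))
    (fun x hx => loop_first hx.2.le) (fun x hx => .inr ?_) (fun x hx => ?_)
  · exact (mem_escaping R.lt_one).2 ⟨h.trans_lt (key x hx), key x hx⟩
  · exact (R.H_escaping_pos (h.trans_lt (key x hx)) (key x hx)).2 (hp.trans_lt (key x hx))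

/-- Between `q` and `p = c` the sliding field also points to the right, hence leads from `b` back to
the two-fold. -/
theorem Roots.follows_last {a b : ℝ} {σ : ℝ → ℝ × ℝ} (B : IsBridge (contact μ β) a b σ)
    (hq : q < b) : Follows (Zv l μ β).field ((Zv l μ β).sliding ∪ (Zv l μ β).escaping)
      (loop (contact μ β) a b σ) (2 / 3) 1 := by
  have hb := sub_pos.2 B.end_lt
  have hp := R.contact_eq_root (.inr h)
  have key : ∀ x ∈ Ioo (2 / 3 : ℝ) 1,
      contact μ β - 3 * (contact μ β - b) + 3 * (contact μ β - b) * x < contact μ β :=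
    fun x hx => by
      have := mul_pos hb (sub_pos.2 hx.2)
      linarith
  refine follows_line (field_snd l μ β) (by linarith : 0 < 3 * (contact μ β - b))
    (fun x hx => loop_last hx.1.le) (fun x hx => .inl ?_) (fun x hx => ?_)
  · exact (mem_sliding R.lt_one).2 ⟨(key x hx).trans_eq h.symm, key x hx⟩
  · refine (R.H_sliding_pos ((key x hx).trans_eq h.symm) (key x hx)).2
      ⟨?_, (key x hx).trans_eq hp.symm⟩
    have := mul_pos hb (sub_pos.2 hx.1)
    linarith

theorem Roots.sigmaGraphIII_of_sigmaGraph {a b : ℝ} {σ : ℝ → ℝ × ℝ}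
    (B : IsBridge (contact μ β) a b σ)
    (hG : (Zv l μ β).SigmaGraph (loop (contact μ β) a b σ '' Icc 0 1)) :
    (Zv l μ β).SigmaGraphIII (loop (contact μ β) a b σ '' Icc 0 1) := by
  -- Inclusion holds because, for `l = c`, every other point of the line is sliding or escaping. It
  -- is proper since `(b - 1, 0)` is a sliding point to the left of the loop.
  refine ⟨hG, (ssubset_iff_of_subset ?_).2 ⟨(b - 1, 0), .inl ?_, ?_⟩⟩
  · rintro w ⟨⟨-, hw⟩, hw'⟩
    rw [eq_line hw] at hw' ⊢
    rw [Xf_line_eq_zero, Yf_line_eq_zero R.lt_one, h, or_self] at hw'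
    rw [mem_union, mem_sliding R.lt_one, mem_escaping R.lt_one, h, and_self, and_self]
    exact lt_or_gt_of_ne hw'
  · have := B.end_lt
    rw [mem_sliding R.lt_one, h]
    constructor <;> linarith
  · rintro ⟨⟨hw, -⟩, -⟩
    rw [B.image_loop] at hw
    rcases hw with ⟨x, hx, hx'⟩ | ⟨t, ht, ht'⟩
    · have := congrArg Prod.fst hx'
      dsimp only at this
      linarith [hx.1]
    · have h2 := B.lt_start
      have h3 := B.end_lt
      rcases ht.1.eq_or_lt with rfl | h0
      · rw [B.start_eq] at ht'
        have := congrArg Prod.fst ht'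
        dsimp only at this
        linarith
      rcases ht.2.eq_or_lt with rfl | h1
      · rw [B.end_eq] at ht'
        have := congrArg Prod.fst ht'
        dsimp only at this
        linarith
      · exact (B.neg t ⟨h0, h1⟩).ne (congrArg Prod.snd ht')

/-- The middle part is one arc of `Y`. -/
theorem Roots.sigmaGraphIII_of_arc {a b : ℝ} {σ : ℝ → ℝ × ℝ} (B : IsBridge (contact μ β) a b σ)
    (hq : q < b) (hσ : Follows (Zv l μ β).Y SigMinus σ (1 / 3) (2 / 3)) :
    (Zv l μ β).SigmaGraphIII (loop (contact μ β) a b σ '' Icc 0 1) := by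
  have h0 : loop (contact μ β) a b σ 0 = (contact μ β, 0) := loop_zero
  have h1 : loop (contact μ β) a b σ 1 = (contact μ β, 0) := loop_one
  refine R.sigmaGraphIII_of_sigmaGraph h B ⟨⟨_, ⟨0, by norm_num, h0⟩, mk_mem_Sig _⟩,
    loop (contact μ β) a b σ, 3, ![0, 1 / 3, 2 / 3, 1], ?_, rfl, rfl, B.continuousOn_loop,
    h0.trans h1.symm, B.injOn_loop, rfl, h0 ▸ R.singular_contact, fun k => .inr ?_, fun k => ?_⟩
  · rw [Fin.strictMono_iff_lt_succ]
    intro k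
    fin_cases k
    · exact (by norm_num : (0 : ℝ) < 1 / 3)
    · exact (by norm_num : (1 / 3 : ℝ) < 2 / 3)
    · exact (by norm_num : (2 / 3 : ℝ) < 1)
  · fin_cases k
    · exact congrArg Prod.snd h0
    · exact congrArg Prod.snd (loop_first (le_refl (1 / 3 : ℝ)))
    · exact congrArg Prod.snd (loop_last (le_refl (2 / 3 : ℝ)))
    · exact congrArg Prod.snd h1
  · fin_cases k
    · exact .inr (.inr (R.follows_first h B))
    · exact .inr (.inl (hσ.congr fun t ht => B.loop_middle (Ioo_subset_Icc_self ht)))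
    · exact .inr (.inr (R.follows_last h B hq))

/-- The middle part consists of two arcs of `Y` which are joined at a singular point. -/
theorem Roots.sigmaGraphIII_of_arcs {a b : ℝ} {σ : ℝ → ℝ × ℝ} (B : IsBridge (contact μ β) a b σ)
    (hq : q < b) (hσ : Follows (Zv l μ β).Y SigMinus σ (1 / 3) (1 / 2))
    (hσ' : Follows (Zv l μ β).Y SigMinus σ (1 / 2) (2 / 3))
    (hs : (Zv l μ β).Singular (σ (1 / 2))) :
    (Zv l μ β).SigmaGraphIII (loop (contact μ β) a b σ '' Icc 0 1) := by
  have h0 : loop (contact μ β) a b σ 0 = (contact μ β, 0) := loop_zero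
  have h1 : loop (contact μ β) a b σ 1 = (contact μ β, 0) := loop_one
  refine R.sigmaGraphIII_of_sigmaGraph h B ⟨⟨_, ⟨0, by norm_num, h0⟩, mk_mem_Sig _⟩,
    loop (contact μ β) a b σ, 4, ![0, 1 / 3, 1 / 2, 2 / 3, 1], ?_, rfl, rfl, B.continuousOn_loop,
    h0.trans h1.symm, B.injOn_loop, rfl, h0 ▸ R.singular_contact, fun k => ?_, fun k => ?_⟩
  · rw [Fin.strictMono_iff_lt_succ]
    intro k
    fin_cases k
    · exact (by norm_num : (0 : ℝ) < 1 / 3)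
    · exact (by norm_num : (1 / 3 : ℝ) < 1 / 2)
    · exact (by norm_num : (1 / 2 : ℝ) < 2 / 3)
    · exact (by norm_num : (2 / 3 : ℝ) < 1)
  · fin_cases k
    · exact .inr (congrArg Prod.snd h0)
    · exact .inr (congrArg Prod.snd (loop_first (le_refl (1 / 3 : ℝ))))
    · refine .inl ?_
      change (Zv l μ β).Singular (loop (contact μ β) a b σ (1 / 2))
      rwa [B.loop_middle ⟨by norm_num, by norm_num⟩]
    · exact .inr (congrArg Prod.snd (loop_last (le_refl (2 / 3 : ℝ))))
    · exact .inr (congrArg Prod.snd h1)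
  · fin_cases k
    · exact .inr (.inr (R.follows_first h B))
    · exact .inr (.inl (hσ.congr fun t ht => B.loop_middle ⟨ht.1.le, by linarith [ht.2]⟩))
    · exact .inr (.inl (hσ'.congr fun t ht => B.loop_middle ⟨by linarith [ht.1], ht.2.le⟩))
    · exact .inr (.inr (R.follows_last h B hq))

end TwoFold

/-! ### The triangle -/

/-- The path along the separatrices of the saddle, from `(β, 0)` to `(-β, 0)`. -/
def sepPath (β t : ℝ) : ℝ × ℝ := (3 * β - 6 * β * t, |3 * β - 6 * β * t| - β)

theorem isBridge_sepPath {μ β : ℝ} (h0 : 0 < μ) (h1 : μ < 1) (hβ : 0 < β) :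
    IsBridge (contact μ β) β (-β) (sepPath β) where
  lt_start := contact_lt h1 hβ
  end_lt := by linarith [contact_pos h0 h1 hβ]
  cont := by unfold sepPath; fun_prop
  start_eq := by
    have : 3 * β - 6 * β * (1 / 3) = β := by ring
    rw [sepPath, this, abs_of_pos hβ, sub_self]
  end_eq := by
    have : 3 * β - 6 * β * (2 / 3) = -β := by ring
    rw [sepPath, this, abs_neg, abs_of_pos hβ, sub_self]
  neg t ht := by
    refine sub_neg.2 (abs_lt.2 ⟨?_, ?_⟩) <;> nlinarith [ht.1, ht.2]
  inj s t h := by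
    have h := congrArg Prod.fst h
    simp only [sepPath, sub_right_inj] at h
    exact mul_left_cancel₀ (by linarith : 6 * β ≠ 0) h

/-- On the side `jS` the field is `-(1 - μ)(x, x)`, parallel to the side. The speed factor blows up
at the saddle, where `Follows`, being a condition on the open interval, asks for nothing. -/
theorem follows_sepPath_stable {l μ β : ℝ} (h1 : μ < 1) (hβ : 0 < β) :
    Follows (Zv l μ β).Y SigMinus (sepPath β) (1 / 3) (1 / 2) := by
  refine Follows.congr (γ := fun t => (3 * β - 6 * β * t, 3 * β - 6 * β * t - β))
    (fun t ht => ?_) (fun t ht => ?_)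
  · have hx : 0 < 3 * β - 6 * β * t := by nlinarith [ht.2]
    have hY : (Zv l μ β).Y (3 * β - 6 * β * t, 3 * β - 6 * β * t - β) =
        (-(1 - μ) * (3 * β - 6 * β * t), -(1 - μ) * (3 * β - 6 * β * t)) := by
      refine Prod.ext ?_ ?_ <;> simp only [Zv] <;> ring
    have hn : 0 < (1 - μ) * (3 * β - 6 * β * t) := mul_pos (by linarith) hx
    refine ⟨?_, fun h => ?_, 6 * β / ((1 - μ) * (3 * β - 6 * β * t)), by positivity, ?_⟩
    · change 3 * β - 6 * β * t - β ≤ 0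
      nlinarith [ht.1]
    · rw [hY] at h
      have := congrArg Prod.fst h
      simp only [Prod.fst_zero] at this
      linarith
    · have h2 : HasDerivAt (fun t : ℝ => 3 * β - 6 * β * t) (-(6 * β * 1)) t :=
        ((hasDerivAt_id t).const_mul (6 * β)).const_sub (3 * β)
      refine (h2.prodMk (h2.sub_const β)).congr_deriv ?_
      rw [hY, Prod.smul_mk, smul_eq_mul, neg_mul, mul_neg, div_mul_cancel₀ _ hn.ne', mul_one]
  · have hx : 0 ≤ 3 * β - 6 * β * t := by nlinarith [ht.2]
    rw [sepPath, abs_of_nonneg hx]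

theorem follows_sepPath_unstable {l μ β : ℝ} (hβ : 0 < β) :
    Follows (Zv l μ β).Y SigMinus (sepPath β) (1 / 2) (2 / 3) := by
  refine Follows.congr (γ := fun t => (3 * β - 6 * β * t, -(3 * β - 6 * β * t) - β))
    (fun t ht => ?_) (fun t ht => ?_)
  · have hx : 0 < -(3 * β - 6 * β * t) := by nlinarith [ht.1]
    have hY : (Zv l μ β).Y (3 * β - 6 * β * t, -(3 * β - 6 * β * t) - β) =
        (-(-(3 * β - 6 * β * t)), -(3 * β - 6 * β * t)) := by
      refine Prod.ext ?_ ?_ <;> simp only [Zv] <;> ring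
    refine ⟨?_, fun h => ?_, 6 * β / -(3 * β - 6 * β * t), by positivity, ?_⟩
    · change -(3 * β - 6 * β * t) - β ≤ 0
      nlinarith [ht.2]
    · rw [hY] at h
      exact hx.ne' (congrArg Prod.snd h)
    · have h2 : HasDerivAt (fun t : ℝ => 3 * β - 6 * β * t) (-(6 * β * 1)) t :=
        ((hasDerivAt_id t).const_mul (6 * β)).const_sub (3 * β)
      refine (h2.prodMk (h2.neg.sub_const β)).congr_deriv ?_
      rw [hY, Prod.smul_mk, smul_eq_mul, smul_eq_mul, mul_neg, div_mul_cancel₀ _ hx.ne', mul_one,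
        neg_neg]
  · have hx : 3 * β - 6 * β * t ≤ 0 := by nlinarith [ht.1]
    rw [sepPath, abs_of_nonpos hx]

theorem segment_line {a b : ℝ} (h : a ≤ b) :
    segment ℝ ((a, 0) : ℝ × ℝ) (b, 0) = (fun x : ℝ => ((x, 0) : ℝ × ℝ)) '' Icc a b := by
  rw [← segment_eq_Icc h, segment_eq_image, segment_eq_image, image_image]
  simp

theorem image_sepPath {β : ℝ} (hβ : 0 < β) : sepPath β '' Icc (1 / 3) (2 / 3) =
    segment ℝ ((β, 0) : ℝ × ℝ) (0, -β) ∪ segment ℝ ((0, -β) : ℝ × ℝ) (-β, 0) := by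
  have key1 : ∀ θ ≤ (1 : ℝ), (1 - θ) • ((β, 0) : ℝ × ℝ) + θ • ((0, -β) : ℝ × ℝ) =
      sepPath β (1 / 3 + θ / 6) := fun θ hθ => by
    have h1 : 3 * β - 6 * β * (1 / 3 + θ / 6) = (1 - θ) * β := by ring
    rw [sepPath, h1, abs_of_nonneg (mul_nonneg (sub_nonneg.2 hθ) hβ.le)]
    refine Prod.ext ?_ ?_ <;> simp
    ring
  have key2 : ∀ θ, (0 : ℝ) ≤ θ → (1 - θ) • ((0, -β) : ℝ × ℝ) + θ • ((-β, 0) : ℝ × ℝ) =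
      sepPath β (1 / 2 + θ / 6) := fun θ hθ => by
    have h1 : 3 * β - 6 * β * (1 / 2 + θ / 6) = -(θ * β) := by ring
    rw [sepPath, h1, abs_neg, abs_of_nonneg (mul_nonneg hθ hβ.le)]
    refine Prod.ext ?_ ?_ <;> simp
    ring
  rw [segment_eq_image, segment_eq_image]
  apply Subset.antisymm
  · rintro _ ⟨t, ht, rfl⟩
    rcases le_total t (1 / 2) with h | h
    · refine .inl ⟨6 * t - 2, ⟨by linarith [ht.1], by linarith⟩, ?_⟩
      dsimp only
      rw [key1 _ (by linarith)]
      congr 1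
      ring
    · refine .inr ⟨6 * t - 3, ⟨by linarith, by linarith [ht.2]⟩, ?_⟩
      dsimp only
      rw [key2 _ (by linarith)]
      congr 1
      ring
  · rintro _ (⟨θ, hθ, rfl⟩ | ⟨θ, hθ, rfl⟩)
    · dsimp only
      rw [key1 _ hθ.2]
      exact ⟨_, ⟨by linarith [hθ.1], by linarith [hθ.2]⟩, rfl⟩
    · dsimp only
      rw [key2 _ hθ.1]
      exact ⟨_, ⟨by linarith [hθ.1], by linarith [hθ.2]⟩, rfl⟩

theorem Roots.sigmaGraphIII_triangle {l μ β q p : ℝ} (R : Roots l μ β q p) (hβ : 0 < β)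
    (h : l = contact μ β) : (Zv l μ β).SigmaGraphIII
      (segment ℝ (-β, 0) (β, 0) ∪ segment ℝ (β, 0) (0, -β) ∪ segment ℝ (0, -β) (-β, 0)) := by
  have B := isBridge_sepPath R.pos R.lt_one hβ
  rw [union_assoc, ← image_sepPath hβ, segment_line (by linarith), ← B.image_loop]
  refine R.sigmaGraphIII_of_arcs h B R.lt_neg (follows_sepPath_stable R.lt_one hβ)
    (follows_sepPath_unstable hβ) (R.singular_iff.2 (.inr (.inr (.inl ⟨hβ.le, ?_⟩))))
  have : 3 * β - 6 * β * (1 / 2) = 0 := by ring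
  rw [sepPath, this, abs_zero, zero_sub]

/-- The barycentric coordinates with respect to `h`, `j`, `S` are `-v / (2β)`, `u / (2β)`, `-y / β`.
-/
theorem mem_triangle_of_le {β x y : ℝ} (hβ : 0 < β) (hy : y ≤ 0) (hu : 0 ≤ x + (y + β))
    (hv : x - (y + β) ≤ 0) : (x, y) ∈ convexHull ℝ {((-β, 0) : ℝ × ℝ), (β, 0), (0, -β)} := by
  have h := (convex_convexHull ℝ {((-β, 0) : ℝ × ℝ), (β, 0), (0, -β)}).sum_mem
    (t := Finset.univ) (w := ![-(x - (y + β)) / (2 * β), (x + (y + β)) / (2 * β), -y / β])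
    (z := ![(-β, 0), (β, 0), (0, -β)]) ?_ ?_ ?_
  · convert h using 1
    refine Prod.ext ?_ ?_
    · simp [Fin.sum_univ_three]
      field_simp
      ring
    · simp [Fin.sum_univ_three]
      field_simp
  · intro i _
    fin_cases i
    · exact div_nonneg (neg_nonneg.2 hv) (by linarith)
    · exact div_nonneg hu (by linarith)
    · exact div_nonneg (neg_nonneg.2 hy) hβ.le
  · simp only [Fin.sum_univ_three, Matrix.cons_val]
    field_simp
    ring
  · intro i _
    apply subset_convexHull
    fin_cases i <;> simp

theorem le_of_mem_triangle {β : ℝ} {w : ℝ × ℝ} (hβ : 0 < β)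
    (h : w ∈ convexHull ℝ {((-β, 0) : ℝ × ℝ), (β, 0), (0, -β)}) :
    w.2 ≤ 0 ∧ 0 ≤ w.1 + (w.2 + β) ∧ w.1 - (w.2 + β) ≤ 0 := by
  refine convexHull_min (t := {w | w.2 ≤ 0 ∧ 0 ≤ w.1 + (w.2 + β) ∧ w.1 - (w.2 + β) ≤ 0}) ?_ ?_ h
  · rintro _ (rfl | rfl | rfl) <;> refine ⟨?_, ?_, ?_⟩ <;> dsimp only <;> linarith
  · rintro u ⟨h1, h2, h3⟩ v ⟨h4, h5, h6⟩ a b ha hb hab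
    obtain rfl : b = 1 - a := by linarith
    refine ⟨?_, ?_, ?_⟩ <;>
      simp only [Prod.fst_add, Prod.snd_add, Prod.smul_fst, Prod.smul_snd, smul_eq_mul]
    · nlinarith
    · nlinarith [mul_nonneg ha h2, mul_nonneg hb h5]
    · nlinarith [mul_nonneg ha (neg_nonneg.2 h3), mul_nonneg hb (neg_nonneg.2 h6)]

/-- For each inequality, a small step in a direction that worsens it still stays in the triangle, so
it had to be strict. -/
theorem lt_of_mem_interior_triangle {β : ℝ} {w : ℝ × ℝ} (hβ : 0 < β)
    (h : w ∈ interior (convexHull ℝ {((-β, 0) : ℝ × ℝ), (β, 0), (0, -β)})) :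
    w.2 < 0 ∧ 0 < w.1 + (w.2 + β) ∧ w.1 - (w.2 + β) < 0 := by
  have key : ∀ v : ℝ × ℝ, ∃ s : ℝ, 0 < s ∧
      w + s • v ∈ convexHull ℝ {((-β, 0) : ℝ × ℝ), (β, 0), (0, -β)} := fun v => by
    have hc : Continuous fun s : ℝ => w + s • v := by fun_prop
    have h1 : ∀ᶠ s in 𝓝 (0 : ℝ), w + s • v ∈
        convexHull ℝ {((-β, 0) : ℝ × ℝ), (β, 0), (0, -β)} := by
      refine hc.continuousAt.eventually_mem ?_
      rw [zero_smul, add_zero]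
      exact mem_interior_iff_mem_nhds.1 h
    obtain ⟨s, hs, hs'⟩ := ((h1.filter_mono nhdsWithin_le_nhds).and
      (self_mem_nhdsWithin (s := Ioi (0 : ℝ)))).exists
    exact ⟨s, hs', hs⟩
  refine ⟨?_, ?_, ?_⟩
  · obtain ⟨s, hs, h1⟩ := key (0, 1)
    have := (le_of_mem_triangle hβ h1).1
    simp at this
    linarith
  · obtain ⟨s, hs, h1⟩ := key (-1, 0)
    have := (le_of_mem_triangle hβ h1).2.1
    simp at this
    linarith
  · obtain ⟨s, hs, h1⟩ := key (1, 0)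
    have := (le_of_mem_triangle hβ h1).2.2
    simp at this
    linarith

/-! ### Orbits of `Y` inside the triangle -/

/-- With `u ≥ 0 ≥ v` the ordinate is a nonnegative combination of exponentials up to a constant, so
it lies above its tangent at time `0`, whose slope is `Y.f`. -/
theorem le_flowY_snd {l μ β : ℝ} {w : ℝ × ℝ} (hu : 0 ≤ w.1 + (w.2 + β))
    (hv : w.1 - (w.2 + β) ≤ 0) (t : ℝ) :
    w.2 + t * (Zv l μ β).Yf w ≤ (flowY μ β w t).2 := by
  have h1 := mul_le_mul_of_nonneg_left (Real.add_one_le_exp (-(1 - μ) * t)) hu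
  have h2 := mul_le_mul_of_nonpos_left (Real.add_one_le_exp t) hv
  rw [Yf_eq, flowY]
  dsimp only
  linarith

theorem convexOn_flowY_snd (μ : ℝ) {β : ℝ} {w : ℝ × ℝ} (hu : 0 ≤ w.1 + (w.2 + β))
    (hv : w.1 - (w.2 + β) ≤ 0) : ConvexOn ℝ univ fun t => (flowY μ β w t).2 := by
  have h1 : ConvexOn ℝ univ fun t : ℝ => Real.exp (-(1 - μ) * t) :=
    convexOn_exp.comp_linearMap (LinearMap.mulLeft ℝ (-(1 - μ)))
  have h2 := ((h1.smul (show 0 ≤ (w.1 + (w.2 + β)) / 2 by linarith)).add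
    (convexOn_exp.smul (show 0 ≤ -(w.1 - (w.2 + β)) / 2 by linarith))).add_const (-β)
  refine h2.congr fun t _ => ?_
  simp only [flowY, Pi.add_apply, smul_eq_mul]
  ring

/-- The orbit of `Y` through an interior point of the triangle meets the line before and after. -/
theorem exists_flowY_mem_line {μ β : ℝ} (hμ : μ < 1) {w : ℝ × ℝ} (hy : w.2 < 0)
    (hu : 0 < w.1 + (w.2 + β)) (hv : w.1 - (w.2 + β) < 0) :
    ∃ t₁ t₂ : ℝ, t₁ < 0 ∧ 0 < t₂ ∧ (flowY μ β w t₁).2 = 0 ∧ (flowY μ β w t₂).2 = 0 ∧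
      ∀ t ∈ Ioo t₁ t₂, (flowY μ β w t).2 < 0 := by
  have hc : Continuous fun t => (flowY μ β w t).2 := (continuous_flowY μ β w).snd
  have h0 : (flowY μ β w 0).2 < 0 := by rwa [flowY_zero]
  have e1 : ∃ T, 0 < T ∧ 0 < (flowY μ β w T).2 := by
    have h1 := Real.tendsto_exp_atTop.const_mul_atTop (show 0 < -(w.1 - (w.2 + β)) / 2 by linarith)
    obtain ⟨T, hT, hT'⟩ := ((h1.eventually_gt_atTop β).and (eventually_gt_atTop 0)).exists
    refine ⟨T, hT', ?_⟩
    have := mul_pos hu (Real.exp_pos (-(1 - μ) * T))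
    simp only [flowY]
    linarith
  have e2 : ∃ T, T < 0 ∧ 0 < (flowY μ β w T).2 := by
    have h1 := (Real.tendsto_exp_atTop.comp ((tendsto_const_mul_atTop_of_neg
      (show -(1 - μ) < 0 by linarith)).2 tendsto_id)).const_mul_atTop
      (show 0 < (w.1 + (w.2 + β)) / 2 by linarith)
    obtain ⟨T, hT, hT'⟩ := ((h1.eventually_gt_atTop β).and (eventually_lt_atBot 0)).exists
    refine ⟨T, hT', ?_⟩
    have := mul_pos (neg_pos.2 hv) (Real.exp_pos T)
    simp only [flowY]
    simp only [Function.comp_apply, id_eq] at hT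
    linarith
  obtain ⟨T, hT, hT'⟩ := e1
  obtain ⟨T', hT1, hT1'⟩ := e2
  obtain ⟨t₂, ht₂, h2⟩ := intermediate_value_Ioo hT.le hc.continuousOn ⟨h0, hT'⟩
  obtain ⟨t₁, ht₁, h1⟩ := intermediate_value_Ioo' hT1.le hc.continuousOn ⟨h0, hT1'⟩
  dsimp only at h1 h2
  refine ⟨t₁, t₂, ht₁.2, ht₂.1, h1, h2, fun t ht => ?_⟩
  -- Between a zero and the time `0`, where the ordinate is negative, convexity keeps it below a
  -- negative chord.
  have hconv := (convexOn_flowY_snd μ hu.le hv.le).2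
  rcases le_total t 0 with h | h
  · have h3 := hconv (mem_univ t₁) (mem_univ 0) (div_nonneg_of_nonpos h ht₁.2.le)
      (sub_nonneg.2 ((div_le_one_of_neg ht₁.2).2 ht.1.le)) (add_sub_cancel _ 1)
    have h4 : 0 < 1 - t / t₁ := sub_pos.2 ((div_lt_one_of_neg ht₁.2).2 ht.1)
    simp only [smul_eq_mul, mul_zero, add_zero, h1, zero_add, div_mul_cancel₀ t ht₁.2.ne] at h3
    exact h3.trans_lt (mul_neg_of_pos_of_neg h4 h0)
  · have h3 := hconv (mem_univ t₂) (mem_univ 0) (div_nonneg h ht₂.1.le)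
      (sub_nonneg.2 ((div_le_one ht₂.1).2 ht.2.le)) (add_sub_cancel _ 1)
    have h4 : 0 < 1 - t / t₂ := sub_pos.2 ((div_lt_one ht₂.1).2 ht.2)
    simp only [smul_eq_mul, mul_zero, add_zero, h2, zero_add, div_mul_cancel₀ t ht₂.1.ne'] at h3
    exact h3.trans_lt (mul_neg_of_pos_of_neg h4 h0)

/-- The orbit of `Y` through `w`, parametrized such that `[1 / 3, 2 / 3]` is mapped to the piece
between the times `s` and `t`. -/
def orbitPath (μ β : ℝ) (w : ℝ × ℝ) (s t x : ℝ) : ℝ × ℝ :=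
  flowY μ β w (s - (t - s) + 3 * (t - s) * x)

theorem follows_orbitPath {l μ β : ℝ} (hμ : μ < 1) {w : ℝ × ℝ} {s t : ℝ} (hst : s < t)
    (hv : w.1 - (w.2 + β) < 0) (hneg : ∀ x ∈ Ioo s t, (flowY μ β w x).2 < 0) :
    Follows (Zv l μ β).Y SigMinus (orbitPath μ β w s t) (1 / 3) (2 / 3) := by
  intro x hx
  have hpos := sub_pos.2 hst
  refine ⟨(hneg _ ⟨by nlinarith [hx.1], by nlinarith [hx.2]⟩).le, fun h => ?_, 3 * (t - s),
    by linarith, ?_⟩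
  · have h1 := flowY_sub_coord μ β w (s - (t - s) + 3 * (t - s) * x)
    rw [orbitPath, Y_eq_zero hμ] at h
    rw [h] at h1
    have := mul_neg_of_neg_of_pos hv (Real.exp_pos (s - (t - s) + 3 * (t - s) * x))
    dsimp only at h1
    linarith
  · have h1 : HasDerivAt (fun x => s - (t - s) + 3 * (t - s) * x) (3 * (t - s) * 1) x :=
      ((hasDerivAt_id x).const_mul _).const_add _
    rw [mul_one] at h1
    exact (hasDerivAt_flowY l μ β w _).scomp x h1

theorem Roots.exists_sigmaGraphIII {l μ β q p : ℝ} (R : Roots l μ β q p) (hβ : 0 < β)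
    (h : l = contact μ β) {w : ℝ × ℝ}
    (hw : w ∈ interior (convexHull ℝ {((-β, 0) : ℝ × ℝ), (β, 0), (0, -β)})) :
    ∃ Δ : Set (ℝ × ℝ), w ∈ Δ ∧ (l, 0) ∈ Δ ∧
      Δ ⊆ convexHull ℝ {((-β, 0) : ℝ × ℝ), (β, 0), (0, -β)} ∧ (Zv l μ β).SigmaGraphIII Δ := by
  have hμ := R.lt_one
  obtain ⟨hy, hu, hv⟩ := lt_of_mem_interior_triangle hβ hw
  obtain ⟨s, t, hs, ht, hs0, ht0, hneg⟩ := exists_flowY_mem_line hμ hy hu hv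
  have hst := hs.trans ht
  have hpos := sub_pos.2 hst
  have hcoord : ∀ x, 0 < (flowY μ β w x).1 + ((flowY μ β w x).2 + β) ∧
      (flowY μ β w x).1 - ((flowY μ β w x).2 + β) < 0 := fun x => by
    rw [flowY_add_coord, flowY_sub_coord]
    exact ⟨mul_pos hu (Real.exp_pos _), mul_neg_of_neg_of_pos hv (Real.exp_pos _)⟩
  -- The tangent at a hitting time `x`, followed back to `w`, must be negative because `w` lies
  -- below the line. So `Y.f < 0` at the earlier hit and `Y.f > 0` at the later one, which places
  -- them right and left of the contact.
  have htan : ∀ x, (flowY μ β w x).2 = 0 →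
      -x * (Zv l μ β).Yf ((flowY μ β w x).1, 0) < 0 := fun x hx => by
    have h1 := le_flowY_snd (l := l) (μ := μ) (hcoord x).1.le (hcoord x).2.le (-x)
    rw [flowY_flowY, add_neg_cancel, flowY_zero, hx, zero_add,
      eq_line (p := flowY μ β w x) hx] at h1
    exact h1.trans_lt hy
  have ha : contact μ β < (flowY μ β w s).1 := by
    refine (Yf_line_neg hμ (l := l)).1 ?_
    have := htan s hs0
    nlinarith
  have hb : (flowY μ β w t).1 < contact μ β := by
    refine (Yf_line_pos hμ (l := l)).1 ?_
    have := htan t ht0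
    nlinarith
  have B : IsBridge (contact μ β) (flowY μ β w s).1 (flowY μ β w t).1 (orbitPath μ β w s t) :=
    { lt_start := ha
      end_lt := hb
      cont := (continuous_flowY μ β w).comp (by fun_prop)
      start_eq := by
        have : s - (t - s) + 3 * (t - s) * (1 / 3) = s := by ring
        rw [orbitPath, this]
        exact eq_line hs0
      end_eq := by
        have : s - (t - s) + 3 * (t - s) * (2 / 3) = t := by ring
        rw [orbitPath, this]
        exact eq_line ht0
      neg := fun x hx => hneg _ ⟨by nlinarith [hx.1], by nlinarith [hx.2]⟩
      inj := fun x y hxy => by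
        have h1 := flowY_sub_coord μ β w (s - (t - s) + 3 * (t - s) * x)
        have h2 := flowY_sub_coord μ β w (s - (t - s) + 3 * (t - s) * y)
        have h3 : flowY μ β w (s - (t - s) + 3 * (t - s) * x) =
          flowY μ β w (s - (t - s) + 3 * (t - s) * y) := hxy
        rw [h3, h2] at h1
        have h4 := Real.exp_injective (mul_left_cancel₀ hv.ne h1)
        exact (mul_left_cancel₀ (by linarith : 3 * (t - s) ≠ 0) (add_left_cancel h4)).symm }
  have hsub : ∀ x ∈ Icc s t, flowY μ β w x ∈
      convexHull ℝ {((-β, 0) : ℝ × ℝ), (β, 0), (0, -β)} := fun x hx => by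
    refine mem_triangle_of_le hβ ?_ (hcoord x).1.le (hcoord x).2.le
    rcases hx.1.eq_or_lt with rfl | h1
    · exact hs0.le
    rcases hx.2.eq_or_lt with rfl | h2
    · exact ht0.le
    · exact (hneg x ⟨h1, h2⟩).le
  have hsa := hcoord s
  have htb := hcoord t
  rw [hs0] at hsa
  rw [ht0] at htb
  refine ⟨_, ?_, ?_, ?_, R.sigmaGraphIII_of_arc h B ?_ (follows_orbitPath hμ hst hv hneg)⟩
  · rw [B.image_loop]
    -- The parameter that corresponds to time `0`, that is, to `w` itself.
    refine .inr ⟨1 / 3 + -s / (3 * (t - s)), ⟨?_, ?_⟩, ?_⟩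
    · have : 0 ≤ -s / (3 * (t - s)) := div_nonneg (by linarith) (by linarith)
      linarith
    · have : -s / (3 * (t - s)) ≤ 1 / 3 := by
        rw [div_le_iff₀ (by linarith)]
        linarith
      linarith
    · have : s - (t - s) + 3 * (t - s) * (1 / 3 + -s / (3 * (t - s))) = 0 := by
        rw [mul_add, mul_div_cancel₀ _ (by linarith)]
        ring
      rw [orbitPath, this, flowY_zero]
  · rw [B.image_loop, h]
    exact .inl ⟨_, ⟨hb.le, ha.le⟩, rfl⟩
  · rw [B.image_loop]
    rintro _ (⟨x, hx, rfl⟩ | ⟨x, hx, rfl⟩)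
    · exact mem_triangle_of_le hβ le_rfl (by linarith [hx.1]) (by linarith [hx.2])
    · exact hsub _ ⟨by nlinarith [hx.1], by nlinarith [hx.2]⟩
  · linarith [R.lt_neg]

/-! ### The regions of the bifurcation diagram -/

theorem exists_region (l μ β : ℝ) : ∃ k, Region l μ β k := by
  rcases lt_trichotomy β 0 with hβ | hβ | hβ
  · rcases lt_trichotomy l (contact μ β) with h | h | h
    · exact ⟨.c1, hβ, h⟩
    · exact ⟨.c2, hβ, h⟩
    · exact ⟨.c3, hβ, h⟩
  · rcases lt_trichotomy l 0 with h | h | h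
    · exact ⟨.c4, hβ, h⟩
    · exact ⟨.c5, hβ, h⟩
    · exact ⟨.c6, hβ, h⟩
  · rcases lt_trichotomy l (contact μ β) with h | h | h
    · rcases lt_trichotomy l (-β) with h' | h' | h'
      · exact ⟨.c7, hβ, h'⟩
      · exact ⟨.c8, hβ, h'⟩
      · exact ⟨.c9, hβ, h', h⟩
    · exact ⟨.c10, hβ, h⟩
    · rcases lt_trichotomy l β with h' | h' | h'
      · exact ⟨.c11, hβ, h, h'⟩
      · exact ⟨.c12, hβ, h'⟩
      · exact ⟨.c13, hβ, h'⟩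

theorem region_unique {l μ β : ℝ} (h0 : 0 < μ) (h1 : μ < 1) {k m : Case}
    (hk : Region l μ β k) (hm : Region l μ β m) : k = m := by
  have hc : 0 < β → 0 < contact μ β ∧ contact μ β < β := fun h =>
    ⟨contact_pos h0 h1 h, contact_lt h1 h⟩
  cases k <;> simp only [Region] at hk <;> cases m <;> first
    | rfl
    | (exfalso; simp only [Region] at hm; grind)

theorem sameOrder_of_region {l β l' β' μ : ℝ} (h0 : 0 < μ) (h1 : μ < 1) {k : Case}
    (h : Region l μ β k) (h' : Region l' μ β' k) : SameOrder l β l' β' μ := by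
  have hc : 0 < β → 0 < contact μ β ∧ contact μ β < β := fun h =>
    ⟨contact_pos h0 h1 h, contact_lt h1 h⟩
  have hc' : 0 < β' → 0 < contact μ β' ∧ contact μ β' < β' := fun h =>
    ⟨contact_pos h0 h1 h, contact_lt h1 h⟩
  have hz : β = 0 → contact μ β = 0 := fun h => h ▸ contact_zero μ
  have hz' : β' = 0 → contact μ β' = 0 := fun h => h ▸ contact_zero μ
  cases k <;> simp only [Region] at h h' <;> constructor <;> grind

theorem SameOrder.region {l β l' β' μ : ℝ} (h : SameOrder l β l' β' μ) {k : Case}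
    (hk : Region l μ β k) : Region l' μ β' k := by
  have hz : β = 0 → contact μ β = 0 := fun h => h ▸ contact_zero μ
  have hz' : β' = 0 → contact μ β' = 0 := fun h => h ▸ contact_zero μ
  obtain ⟨h1, h2, h3, h4, h5, h6, h7, h8⟩ := h
  cases k <;> simp only [Region] at hk ⊢ <;> grind

theorem sameOrder_iff {l β l' β' μ : ℝ} (h0 : 0 < μ) (h1 : μ < 1) {k m : Case}
    (hk : Region l μ β k) (hm : Region l' μ β' m) : SameOrder l β l' β' μ ↔ k = m :=
  ⟨fun h => region_unique h0 h1 (h.region hk) hm,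
    fun h => sameOrder_of_region h0 h1 hk (h ▸ hm)⟩

/-- The union of the regions with the same behaviour as a representative region. -/
def TypeRegion (l μ β : ℝ) : Case → Prop
  | .c1 => β < 0 ∧ l ≠ contact μ β
  | .c2 => β < 0 ∧ l = contact μ β
  | .c4 => β = 0 ∧ l ≠ contact μ β
  | .c5 => β = 0 ∧ l = contact μ β
  | .c7 => 0 < β ∧ l < contact μ β
  | .c10 => 0 < β ∧ l = contact μ β
  | .c11 => 0 < β ∧ contact μ β < l
  | _ => False

theorem typeRegion_of_region {l β μ : ℝ} (h0 : 0 < μ) (h1 : μ < 1) {k : Case}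
    (h : Region l μ β k) : TypeRegion l μ β k.rep := by
  have hc : 0 < β → 0 < contact μ β ∧ contact μ β < β := fun h =>
    ⟨contact_pos h0 h1 h, contact_lt h1 h⟩
  have hz : β = 0 → contact μ β = 0 := fun h => h ▸ contact_zero μ
  cases k <;> simp only [Region] at h <;> simp only [Case.rep, TypeRegion] <;> grind

theorem typeRegion_unique {l μ β : ℝ} {k m : Case}
    (hk : TypeRegion l μ β k) (hm : TypeRegion l μ β m) : k = m := by
  cases k <;> simp only [TypeRegion] at hk <;> cases m <;> first
    | rfl
    | (exfalso; simp only [TypeRegion] at hm <;> grind)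

theorem sameType_iff {l β l' β' μ : ℝ} (h0 : 0 < μ) (h1 : μ < 1) {k m : Case}
    (hk : Region l μ β k) (hm : Region l' μ β' m) : SameType l β l' β' μ ↔ k.rep = m.rep := by
  have hk' := typeRegion_of_region h0 h1 hk
  have hm' := typeRegion_of_region h0 h1 hm
  constructor
  · rintro ⟨e1, e2, e3, e4⟩
    refine typeRegion_unique (l := l') (β := β') (μ := μ) ?_ hm'
    revert hk'
    cases k.rep <;> simp only [TypeRegion] <;> grind
  · intro h
    rw [← h] at hm'
    revert hk' hm'
    cases k.rep <;> simp only [TypeRegion, false_imp_iff] <;> intro e1 e2 <;> constructor <;> grind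

/-- The witnesses scale with `s`. In the two outermost regions for `β > 0` the value `β = s / 2`
leaves room for `|l| > β` within the bound `s`. -/
theorem exists_region_near {μ s : ℝ} (h0 : 0 < μ) (h1 : μ < 1) (hs : 0 < s) (k : Case) :
    ∃ l β, |l| ≤ s ∧ |β| ≤ s ∧ Region l μ β k := by
  have hp := contact_pos h0 h1 hs
  have hp' := contact_lt h1 hs
  have hn := contact_neg h0 h1 (neg_lt_zero.2 hs)
  have hn' := lt_contact h1 (neg_lt_zero.2 hs)
  simp only [abs_le]
  cases k with
  | c1 => exact ⟨-s, -s, by grind, by grind, by linarith, by linarith⟩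
  | c2 => exact ⟨contact μ (-s), -s, by grind, by grind, by linarith, rfl⟩
  | c3 => exact ⟨0, -s, by grind, by grind, by linarith, by linarith⟩
  | c4 => exact ⟨-s, 0, by grind, by grind, rfl, by linarith⟩
  | c5 => exact ⟨0, 0, by grind, by grind, rfl, rfl⟩
  | c6 => exact ⟨s, 0, by grind, by grind, rfl, hs⟩
  | c7 => exact ⟨-s, s / 2, by grind, by grind, by linarith, by linarith⟩
  | c8 => exact ⟨-s, s, by grind, by grind, hs, rfl⟩
  | c9 => exact ⟨0, s, by grind, by grind, hs, by linarith, by linarith⟩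
  | c10 => exact ⟨contact μ s, s, by grind, by grind, hs, rfl⟩
  | c11 => exact ⟨(contact μ s + s) / 2, s, by grind, by grind, hs, by linarith, by linarith⟩
  | c12 => exact ⟨s, s, by grind, by grind, hs, rfl⟩
  | c13 => exact ⟨s, s / 2, by grind, by grind, by linarith, by linarith⟩

/-! ### Numbers of classes -/

/-- If `g` is a complete invariant, the relation is its kernel and the classes are its values. -/
theorem natCard_quotient_eq {α β : Type*} (s : Setoid α) (g : α → β)
    (h : ∀ a b, s a b ↔ g a = g b) : Nat.card (Quotient s) = (range g).ncard := by
  obtain rfl : s = Setoid.ker g := Setoid.ext h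
  rw [← Nat.card_coe_set_eq]
  exact Nat.card_congr (Setoid.quotientKerEquivRange g)

deriving instance DecidableEq for Case

instance : Fintype Case where
  elems := {.c1, .c2, .c3, .c4, .c5, .c6, .c7, .c8, .c9, .c10, .c11, .c12, .c13}
  complete k := by cases k <;> decide

theorem ncard_univ_case : (univ : Set Case).ncard = 13 := by
  rw [ncard_univ, Nat.card_eq_fintype_card]
  rfl

theorem ncard_range_rep : (range Case.rep).ncard = 7 := by
  rw [← image_univ, ← Finset.coe_univ, ← Finset.coe_image, ncard_coe_finset]
  rfl

end FoldSaddle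

end

/-! ### Assembly of the bifurcation diagram -/

theorem theorem5 (r : ℝ) (hr0 : 0 < r) (hr1 : r < 1) :
    ∃ ε₀ : ℝ, 0 < ε₀ ∧ ∀ μ : ℝ, 0 < μ → μ < ε₀ →
      -- thirteen configurations, seven behaviours
      Nat.card (Quotient (FoldSaddle.configSetoid μ r)) = 13 ∧
      Nat.card (Quotient (FoldSaddle.behaviourSetoid μ r)) = 7 ∧
      -- the bifurcation diagram: thirteen regions, all of them adherent to the origin
      (∀ a : FoldSaddle.Box r, ∃! k, FoldSaddle.Region a.1.1 μ a.1.2 k) ∧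
      (∀ k, ∀ δ > 0, ∃ a : FoldSaddle.Box r,
        |a.1.1| < δ ∧ |a.1.2| < δ ∧ FoldSaddle.Region a.1.1 μ a.1.2 k) ∧
      (∀ (a b : FoldSaddle.Box r) (k m : FoldSaddle.Case),
        FoldSaddle.Region a.1.1 μ a.1.2 k → FoldSaddle.Region b.1.1 μ b.1.2 m →
        (FoldSaddle.Sys.SameConfig
            (FoldSaddle.Zv a.1.1 μ a.1.2) (FoldSaddle.Zv b.1.1 μ b.1.2) ↔ k = m) ∧
        (FoldSaddle.Sys.SameBehaviour
            (FoldSaddle.Zv a.1.1 μ a.1.2) (FoldSaddle.Zv b.1.1 μ b.1.2) ↔ k.rep = m.rep) ∧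
        -- different behaviours are topologically different
        (FoldSaddle.Sys.TopEquiv
            (FoldSaddle.Zv a.1.1 μ a.1.2) (FoldSaddle.Zv b.1.1 μ b.1.2) → k.rep = m.rep)) ∧
      -- the pictures
      (∀ l β : ℝ, |l| < r → |β| < r →
        -- `d = (l, 0)` is the only contact of `X`, and a visible fold
        (∀ x : ℝ, (FoldSaddle.Zv l μ β).Xf (x, 0) = 0 ↔ x = l) ∧
        (FoldSaddle.Zv l μ β).VisFoldX (l, 0) ∧
        -- the contact of `Y`, its saddle and the separatrices
        (∀ x : ℝ, (FoldSaddle.Zv l μ β).Yf (x, 0) = 0 ↔ x = FoldSaddle.contact μ β) ∧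
        (∀ p : ℝ × ℝ, (FoldSaddle.Zv l μ β).Y p = 0 ↔ p = (0, -β)) ∧
        FoldSaddle.Sys.HypSaddle (FoldSaddle.Zv l μ β).Y (0, -β) ∧
        (β < 0 → (FoldSaddle.Zv l μ β).VisFoldY (FoldSaddle.contact μ β, 0)) ∧
        (0 < β → (FoldSaddle.Zv l μ β).InvFoldY (FoldSaddle.contact μ β, 0)) ∧
        (∀ p : ℝ × ℝ, (FoldSaddle.Zv l μ β).UnstableHit p ↔ 0 < β ∧ p = (-β, 0)) ∧
        (∀ p : ℝ × ℝ, (FoldSaddle.Zv l μ β).StableHit p ↔ 0 < β ∧ p = (β, 0)) ∧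
        -- sliding on the left, escaping on the right, sewing in between
        (∀ x : ℝ, (x, 0) ∈ (FoldSaddle.Zv l μ β).sliding ↔ x < min l (FoldSaddle.contact μ β)) ∧
        (∀ x : ℝ, (x, 0) ∈ (FoldSaddle.Zv l μ β).escaping ↔ max l (FoldSaddle.contact μ β) < x) ∧
        (∀ x : ℝ, (x, 0) ∈ (FoldSaddle.Zv l μ β).sewing ↔
          min l (FoldSaddle.contact μ β) < x ∧ x < max l (FoldSaddle.contact μ β)) ∧
        -- the additional saddle `(q, 0)` on the left, and the other pseudo-equilibrium
        (∃ q : ℝ, q < min l (FoldSaddle.contact μ β) ∧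
          (FoldSaddle.Zv l μ β).SigmaSaddle (q, 0) ∧
          (∀ x < q, (FoldSaddle.Zv l μ β).H x < 0) ∧
          ((β ≤ 0 ∨ l = FoldSaddle.contact μ β) →
            (∀ p : ℝ × ℝ, (FoldSaddle.Zv l μ β).Pseudo p ↔ p = (q, 0)) ∧
            (∀ x, q < x → x < min l (FoldSaddle.contact μ β) → 0 < (FoldSaddle.Zv l μ β).H x) ∧
            (∀ x, max l (FoldSaddle.contact μ β) < x → 0 < (FoldSaddle.Zv l μ β).H x)) ∧
          (0 < β → l < FoldSaddle.contact μ β →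
            (∀ x, q < x → x < l → 0 < (FoldSaddle.Zv l μ β).H x) ∧
            ∃ p₀ : ℝ, FoldSaddle.contact μ β < p₀ ∧
              (FoldSaddle.Zv l μ β).SigmaRepeller (p₀, 0) ∧
              (∀ p : ℝ × ℝ, (FoldSaddle.Zv l μ β).Pseudo p ↔ p = (q, 0) ∨ p = (p₀, 0)) ∧
              (∀ x, FoldSaddle.contact μ β < x → x < p₀ → (FoldSaddle.Zv l μ β).H x < 0) ∧
              (∀ x, p₀ < x → 0 < (FoldSaddle.Zv l μ β).H x)) ∧
          (0 < β → FoldSaddle.contact μ β < l →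
            (∀ x, l < x → 0 < (FoldSaddle.Zv l μ β).H x) ∧
            ∃ p₀ : ℝ, q < p₀ ∧ p₀ < FoldSaddle.contact μ β ∧
              (FoldSaddle.Zv l μ β).SigmaAttractor (p₀, 0) ∧
              (∀ p : ℝ × ℝ, (FoldSaddle.Zv l μ β).Pseudo p ↔ p = (q, 0) ∨ p = (p₀, 0)) ∧
              (∀ x, q < x → x < p₀ → 0 < (FoldSaddle.Zv l μ β).H x) ∧
              (∀ x, p₀ < x → x < FoldSaddle.contact μ β → (FoldSaddle.Zv l μ β).H x < 0))) ∧
        -- fold on fold below the saddle connection: the family of graphs of kind III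
        (0 < β → l = FoldSaddle.contact μ β →
          (FoldSaddle.Zv l μ β).SigmaGraphIII
            (segment ℝ (-β, 0) (β, 0) ∪ segment ℝ (β, 0) (0, -β) ∪ segment ℝ (0, -β) (-β, 0)) ∧
          ∀ w ∈ interior (convexHull ℝ {((-β, 0) : ℝ × ℝ), (β, 0), (0, -β)}),
            ∃ Δ : Set (ℝ × ℝ), w ∈ Δ ∧ (l, 0) ∈ Δ ∧
              Δ ⊆ convexHull ℝ {((-β, 0) : ℝ × ℝ), (β, 0), (0, -β)} ∧
              (FoldSaddle.Zv l μ β).SigmaGraphIII Δ)) := by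
  -- The bound under which `exists_roots` separates `q` from the square.
  refine ⟨(1 - r) ^ 2 / 16, by have := sub_pos.2 hr1; positivity, fun μ hμ0 hμ => ?_⟩
  have hμ1 : μ < 1 := by nlinarith
  have hroots : ∀ a : FoldSaddle.Box r, ∃ q p, FoldSaddle.Roots a.1.1 μ a.1.2 q p := fun a =>
    FoldSaddle.exists_roots hr1 hμ0 hμ a.2.1 a.2.2
  have huniq : ∀ a : FoldSaddle.Box r, ∃! k, FoldSaddle.Region a.1.1 μ a.1.2 k := fun a =>
    (FoldSaddle.exists_region _ _ _).imp fun k hk =>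
      ⟨hk, fun m hm => FoldSaddle.region_unique hμ0 hμ1 hm hk⟩
  have hnear : ∀ k, ∀ δ > 0, ∃ a : FoldSaddle.Box r,
      |a.1.1| < δ ∧ |a.1.2| < δ ∧ FoldSaddle.Region a.1.1 μ a.1.2 k := fun k δ hδ => by
    -- Halved because the representatives satisfy only non-strict bounds, while the square and the
    -- `δ`-neighbourhood are open.
    have hs : 0 < min δ r / 2 := half_pos (lt_min hδ hr0)
    obtain ⟨l, β, h1, h2, h3⟩ := FoldSaddle.exists_region_near hμ0 hμ1 hs k
    have h4 := half_lt_self (lt_min hδ hr0)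
    have h5 := lt_min_iff.1 (h1.trans_lt h4)
    have h6 := lt_min_iff.1 (h2.trans_lt h4)
    exact ⟨⟨(l, β), h5.2, h6.2⟩, h5.1, h6.1, h3⟩
  have hclass : ∀ (a b : FoldSaddle.Box r) (k m : FoldSaddle.Case),
      FoldSaddle.Region a.1.1 μ a.1.2 k → FoldSaddle.Region b.1.1 μ b.1.2 m →
      (FoldSaddle.Sys.SameConfig (FoldSaddle.Zv a.1.1 μ a.1.2) (FoldSaddle.Zv b.1.1 μ b.1.2) ↔
        k = m) ∧
      (FoldSaddle.Sys.SameBehaviour (FoldSaddle.Zv a.1.1 μ a.1.2) (FoldSaddle.Zv b.1.1 μ b.1.2) ↔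
        k.rep = m.rep) := fun a b k m hk hm => by
    obtain ⟨q, p, R⟩ := hroots a
    obtain ⟨q', p', R'⟩ := hroots b
    rw [← FoldSaddle.sameOrder_iff hμ0 hμ1 hk hm, ← FoldSaddle.sameType_iff hμ0 hμ1 hk hm]
    exact ⟨⟨FoldSaddle.sameOrder_of_sameConfig hμ1, FoldSaddle.sameConfig_of_sameOrder R R'⟩,
      ⟨FoldSaddle.sameType_of_sameBehaviour R R', FoldSaddle.sameBehaviour_of_sameType R R'⟩⟩
  -- The region as a function of the parameters is a complete invariant of the configuration, and
  -- `Case.rep ∘ g` one of the behaviour. As every region meets the square, the classes are counted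
  -- by all cases and by the values of `Case.rep`.
  choose g hg using fun a => (huniq a).exists
  have hg_surj : Function.Surjective g := fun k => by
    obtain ⟨a, -, -, ha⟩ := hnear k 1 one_pos
    exact ⟨a, (huniq a).unique (hg a) ha⟩
  refine ⟨?_, ?_, huniq, hnear, fun a b k m hk hm => ⟨(hclass a b k m hk hm).1,
    (hclass a b k m hk hm).2, fun h => (FoldSaddle.sameType_iff hμ0 hμ1 hk hm).1
      (FoldSaddle.sameType_of_topEquiv hμ1 h)⟩, fun l β hl hβ => ?_⟩
  · rw [FoldSaddle.natCard_quotient_eq _ g fun a b => (hclass a b _ _ (hg a) (hg b)).1,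
      hg_surj.range_eq, FoldSaddle.ncard_univ_case]
  · rw [FoldSaddle.natCard_quotient_eq _ (FoldSaddle.Case.rep ∘ g)
      fun a b => (hclass a b _ _ (hg a) (hg b)).2, hg_surj.range_comp, FoldSaddle.ncard_range_rep]
  obtain ⟨q, p, R⟩ := FoldSaddle.exists_roots hr1 hμ0 hμ hl hβ
  refine ⟨fun x => FoldSaddle.Xf_line_eq_zero, FoldSaddle.visFoldX_iff.2 rfl,
    fun x => FoldSaddle.Yf_line_eq_zero hμ1, fun w => FoldSaddle.Y_eq_zero hμ1,
    (FoldSaddle.hypSaddle_Y hμ1).2 rfl, fun h => (FoldSaddle.visFoldY_iff hμ1).2 ⟨h, rfl⟩,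
    fun h => (FoldSaddle.invFoldY_iff hμ1).2 ⟨h, rfl⟩, fun w => FoldSaddle.unstableHit_iff hμ1,
    fun w => FoldSaddle.stableHit_iff hμ1,
    fun x => (FoldSaddle.mem_sliding hμ1).trans lt_min_iff.symm,
    fun x => (FoldSaddle.mem_escaping hμ1).trans max_lt_iff.symm,
    fun x => FoldSaddle.mem_sewing hμ1,
    ⟨q, lt_min R.lt_fold R.lt_contact, R.sigmaSaddle_iff.2 rfl, fun x => R.H_neg_of_lt,
      fun h => ?_, fun h1 h2 => ?_, fun h1 h2 => ?_⟩,
    fun h1 h2 => ⟨R.sigmaGraphIII_triangle h1 h2, fun w hw => R.exists_sigmaGraphIII h1 h2 hw⟩⟩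
  · refine ⟨fun w => ?_, fun x h1 h2 => ?_, fun x h1 => ?_⟩
    · rw [R.pseudo_iff]
      refine or_iff_left ?_
      rintro (⟨⟨h1, h2⟩, -⟩ | ⟨⟨h1, h2⟩, -⟩) <;> rcases h with h | h <;> linarith
    · rw [lt_min_iff] at h2
      refine (R.H_sliding_pos h2.1 h2.2).2 ⟨h1, not_le.1 fun h3 => ?_⟩
      have h4 := R.root_sliding_iff.1 ⟨h3.trans_lt h2.1, h3.trans_lt h2.2⟩
      rcases h with h | h <;> linarith
    · rw [max_lt_iff] at h1
      refine (R.H_escaping_pos h1.1 h1.2).2 (not_le.1 fun h3 => ?_)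
      have h4 := R.root_escaping_iff.1 ⟨h1.1.trans_le h3, h1.2.trans_le h3⟩
      rcases h with h | h <;> linarith
  · obtain ⟨h3, h4⟩ := R.root_escaping_iff.2 ⟨h1, h2⟩
    refine ⟨fun x h5 h6 => (R.H_sliding_pos h6 (h6.trans h2)).2 ⟨h5, h6.trans h3⟩, p, h4,
      R.sigmaRepeller_iff.2 ⟨⟨h1, h2⟩, rfl⟩, fun w => ?_,
      fun x h5 h6 => (R.H_escaping_neg (h2.trans h5) h5).2 h6,
      fun x h5 => (R.H_escaping_pos (h3.trans h5) (h4.trans h5)).2 h5⟩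
    rw [R.pseudo_iff]
    simp only [h1, h2, h2.not_gt, and_false, false_and, false_or, true_and]
  · obtain ⟨h3, h4⟩ := R.root_sliding_iff.2 ⟨h1, h2⟩
    refine ⟨fun x h5 => (R.H_escaping_pos h5 (h2.trans h5)).2 (h3.trans h5), p, R.lt_root, h4,
      R.sigmaAttractor_iff.2 ⟨⟨h1, h2⟩, rfl⟩, fun w => ?_,
      fun x h5 h6 => (R.H_sliding_pos (h6.trans h3) (h6.trans h4)).2 ⟨h5, h6⟩,
      fun x h5 h6 => (R.H_sliding_neg (h6.trans h2) h6).2 (.inr h5)⟩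
    rw [R.pseudo_iff]
    simp only [h1, h2, h2.not_gt, and_false, false_and, or_false, true_and]
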